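/- Setting. Let $N,d,k\ge 1$. For each mode $i\in\{1,\dots,N\}$ let $A_i,Q_i\in\mathbb R^{d\times d}$, $B_i\in\mathbb R^{d\times k}$, $R_i\in\mathbb R^{k\times k}$ with $Q_i\succ0$ and $R_i\succ 0$. Let $(\omega(t))_{t\ge0}$ be a time-homogeneous Markov chain on $\{1,\dots,N\}$ with transition probabilities $p_{ij}$ and initial distribution $\pi$, where $\pi_i>0$ for all $i$, and let $x_0$ be a random vector in $\mathbb R^d$, independent of the chain, with finite second moments and $\mathbb E[x_0x_0^T]\succ0$. For $K=(K_1,\dots,K_N)$ with $K_i\in\mathbb R^{k\times d}$ consider the closed loop $x_{t+1}=\Gamma_{\omega(t)}x_t$, $\Gamma_i=A_i-B_iK_i$, that is, $x_{t+1}=A_{\omega(t)}x_t+B_{\omega(t)}u_t$ with $u_t=-K_{\omega(t)}x_t$, and the cost $$C(K)=\mathbb E\Big[\sum_{t\ge0}x_t^TQ_{\omega(t)}x_t+u_t^TR_{\omega(t)}u_t\Big].$$ Let $\mathbb K$ be the set of all $K$ for which the closed loop is mean-square stable: $\mathbb E[x_tx_t^T]\to0$ for every deterministic initial state and every initial mode.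 Assume $\mathbb K\ne\emptyset$. Notation. For tuples of matrices, products, transposes and inverses are taken componentwise; $\langle V,S\rangle=\sum_i\operatorname{tr}(V_i^TS_i)$, $\|V\|_2=\langle V,V\rangle^{1/2}$, $\|V\|_{\max}=\max_i\|V_i\|$ with $\|\cdot\|$ the maximal singular value, and $\Lambda_{\min}(V)=\min_i\sigma_{\min}(V_i)$ with $\sigma_{\min}$ the minimal singular value. Gradient and Hessian are taken with respect to $\langle\cdot,\cdot\rangle$, and $\|\nabla^2C(K)\|$ is the operator norm with respect to $\|\cdot\|_2$. Put $\mathcal E_i(V)=\sum_jp_{ij}V_j$ and $\mathcal E(V)=(\mathcal E_1(V),\dots,\mathcal E_N(V))$, and for $K\in\mathbb K$ let $P^K$ be the solution of $P_i=Q_i+K_i^TR_iK_i+\Gamma_i^T\mathcal E_i(P)\Gamma_i$ for all $i$, let $\mathbf X^K_i=\sum_{t\ge0}\mathbb E[x_tx_t^T\mathbf 1_{\{\omega(t)=i\}}]$, $\Psi^K=R+B^T\mathcal E(P^K)B$ and $L^K=\Psi^KK-B^T\mathcal E(P^K)A$. Put $\mu=\min_i\pi_i\cdot\sigma_{\min}(\mathbb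 E[x_0x_0^T])$, and $\mathbb K_\alpha=\{K\in\mathbb K: C(K)\le\alpha\}$ for $\alpha\in\mathbb R$. Claim. For every $K\in\mathbb K$ the cost $C(K)$ is finite, $P^K$ exists and is unique, $C(K)=\mathbb E\big[x_0^T(\sum_i\pi_iP^K_i)x_0\big]$, the series $\mathbf X^K$ converges, and $C$ is twice continuously differentiable at $K$. There is a unique $K^*\in\mathbb K$ that minimizes $C$ over $\mathbb K$, and $\mu>0$. Moreover: 1. (Coercivity) For every sequence $(K^l)$ in $\mathbb K$ such that $\|K^l\|_2\to\infty$, or such that $K^l$ converges to a point of the boundary $\partial\mathbb K$, one has $C(K^l)\to+\infty$. 2. (Almost smoothness) For all $K,K'\in\mathbb K$, with $\Delta K=K-K'$, $$C(K')-C(K)=\sum_i\Big(-2\operatorname{tr}\big(\mathbf X_i^{K'}\Delta K_i^TL_i^K\big)+\operatorname{tr}\big(\mathbf X_i^{K'}\Delta K_i^T\Psi_i^K\Delta K_i\big)\Big)=-2\langle\Delta K^TL^K,\mathbf X^{K'}\rangle+\langle\Delta K^T\Psi^K\Delta K,\mathbf X^{K'}\rangle .$$ 3. (Gradient dominance) For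 every $K\in\mathbb K$, $$C(K)-C(K^*)\le\|\mathbf X^{K^*}\|_{\max}\langle(\Psi^K)^{-1}L^K,L^K\rangle\le\frac{\|\mathbf X^{K^*}\|_{\max}}{\Lambda_{\min}(R)}\|L^K\|_2^2\le\frac{\|\mathbf X^{K^*}\|_{\max}}{4\mu^2\Lambda_{\min}(R)}\|\nabla C(K)\|_2^2 .$$ 4. (Compact sublevel sets) $\mathbb K_\alpha$ is compact for every $\alpha\ge C(K^*)$. 5. (Smoothness on sublevel sets) For every $\alpha\in\mathbb R$ put $$\xi=\frac1{\Lambda_{\min}(Q)}\Big(\frac{1+\|B\|_{\max}^2}{\mu}\alpha+\|R\|_{\max}\Big)-1,\qquad L=2\Big(\|R\|_{\max}+\|B\|_{\max}^2\Big(1+\frac{2\xi}{\|B\|_{\max}}\Big)\frac{\alpha}{\mu}\Big)\frac{\alpha}{\Lambda_{\min}(Q)},$$ where $\|B\|_{\max}^2(1+2\xi/\|B\|_{\max})$ is read as $0$ if $B=0$. Then $\|\nabla^2C(K)\|\le L$ for every $K\in\mathbb K_\alpha$, and for all $K,K'$ with $tK+(1-t)K'\in\mathbb K_\alpha$ for every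 $t\in[0,1]$, $$C(K')\le C(K)+\langle\nabla C(K),K'-K\rangle+\frac L2\|K'-K\|_2^2 .$$ -/

import Mathlib

open Filter Topology MeasureTheory ProbabilityTheory
open scoped Matrix ENNReal Gradient

noncomputable section

namespace MJLS

/-- The maximal singular value (spectral norm) of a real matrix. -/
def specNorm {m n : ℕ} (M : Matrix (Fin m) (Fin n) ℝ) : ℝ :=
  ‖(Matrix.toEuclideanLin M).toContinuousLinearMap‖

/-- The minimal singular value of a square matrix. -/
def sigmaMin {n : ℕ} (M : Matrix (Fin n) (Fin n) ℝ) : ℝ :=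
  ⨅ j : Fin n, (Matrix.toEuclideanLin M).singularValues (j : ℕ)

/-- `‖V‖_max`, the maximum over the modes of the spectral norms. -/
def normMax {N m n : ℕ} (V : Fin N → Matrix (Fin m) (Fin n) ℝ) : ℝ :=
  ⨆ i, specNorm (V i)

/-- `Λ_min(V)`, the minimum over the modes of the minimal singular values. -/
def lamMin {N n : ℕ} (V : Fin N → Matrix (Fin n) (Fin n) ℝ) : ℝ :=
  ⨅ i, sigmaMin (V i)

/-- The inner product `⟨V, S⟩ = ∑ i, tr (V iᵀ S i)` of two tuples of matrices. -/
def tupleInner {N m n : ℕ} (V S : Fin N → Matrix (Fin m) (Fin n) ℝ) : ℝ :=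
  ∑ i, ((V i)ᵀ * S i).trace

/-- The space of policies `K = (K_1, …, K_N)`, `K_i` a `k × d` matrix. As a Euclidean space over
the entries, its norm is `‖K‖_2 = (∑ i, tr (K iᵀ K i))^(1/2)` and its inner product is
`∑ i, tr (K iᵀ K' i)`. -/
abbrev Policy (N k d : ℕ) : Type := EuclideanSpace ℝ (Fin N × Fin k × Fin d)

/-- The gain matrix `K_i` of mode `i`. -/
def Policy.mat {N k d : ℕ} (K : Policy N k d) (i : Fin N) : Matrix (Fin k) (Fin d) ℝ :=
  Matrix.of fun a b => K (i, a, b)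

/-- A process with values in `Fin N` that is a time-homogeneous Markov chain with initial
distribution `π` and transition matrix `p`. The last field is the Markov property
`Pr(ω(t+1) = j | ω(t) = i, ω(t-1) = …, …, ω(0) = …) = p i j`, multiplied out. -/
structure IsMarkovChain {N : ℕ} {Ω : Type*} [MeasurableSpace Ω] (Pr : Measure Ω)
    (ω : ℕ → Ω → Fin N) (π : Fin N → ℝ) (p : Matrix (Fin N) (Fin N) ℝ) : Prop where
  measurable : ∀ t, Measurable (ω t)
  initial : ∀ i, Pr.real {a | ω 0 a = i} = π i
  step : ∀ (t : ℕ) (w : ℕ → Fin N),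
    Pr.real {a | ∀ s ≤ t + 1, ω s a = w s} =
      Pr.real {a | ∀ s ≤ t, ω s a = w s} * p (w t) (w (t + 1))

end MJLS

/-- A Markovian jump linear quadratic control problem with `N` modes, state space `ℝ^d` and input
space `ℝ^k`, on a probability space `(Ω, Pr)`: the system `x_{t+1} = A_{ω(t)} x_t + B_{ω(t)} u_t`,
the Markov chain `ω` with initial distribution `π` and transition matrix `p`, the random initial
state `x0`, independent of the chain, and the cost matrices `Q` and `R`. -/
structure MJLS (N d k : ℕ) (Ω : Type*) [MeasurableSpace Ω] where
  A : Fin N → Matrix (Fin d) (Fin d) ℝ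
  B : Fin N → Matrix (Fin d) (Fin k) ℝ
  Q : Fin N → Matrix (Fin d) (Fin d) ℝ
  R : Fin N → Matrix (Fin k) (Fin k) ℝ
  p : Matrix (Fin N) (Fin N) ℝ
  π : Fin N → ℝ
  Pr : Measure Ω
  ω : ℕ → Ω → Fin N
  x0 : Ω → Fin d → ℝ
  isProbabilityMeasure : IsProbabilityMeasure Pr
  p_nonneg : ∀ i j, 0 ≤ p i j
  p_sum : ∀ i, ∑ j, p i j = 1
  π_sum : ∑ i, π i = 1
  π_pos : ∀ i, 0 < π i
  Q_posDef : ∀ i, (Q i).PosDef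
  R_posDef : ∀ i, (R i).PosDef
  chain : MJLS.IsMarkovChain Pr ω π p
  x0_measurable : Measurable x0
  x0_indep : IndepFun x0 (fun a t => ω t a) Pr
  x0_memLp : ∀ α, MemLp (fun a => x0 a α) 2 Pr
  x0_cov_posDef : (Matrix.of fun α β => ∫ a, x0 a α * x0 a β ∂Pr).PosDef

namespace MJLS

variable {N d k : ℕ} {Ω : Type*} [MeasurableSpace Ω] (M : MJLS N d k Ω) (K : Policy N k d)

/-- `E[x_0 x_0ᵀ]`. -/
def cov0 : Matrix (Fin d) (Fin d) ℝ :=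
  Matrix.of fun α β => ∫ a, M.x0 a α * M.x0 a β ∂M.Pr

/-- The closed-loop matrix `Γ_i = A_i - B_i K_i`. -/
def Γ (i : Fin N) : Matrix (Fin d) (Fin d) ℝ := M.A i - M.B i * K.mat i

/-- The closed-loop trajectory under `u_t = -K_{ω(t)} x_t` from the initial state `x`, along the
sample path `a` of the chain. -/
def state (x : Fin d → ℝ) (a : Ω) : ℕ → Fin d → ℝ
  | 0 => x
  | t + 1 => M.Γ K (M.ω t a) *ᵥ state x a t

/-- The control action `u_t = -K_{ω(t)} x_t`. -/
def control (x : Fin d → ℝ) (a : Ω) (t : ℕ) : Fin k → ℝ :=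
  -(K.mat (M.ω t a) *ᵥ M.state K x a t)

/-- The stage cost `x_tᵀ Q_{ω(t)} x_t + u_tᵀ R_{ω(t)} u_t`. -/
def stageCost (x : Fin d → ℝ) (a : Ω) (t : ℕ) : ℝ :=
  M.state K x a t ⬝ᵥ (M.Q (M.ω t a) *ᵥ M.state K x a t) +
    M.control K x a t ⬝ᵥ (M.R (M.ω t a) *ᵥ M.control K x a t)

/-- The cost `E[∑_t x_tᵀ Q_{ω(t)} x_t + u_tᵀ R_{ω(t)} u_t]`, with values in `[0, ∞]`
(every stage cost is nonnegative). -/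
def extCost : ℝ≥0∞ :=
  ∫⁻ a, ∑' t, ENNReal.ofReal (M.stageCost K (M.x0 a) a t) ∂M.Pr

/-- The real-valued cost `C(K)`. -/
def cost : ℝ := (M.extCost K).toReal

/-- Mean-square stability of the closed loop: for every deterministic initial state `x` and every
initial mode `i`, `E[x_t x_tᵀ] → 0`. Starting the chain in mode `i` is conditioning on
`ω(0) = i`, an event of probability `π i > 0`. -/
def IsMSS : Prop :=
  ∀ (x : Fin d → ℝ) (i : Fin N) (α β : Fin d),
    Tendsto (fun t => ∫ a, M.state K x a t α * M.state K x a t β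
      ∂(ProbabilityTheory.cond M.Pr {a | M.ω 0 a = i})) atTop (𝓝 0)

/-- The set `𝕂` of policies that stabilize the system in the mean-square sense. -/
def stabSet : Set (Policy N k d) := {K | M.IsMSS K}

/-- The sublevel set `𝕂_α`. -/
def sublevel (α : ℝ) : Set (Policy N k d) := {K | K ∈ M.stabSet ∧ M.cost K ≤ α}

/-- `K` is an optimal policy: a minimizer of the cost over `𝕂`. -/
def IsOptimal : Prop := K ∈ M.stabSet ∧ ∀ K' ∈ M.stabSet, M.cost K ≤ M.cost K'

/-- `E_i(V) = ∑_j p_ij V_j`. -/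
def opE (V : Fin N → Matrix (Fin d) (Fin d) ℝ) (i : Fin N) : Matrix (Fin d) (Fin d) ℝ :=
  ∑ j, M.p i j • V j

/-- `P` solves the coupled Lyapunov equations
`P_i = Q_i + K_iᵀ R_i K_i + (A_i - B_i K_i)ᵀ E_i(P) (A_i - B_i K_i)`. -/
def IsLyapunov (P : Fin N → Matrix (Fin d) (Fin d) ℝ) : Prop :=
  ∀ i, P i = M.Q i + (K.mat i)ᵀ * M.R i * K.mat i + (M.Γ K i)ᵀ * M.opE P i * M.Γ K i

/-- `P^K`, the solution of the coupled Lyapunov equations. -/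
def PK : Fin N → Matrix (Fin d) (Fin d) ℝ := Classical.epsilon (M.IsLyapunov K)

/-- `X_i(t) = E[x_t x_tᵀ 1_{ω(t) = i}]`. -/
def corr (t : ℕ) (i : Fin N) : Matrix (Fin d) (Fin d) ℝ :=
  Matrix.of fun α β => ∫ a, {a | M.ω t a = i}.indicator
    (fun a => M.state K (M.x0 a) a t α * M.state K (M.x0 a) a t β) a ∂M.Pr

/-- `𝐗^K = ∑_t X(t)`. -/
def XK (i : Fin N) : Matrix (Fin d) (Fin d) ℝ :=
  Matrix.of fun α β => ∑' t, M.corr K t i α β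

/-- `Ψ = R + Bᵀ E(P^K) B`. -/
def Psi (i : Fin N) : Matrix (Fin k) (Fin k) ℝ :=
  M.R i + (M.B i)ᵀ * M.opE (M.PK K) i * M.B i

/-- `L^K_i = (R_i + B_iᵀ E_i(P^K) B_i) K_i - B_iᵀ E_i(P^K) A_i`. -/
def LK (i : Fin N) : Matrix (Fin k) (Fin d) ℝ :=
  M.Psi K i * K.mat i - (M.B i)ᵀ * M.opE (M.PK K) i * M.A i

/-- `μ = min_i π_i · σ_min(E[x_0 x_0ᵀ])`. -/
def mu : ℝ := (⨅ i, M.π i) * sigmaMin M.cov0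

/-- The constant `ξ` of the sublevel set `𝕂_α`. -/
def xi (α : ℝ) : ℝ :=
  1 / lamMin M.Q * ((1 + normMax M.B ^ 2) / M.mu * α + normMax M.R) - 1

/-- The smoothness constant `L` of the sublevel set `𝕂_α`. The factor `‖B‖² (1 + 2 ξ / ‖B‖)` is
`‖B‖² + 2 ξ ‖B‖`, also when `B = 0`. -/
def smoothConst (α : ℝ) : ℝ :=
  2 * (normMax M.R + normMax M.B ^ 2 * (1 + 2 * M.xi α / normMax M.B) * (α / M.mu)) *
    (α / lamMin M.Q)

end MJLS

end

/-!
The second moments `E[x_t x_tᵀ 1_{ω(t) = j}]` of the closed loop evolve by a linear operator that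
preserves positive semidefinite tuples, and mean-square stability says that its powers tend to zero.
The cost is then the trace pairing of the stage cost with the Neumann series of this operator at
the initial moments, or dually of `P^K` with the initial moments. Pairing the residual of `P^K` in
the Lyapunov equation of `K'` with `X^{K'}` gives the cost difference exactly, as a quadratic
polynomial in `K - K'`; completing the square yields gradient dominance, and dividing by the step
along a line through `K` yields the gradient `2 L^K X^K`.

The second derivative in a direction `E` contains the derivative `P'` of `P^K` in that direction.
`P'` solves the Lyapunov equation with source `Eᵀ L^K + (L^K)ᵀ E`, and since for `‖E‖ ≤ 1` this
source is at most `ξ` times the stage cost as a quadratic form, comparison of the two solutions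
gives `|P'| ≤ ξ P^K`.
-/

noncomputable section

namespace MJLS

open Matrix

/-! ### Quadratic forms and extremal singular values -/

section DotProduct

variable {m n : Type*} [Fintype m] [Fintype n]

lemma dotProduct_self_eq_norm_sq (v : n → ℝ) : v ⬝ᵥ v = ‖WithLp.toLp 2 v‖ ^ 2 := by
  rw [EuclideanSpace.real_norm_sq_eq]
  simp only [dotProduct, pow_two]

lemma dotProduct_sq_le (v w : n → ℝ) : (v ⬝ᵥ w) ^ 2 ≤ (v ⬝ᵥ v) * (w ⬝ᵥ w) := by
  simpa only [dotProduct, pow_two] using Finset.sum_mul_sq_le_sq_mul_sq Finset.univ v w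

lemma dotProduct_self_nonneg (v : n → ℝ) : 0 ≤ v ⬝ᵥ v :=
  Finset.sum_nonneg fun i _ => mul_self_nonneg (v i)

lemma dotProduct_transpose_mul_mul_mulVec (E : Matrix m n ℝ) (H : Matrix m m ℝ) (v w : n → ℝ) :
    v ⬝ᵥ (Eᵀ * H * E) *ᵥ w = (E *ᵥ v) ⬝ᵥ H *ᵥ (E *ᵥ w) := by
  rw [← mulVec_mulVec, ← mulVec_mulVec, dotProduct_mulVec, vecMul_transpose]

lemma dotProduct_mulVec_symm {H : Matrix n n ℝ} (hH : Hᵀ = H) (u v : n → ℝ) :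
    v ⬝ᵥ H *ᵥ u = u ⬝ᵥ H *ᵥ v := by
  rw [dotProduct_mulVec, ← mulVec_transpose, hH, dotProduct_comm]

lemma abs_dotProduct_mulVec_le_of_symm {H : Matrix n n ℝ} (hH : Hᵀ = H) {c : ℝ}
    (hc : ∀ v, |v ⬝ᵥ H *ᵥ v| ≤ c * (v ⬝ᵥ v)) (u v : n → ℝ) :
    |u ⬝ᵥ H *ᵥ v| ≤ c * (u ⬝ᵥ u + v ⬝ᵥ v) / 2 := by
  have hadd := abs_le.1 (hc (u + v))
  have hsub := abs_le.1 (hc (u - v))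
  simp only [mulVec_add, mulVec_sub, dotProduct_add, dotProduct_sub, add_dotProduct,
    sub_dotProduct, dotProduct_mulVec_symm hH u v, dotProduct_comm v u] at hadd hsub
  rw [abs_le]
  constructor <;> linarith

end DotProduct

section PosSemidef

lemma transpose_eq_of_posSemidef {n : Type*} {H : Matrix n n ℝ} (hH : H.PosSemidef) :
    Hᵀ = H := by
  simpa only [IsHermitian, conjTranspose_eq_transpose_of_trivial] using hH.1

lemma posSemidef_vecMulVec_self {n : Type*} [Finite n] (x : n → ℝ) :
    (vecMulVec x x).PosSemidef := by
  simpa only [star_trivial] using posSemidef_vecMulVec_self_star x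

variable {n : Type*} [Fintype n] {G H X : Matrix n n ℝ}

lemma quadForm_nonneg (hH : H.PosSemidef) (v : n → ℝ) : 0 ≤ v ⬝ᵥ H *ᵥ v := by
  simpa only [star_trivial] using hH.dotProduct_mulVec_nonneg v

lemma posSemidef_of_quadForm_nonneg (hH : Hᵀ = H) (h : ∀ v, 0 ≤ v ⬝ᵥ H *ᵥ v) : H.PosSemidef :=
  .of_dotProduct_mulVec_nonneg (by rwa [IsHermitian, conjTranspose_eq_transpose_of_trivial])
    (by simpa only [star_trivial] using h)

lemma dotProduct_vecMulVec_self_mulVec (x v : n → ℝ) :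
    v ⬝ᵥ vecMulVec x x *ᵥ v = (x ⬝ᵥ v) ^ 2 := by
  rw [vecMulVec_mulVec, dotProduct_smul, MulOpposite.smul_eq_mul_unop, MulOpposite.unop_op,
    dotProduct_comm v x, pow_two]

lemma trace_mul_vecMulVec_self (H : Matrix n n ℝ) (x : n → ℝ) :
    (H * vecMulVec x x).trace = x ⬝ᵥ H *ᵥ x := by
  rw [mul_vecMulVec, trace_vecMulVec, dotProduct_comm]

lemma trace_mul_nonneg (hH : ∀ v, 0 ≤ v ⬝ᵥ H *ᵥ v) (hX : X.PosSemidef) :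
    0 ≤ (H * X).trace := by
  classical
  obtain ⟨C, rfl⟩ : ∃ C : Matrix n n ℝ, X = Cᴴ * C := by
    open scoped MatrixOrder in
    exact CStarAlgebra.nonneg_iff_eq_star_mul_self.1 hX.nonneg
  rw [← mul_assoc, trace_mul_comm, ← mul_assoc]
  refine Finset.sum_nonneg fun j _ => ?_
  have := hH (C j)
  rwa [dotProduct_mulVec] at this

lemma trace_mul_le_trace_mul (h : ∀ v, v ⬝ᵥ G *ᵥ v ≤ v ⬝ᵥ H *ᵥ v) (hX : X.PosSemidef) :
    (G * X).trace ≤ (H * X).trace := by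
  rw [← sub_nonneg, ← trace_sub, ← sub_mul]
  refine trace_mul_nonneg (fun v => ?_) hX
  rw [sub_mulVec, dotProduct_sub, sub_nonneg]
  exact h v

lemma mul_trace_le_trace_mul {c : ℝ} (h : ∀ v, c * (v ⬝ᵥ v) ≤ v ⬝ᵥ H *ᵥ v) (hX : X.PosSemidef) :
    c * X.trace ≤ (H * X).trace := by
  classical
  have := trace_mul_le_trace_mul (G := c • 1) (H := H)
    (fun v => by simpa only [smul_mulVec, one_mulVec, dotProduct_smul, smul_eq_mul] using h v) hX
  rwa [smul_mul_assoc, one_mul, trace_smul, smul_eq_mul] at this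

lemma trace_mul_le_mul_trace {c : ℝ} (h : ∀ v, v ⬝ᵥ H *ᵥ v ≤ c * (v ⬝ᵥ v)) (hX : X.PosSemidef) :
    (H * X).trace ≤ c * X.trace := by
  have := mul_trace_le_trace_mul (H := -H) (c := -c)
    (fun v => by rw [neg_mulVec, dotProduct_neg]; linarith [h v]) hX
  rw [neg_mul H, trace_neg] at this
  linarith

lemma dotProduct_mulVec_le_trace_mul (hX : X.PosSemidef) (v : n → ℝ) :
    v ⬝ᵥ X *ᵥ v ≤ X.trace * (v ⬝ᵥ v) := by
  have := trace_mul_le_mul_trace (H := vecMulVec v v) (c := v ⬝ᵥ v)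
    (fun w => by rw [dotProduct_vecMulVec_self_mulVec]; exact dotProduct_sq_le v w) hX
  rwa [trace_mul_comm, trace_mul_vecMulVec_self, mul_comm] at this

lemma abs_apply_le_trace (hX : X.PosSemidef) (α β : n) : |X α β| ≤ X.trace := by
  classical
  have hdiag (a) : X a a ≤ X.trace :=
    Finset.single_le_sum (f := fun a => X a a) (fun a _ => hX.diag_nonneg) (Finset.mem_univ a)
  have hform (s : ℝ) : 0 ≤ X α α + 2 * s * X α β + s ^ 2 * X β β := by
    have := quadForm_nonneg hX (Pi.single α 1 + s • Pi.single β 1)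
    have hsymm : X β α = X α β := congrFun₂ (transpose_eq_of_posSemidef hX) α β
    simp only [mulVec_add, mulVec_smul, dotProduct_add, add_dotProduct, smul_dotProduct,
      dotProduct_smul, mulVec_single_one, single_one_dotProduct, smul_eq_mul, col_apply,
      hsymm] at this
    linarith
  rw [abs_le]
  constructor <;> linarith [hform 1, hform (-1), hdiag α, hdiag β]

end PosSemidef

section SpectralBounds

lemma toEuclideanLin_toLp {m n : ℕ} (S : Matrix (Fin m) (Fin n) ℝ) (v : Fin n → ℝ) :
    toEuclideanLin S (WithLp.toLp 2 v) = WithLp.toLp 2 (S *ᵥ v) := rfl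

lemma mul_norm_sq_le_inner_of_le_eigenvalues {E : Type*} [NormedAddCommGroup E]
    [InnerProductSpace ℝ E] [FiniteDimensional ℝ E] {n : ℕ} (hn : Module.finrank ℝ E = n)
    {T : E →ₗ[ℝ] E} (hT : T.IsSymmetric) {c : ℝ} (hc : ∀ j, c ≤ hT.eigenvalues hn j) (x : E) :
    c * ‖x‖ ^ 2 ≤ inner ℝ x (T x) := by
  let b := hT.eigenvectorBasis hn
  rw [← b.sum_inner_mul_inner x, ← real_inner_self_eq_norm_sq, ← b.sum_inner_mul_inner x x,
    Finset.mul_sum]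
  refine Finset.sum_le_sum fun j _ => ?_
  have hTj : inner ℝ (b j) (T x) = hT.eigenvalues hn j * inner ℝ (b j) x := by
    rw [← hT (b j) x, hT.apply_eigenvectorBasis hn j, RCLike.ofReal_real_eq_id, id,
      real_inner_smul_left]
  rw [hTj, real_inner_comm]
  nlinarith [hc j, mul_self_nonneg (inner ℝ (b j) x)]

variable {N m n : ℕ}

lemma specNorm_nonneg (S : Matrix (Fin m) (Fin n) ℝ) : 0 ≤ specNorm S :=
  norm_nonneg _

lemma mulVec_dotProduct_mulVec_le_specNorm (S : Matrix (Fin m) (Fin n) ℝ) (v : Fin n → ℝ) :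
    (S *ᵥ v) ⬝ᵥ (S *ᵥ v) ≤ specNorm S ^ 2 * (v ⬝ᵥ v) := by
  rw [dotProduct_self_eq_norm_sq, dotProduct_self_eq_norm_sq, ← mul_pow]
  gcongr
  exact (toEuclideanLin S).toContinuousLinearMap.le_opNorm (WithLp.toLp 2 v)

lemma dotProduct_mulVec_le_specNorm (S : Matrix (Fin n) (Fin n) ℝ) (v : Fin n → ℝ) :
    v ⬝ᵥ S *ᵥ v ≤ specNorm S * (v ⬝ᵥ v) := by
  have hv := dotProduct_self_nonneg v
  refine le_of_sq_le_sq ?_ (mul_nonneg (specNorm_nonneg S) hv)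
  nlinarith [dotProduct_sq_le v (S *ᵥ v), mulVec_dotProduct_mulVec_le_specNorm S v]

lemma normMax_nonneg (V : Fin N → Matrix (Fin m) (Fin n) ℝ) : 0 ≤ normMax V :=
  Real.iSup_nonneg fun _ => specNorm_nonneg _

lemma specNorm_le_normMax (V : Fin N → Matrix (Fin m) (Fin n) ℝ) (i : Fin N) :
    specNorm (V i) ≤ normMax V :=
  le_ciSup (f := fun i => specNorm (V i)) (Set.finite_range _).bddAbove i

lemma mulVec_dotProduct_mulVec_le_normMax (V : Fin N → Matrix (Fin m) (Fin n) ℝ) (i : Fin N)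
    (v : Fin n → ℝ) : (V i *ᵥ v) ⬝ᵥ (V i *ᵥ v) ≤ normMax V ^ 2 * (v ⬝ᵥ v) := by
  refine (mulVec_dotProduct_mulVec_le_specNorm (V i) v).trans ?_
  gcongr
  exacts [dotProduct_self_nonneg v, specNorm_nonneg _, specNorm_le_normMax V i]

lemma dotProduct_mulVec_le_normMax (V : Fin N → Matrix (Fin n) (Fin n) ℝ) (i : Fin N)
    (v : Fin n → ℝ) : v ⬝ᵥ V i *ᵥ v ≤ normMax V * (v ⬝ᵥ v) :=
  (dotProduct_mulVec_le_specNorm (V i) v).trans <|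
    mul_le_mul_of_nonneg_right (specNorm_le_normMax V i) (dotProduct_self_nonneg v)

lemma sigmaMin_nonneg (S : Matrix (Fin n) (Fin n) ℝ) : 0 ≤ sigmaMin S :=
  Real.iInf_nonneg fun j => LinearMap.singularValues_nonneg _ j

lemma sigmaMin_sq_mul_le (S : Matrix (Fin n) (Fin n) ℝ) (v : Fin n → ℝ) :
    sigmaMin S ^ 2 * (v ⬝ᵥ v) ≤ (S *ᵥ v) ⬝ᵥ (S *ᵥ v) := by
  set T := toEuclideanLin S with hT
  have hn : Module.finrank ℝ (EuclideanSpace ℝ (Fin n)) = n := finrank_euclideanSpace_fin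
  have hle (j : Fin n) :
      sigmaMin S ^ 2 ≤ T.isSymmetric_adjoint_comp_self.eigenvalues hn j := by
    rw [← T.sq_singularValues_fin hn]
    gcongr
    · exact sigmaMin_nonneg S
    · exact ciInf_le (f := fun j : Fin n => T.singularValues (j : ℕ))
        (Set.finite_range _).bddBelow j
  have := mul_norm_sq_le_inner_of_le_eigenvalues hn T.isSymmetric_adjoint_comp_self hle
    (WithLp.toLp 2 v)
  rwa [LinearMap.comp_apply, LinearMap.adjoint_inner_right, real_inner_self_eq_norm_sq, hT,
    toEuclideanLin_toLp, ← dotProduct_self_eq_norm_sq, ← dotProduct_self_eq_norm_sq] at this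

lemma sigmaMin_le_of_mulVec_eq_smul {S : Matrix (Fin n) (Fin n) ℝ} (hS : S.PosSemidef)
    {v : Fin n → ℝ} (hv : v ⬝ᵥ v = 1) {c : ℝ} (hc : S *ᵥ v = c • v) : sigmaMin S ≤ c := by
  have hform := quadForm_nonneg hS v
  have hsq := sigmaMin_sq_mul_le S v
  simp only [hc, smul_dotProduct, dotProduct_smul, hv, smul_eq_mul, mul_one] at hform hsq
  exact le_of_sq_le_sq (by rwa [pow_two c]) hform

lemma sigmaMin_mul_le_quadForm {S : Matrix (Fin n) (Fin n) ℝ} (hS : S.PosSemidef)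
    (v : Fin n → ℝ) : sigmaMin S * (v ⬝ᵥ v) ≤ v ⬝ᵥ S *ᵥ v := by
  have hn : Module.finrank ℝ (EuclideanSpace ℝ (Fin n)) = n := finrank_euclideanSpace_fin
  have hT : (toEuclideanLin S).IsSymmetric := isSymmetric_toEuclideanLin_iff.2 hS.1
  have hle (j : Fin n) : sigmaMin S ≤ hT.eigenvalues hn j := by
    refine sigmaMin_le_of_mulVec_eq_smul (v := (hT.eigenvectorBasis hn j).ofLp) hS ?_ ?_
    · rw [dotProduct_self_eq_norm_sq, WithLp.toLp_ofLp, OrthonormalBasis.norm_eq_one, one_pow]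
    · exact congrArg WithLp.ofLp (hT.apply_eigenvectorBasis hn j)
  have := mul_norm_sq_le_inner_of_le_eigenvalues hn hT hle (WithLp.toLp 2 v)
  rwa [toEuclideanLin_toLp, ← dotProduct_self_eq_norm_sq, EuclideanSpace.inner_toLp_toLp,
    star_trivial, dotProduct_comm (S *ᵥ v)] at this

lemma sigmaMin_pos [NeZero n] {S : Matrix (Fin n) (Fin n) ℝ} (hS : S.PosDef) :
    0 < sigmaMin S := by
  obtain ⟨j, hj⟩ := exists_eq_ciInf_of_finite
    (f := fun j : Fin n => (toEuclideanLin S).singularValues (j : ℕ))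
  rw [sigmaMin, ← hj]
  refine (LinearMap.injective_iff_forall_lt_finrank_singularValues_pos _).1 ?_ j
    (by rw [finrank_euclideanSpace_fin]; exact j.isLt)
  refine (injective_iff_map_eq_zero _).2 fun x hx => ?_
  by_contra hne
  have hpos := hS.dotProduct_mulVec_pos (x := x.ofLp) (by simpa using hne)
  have hzero : S *ᵥ x.ofLp = 0 := congrArg WithLp.ofLp hx
  simp [hzero] at hpos

lemma lamMin_mul_le_quadForm {V : Fin N → Matrix (Fin n) (Fin n) ℝ}
    (hV : ∀ i, (V i).PosSemidef) (i : Fin N) (v : Fin n → ℝ) :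
    lamMin V * (v ⬝ᵥ v) ≤ v ⬝ᵥ V i *ᵥ v := by
  refine le_trans ?_ (sigmaMin_mul_le_quadForm (hV i) v)
  gcongr
  · exact dotProduct_self_nonneg v
  · exact ciInf_le (f := fun i => sigmaMin (V i)) (Set.finite_range _).bddBelow i

lemma lamMin_pos [NeZero N] [NeZero n] {V : Fin N → Matrix (Fin n) (Fin n) ℝ}
    (hV : ∀ i, (V i).PosDef) : 0 < lamMin V := by
  obtain ⟨j, hj⟩ := exists_eq_ciInf_of_finite (f := fun i => sigmaMin (V i))
  rw [lamMin, ← hj]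
  exact sigmaMin_pos (hV j)

end SpectralBounds

/-! ### Coupled Lyapunov operators -/

section TracePairing

variable {ι n : Type*} [Fintype ι] [Fintype n] {G H P S : ι → Matrix n n ℝ}

/-- The bilinear pairing `∑ i, tr (P i * S i)` of two tuples of square matrices. It agrees with
`tupleInner P S` as soon as the `P i` are symmetric. -/
def tracePairing : LinearMap.BilinForm ℝ (ι → Matrix n n ℝ) :=
  LinearMap.mk₂ ℝ (fun P S => ∑ i, (P i * S i).trace)
    (fun _ _ _ => by simp only [Pi.add_apply, add_mul, trace_add, Finset.sum_add_distrib])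
    (fun _ _ _ => by
      simp only [Pi.smul_apply, smul_mul_assoc, trace_smul, ← Finset.smul_sum])
    (fun _ _ _ => by simp only [Pi.add_apply, mul_add, trace_add, Finset.sum_add_distrib])
    (fun _ _ _ => by
      simp only [Pi.smul_apply, mul_smul_comm, trace_smul, ← Finset.smul_sum])

lemma tracePairing_apply (P S : ι → Matrix n n ℝ) :
    tracePairing P S = ∑ i, (P i * S i).trace := rfl

lemma tracePairing_comm (P S : ι → Matrix n n ℝ) : tracePairing P S = tracePairing S P :=
  Finset.sum_congr rfl fun _ _ => trace_mul_comm _ _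

lemma tracePairing_single [DecidableEq ι] (P : ι → Matrix n n ℝ) (i : ι) (S : Matrix n n ℝ) :
    tracePairing P (Pi.single i S) = (P i * S).trace := by
  rw [tracePairing_apply, Finset.sum_eq_single_of_mem i (Finset.mem_univ i), Pi.single_eq_same]
  intro j _ hj
  rw [Pi.single_eq_of_ne hj, mul_zero, trace_zero]

lemma tracePairing_single_vecMulVec [DecidableEq ι] (P : ι → Matrix n n ℝ) (i : ι) (v : n → ℝ) :
    tracePairing P (Pi.single i (vecMulVec v v)) = v ⬝ᵥ P i *ᵥ v := by
  rw [tracePairing_single, trace_mul_vecMulVec_self]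

lemma tracePairing_one [DecidableEq n] (S : ι → Matrix n n ℝ) :
    tracePairing 1 S = ∑ i, (S i).trace := by
  simp only [tracePairing_apply, Pi.one_apply, one_mul]

lemma continuous_tracePairing (P : ι → Matrix n n ℝ) : Continuous (tracePairing P) :=
  (tracePairing P).continuous_of_finiteDimensional

lemma tracePairing_nonneg (hH : ∀ i v, 0 ≤ v ⬝ᵥ H i *ᵥ v) (hS : ∀ i, (S i).PosSemidef) :
    0 ≤ tracePairing H S :=
  Finset.sum_nonneg fun i _ => trace_mul_nonneg (hH i) (hS i)

lemma tracePairing_le_tracePairing (h : ∀ i v, v ⬝ᵥ G i *ᵥ v ≤ v ⬝ᵥ H i *ᵥ v)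
    (hS : ∀ i, (S i).PosSemidef) : tracePairing G S ≤ tracePairing H S :=
  Finset.sum_le_sum fun i _ => trace_mul_le_trace_mul (h i) (hS i)

lemma mul_tracePairing_one_le [DecidableEq n] {c : ℝ} (h : ∀ i v, c * (v ⬝ᵥ v) ≤ v ⬝ᵥ H i *ᵥ v)
    (hS : ∀ i, (S i).PosSemidef) : c * tracePairing 1 S ≤ tracePairing H S := by
  rw [tracePairing_one, Finset.mul_sum]
  exact Finset.sum_le_sum fun i _ => mul_trace_le_trace_mul (h i) (hS i)

lemma tracePairing_le_mul_one [DecidableEq n] {c : ℝ} (h : ∀ i v, v ⬝ᵥ H i *ᵥ v ≤ c * (v ⬝ᵥ v))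
    (hS : ∀ i, (S i).PosSemidef) : tracePairing H S ≤ c * tracePairing 1 S := by
  rw [tracePairing_one, Finset.mul_sum]
  exact Finset.sum_le_sum fun i _ => trace_mul_le_mul_trace (h i) (hS i)

lemma tracePairing_eq_zero_iff : (∀ S, tracePairing H S = 0) ↔ H = 0 := by
  classical
  refine ⟨fun h => ?_, fun h S => by rw [h, map_zero, LinearMap.zero_apply]⟩
  ext i α β
  have := h (Pi.single i (Matrix.single β α 1))
  simpa [tracePairing_single, trace_mul_single] using this

end TracePairing

section LyapunovOperators

variable {ι n : Type*} [Fintype ι] [Fintype n] (p : Matrix ι ι ℝ) (G : ι → Matrix n n ℝ)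

/-- The coupled Lyapunov operator `P ↦ (G_iᵀ (∑ j, p_ij P_j) G_i)_i` of the jump linear system
`x_{t+1} = G_{ω(t)} x_t` driven by a Markov chain with transition matrix `p`. -/
def lyapOp : Module.End ℝ (ι → Matrix n n ℝ) where
  toFun P i := (G i)ᵀ * (∑ j, p i j • P j) * G i
  map_add' P P' := by
    ext1 i
    simp only [Pi.add_apply, smul_add, Finset.sum_add_distrib, mul_add, add_mul]
  map_smul' c P := by
    ext1 i
    simp only [Pi.smul_apply, RingHom.id_apply, smul_comm _ c, ← Finset.smul_sum,
      mul_smul_comm, smul_mul_assoc]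

/-- The operator `S ↦ (∑ i, p_ij G_i S_i G_iᵀ)_j` that propagates the second moments
`E[x_t x_tᵀ 1_{ω(t) = j}]` of the jump linear system by one time step. -/
def lyapAdjoint : Module.End ℝ (ι → Matrix n n ℝ) where
  toFun S j := ∑ i, p i j • (G i * S i * (G i)ᵀ)
  map_add' S S' := by
    ext1 j
    simp only [Pi.add_apply, mul_add, add_mul, smul_add, Finset.sum_add_distrib]
  map_smul' c S := by
    ext1 j
    simp only [Pi.smul_apply, RingHom.id_apply, smul_comm _ c, ← Finset.smul_sum,
      mul_smul_comm, smul_mul_assoc]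

lemma lyapOp_apply (P : ι → Matrix n n ℝ) (i : ι) :
    lyapOp p G P i = (G i)ᵀ * (∑ j, p i j • P j) * G i := rfl

lemma lyapAdjoint_apply (S : ι → Matrix n n ℝ) (j : ι) :
    lyapAdjoint p G S j = ∑ i, p i j • (G i * S i * (G i)ᵀ) := rfl

lemma tracePairing_lyapOp (P S : ι → Matrix n n ℝ) :
    tracePairing (lyapOp p G P) S = tracePairing P (lyapAdjoint p G S) := by
  simp only [tracePairing_apply, lyapOp_apply, lyapAdjoint_apply, Finset.mul_sum, Finset.sum_mul,
    trace_sum]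
  rw [Finset.sum_comm]
  refine Finset.sum_congr rfl fun j _ => Finset.sum_congr rfl fun i _ => ?_
  simp only [mul_smul_comm, smul_mul_assoc, trace_smul]
  rw [mul_assoc, mul_assoc, trace_mul_comm, mul_assoc, mul_assoc]

lemma lyapOp_transpose (P : ι → Matrix n n ℝ) :
    lyapOp p G (fun i => (P i)ᵀ) = fun i => (lyapOp p G P i)ᵀ := by
  ext1 i
  simp only [lyapOp_apply, transpose_mul, transpose_transpose, transpose_sum, transpose_smul,
    mul_assoc]

lemma dotProduct_lyapAdjoint_mulVec (S : ι → Matrix n n ℝ) (j : ι) (u v : n → ℝ) :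
    u ⬝ᵥ lyapAdjoint p G S j *ᵥ v =
      ∑ i, p i j * (((G i)ᵀ *ᵥ u) ⬝ᵥ S i *ᵥ ((G i)ᵀ *ᵥ v)) := by
  rw [lyapAdjoint_apply, sum_mulVec, dotProduct_sum]
  refine Finset.sum_congr rfl fun i _ => ?_
  rw [smul_mulVec, dotProduct_smul, smul_eq_mul, ← dotProduct_transpose_mul_mul_mulVec,
    transpose_transpose]

variable {p G}

lemma lyapAdjoint_posSemidef (hp : ∀ i j, 0 ≤ p i j) {S : ι → Matrix n n ℝ}
    (hS : ∀ i, (S i).PosSemidef) (j : ι) : (lyapAdjoint p G S j).PosSemidef := by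
  refine posSemidef_sum _ fun i _ => PosSemidef.smul ?_ (hp i j)
  simpa only [conjTranspose_eq_transpose_of_trivial] using
    (hS i).mul_mul_conjTranspose_same (G i)

lemma lyapAdjoint_pow_posSemidef (hp : ∀ i j, 0 ≤ p i j) {S : ι → Matrix n n ℝ}
    (hS : ∀ i, (S i).PosSemidef) (t : ℕ) (j : ι) : ((lyapAdjoint p G ^ t) S j).PosSemidef := by
  induction t generalizing j with
  | zero => exact hS j
  | succ t ih =>
    rw [pow_succ', Module.End.mul_apply]
    exact lyapAdjoint_posSemidef hp ih j

lemma tracePairing_add_lyapOp_sub (H P : ι → Matrix n n ℝ) {X S : ι → Matrix n n ℝ}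
    (hX : X = S + lyapAdjoint p G X) :
    tracePairing (H + lyapOp p G P - P) X = tracePairing H X - tracePairing P S := by
  have hP : tracePairing P X = tracePairing P S + tracePairing (lyapOp p G P) X := by
    rw [tracePairing_lyapOp, ← map_add, ← hX]
  rw [map_sub, map_add, LinearMap.sub_apply, LinearMap.add_apply, hP]
  ring

lemma tracePairing_eq_of_eq_add {P H X S : ι → Matrix n n ℝ} (hP : P = H + lyapOp p G P)
    (hX : X = S + lyapAdjoint p G X) : tracePairing P S = tracePairing H X := by
  have h := tracePairing_add_lyapOp_sub H P hX
  rw [← hP, sub_self, map_zero, LinearMap.zero_apply] at h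
  linarith

end LyapunovOperators

section Domination

variable {ι n : Type*} [Fintype ι] [Fintype n] {p : Matrix ι ι ℝ} {G D S : ι → Matrix n n ℝ}

/-- The tuple `D` dominates the tuple `S` of not necessarily symmetric matrices as a tuple of
bilinear forms. Positive maps preserve this relation, which reduces the convergence of arbitrary
tuples to that of a positive definite one. -/
def Dominates (D S : ι → Matrix n n ℝ) : Prop :=
  ∀ i u v, |u ⬝ᵥ S i *ᵥ v| ≤ (u ⬝ᵥ D i *ᵥ u + v ⬝ᵥ D i *ᵥ v) / 2

lemma Dominates.lyapAdjoint (hp : ∀ i j, 0 ≤ p i j) (h : Dominates D S) :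
    Dominates (lyapAdjoint p G D) (lyapAdjoint p G S) := by
  intro j u v
  simp only [dotProduct_lyapAdjoint_mulVec]
  rw [← Finset.sum_add_distrib, Finset.sum_div]
  refine (Finset.abs_sum_le_sum_abs _ _).trans (Finset.sum_le_sum fun i _ => ?_)
  rw [abs_mul, abs_of_nonneg (hp i j), ← mul_add, mul_div_assoc]
  exact mul_le_mul_of_nonneg_left (h i _ _) (hp i j)

lemma Dominates.lyapAdjoint_pow (hp : ∀ i j, 0 ≤ p i j) (h : Dominates D S) (t : ℕ) :
    Dominates ((MJLS.lyapAdjoint p G ^ t) D) ((MJLS.lyapAdjoint p G ^ t) S) := by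
  induction t with
  | zero => exact h
  | succ t ih =>
    rw [pow_succ', Module.End.mul_apply, Module.End.mul_apply]
    exact ih.lyapAdjoint hp

lemma abs_dotProduct_mulVec_le_sum_abs (S : Matrix n n ℝ) (u v : n → ℝ) :
    |u ⬝ᵥ S *ᵥ v| ≤ (∑ α, ∑ β, |S α β|) * ((u ⬝ᵥ u + v ⬝ᵥ v) / 2) := by
  have hsq (w : n → ℝ) (α : n) : |w α| ^ 2 ≤ w ⬝ᵥ w := by
    rw [sq_abs, pow_two]
    exact Finset.single_le_sum (f := fun α => w α * w α) (fun α _ => mul_self_nonneg _)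
      (Finset.mem_univ α)
  simp only [dotProduct, mulVec, Finset.mul_sum] at hsq ⊢
  rw [Finset.sum_mul]
  refine (Finset.abs_sum_le_sum_abs _ _).trans (Finset.sum_le_sum fun α _ => ?_)
  rw [Finset.sum_mul]
  refine (Finset.abs_sum_le_sum_abs _ _).trans (Finset.sum_le_sum fun β _ => ?_)
  rw [abs_mul, abs_mul, mul_left_comm]
  gcongr
  nlinarith [sq_nonneg (|u α| - |v β|), hsq u α, hsq v β]

lemma exists_dominates_smul {ι : Type*} [Finite ι] {D : ι → Matrix n n ℝ} {ε : ℝ} (hε : 0 < ε)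
    (hD : ∀ i v, ε * (v ⬝ᵥ v) ≤ v ⬝ᵥ D i *ᵥ v) (S : ι → Matrix n n ℝ) :
    ∃ c : ℝ, 0 ≤ c ∧ Dominates (c • D) S := by
  cases nonempty_fintype ι
  set b := ∑ i, ∑ α, ∑ β, |S i α β|
  have hb : 0 ≤ b := by positivity
  refine ⟨b / ε, by positivity, fun i u v => ?_⟩
  have hi : ∑ α, ∑ β, |S i α β| ≤ b :=
    Finset.single_le_sum (f := fun i => ∑ α, ∑ β, |S i α β|) (fun i _ => by positivity)
      (Finset.mem_univ i)
  have hform (w : n → ℝ) : b * (w ⬝ᵥ w) ≤ w ⬝ᵥ (b / ε) • D i *ᵥ w := by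
    rw [dotProduct_smul, smul_eq_mul, div_mul_eq_mul_div, le_div_iff₀ hε, mul_assoc,
      mul_comm _ ε]
    exact mul_le_mul_of_nonneg_left (hD i w) hb
  have huv := add_nonneg (dotProduct_self_nonneg u) (dotProduct_self_nonneg v)
  calc |u ⬝ᵥ S i *ᵥ v| ≤ (∑ α, ∑ β, |S i α β|) * ((u ⬝ᵥ u + v ⬝ᵥ v) / 2) :=
        abs_dotProduct_mulVec_le_sum_abs (S i) u v
    _ ≤ b * ((u ⬝ᵥ u + v ⬝ᵥ v) / 2) := by gcongr
    _ ≤ _ := by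
      simp only [Pi.smul_apply, smul_mulVec]
      linarith [hform u, hform v]

lemma exists_abs_lyapAdjoint_pow_le [DecidableEq n] (hp : ∀ i j, 0 ≤ p i j) {ε : ℝ} (hε : 0 < ε)
    (hD : ∀ i v, ε * (v ⬝ᵥ v) ≤ v ⬝ᵥ D i *ᵥ v) (hD' : ∀ i, (D i).PosSemidef)
    (S : ι → Matrix n n ℝ) :
    ∃ c : ℝ, ∀ t i α β, |(lyapAdjoint p G ^ t) S i α β| ≤
      c * tracePairing 1 ((lyapAdjoint p G ^ t) D) := by
  obtain ⟨c, hc, hdom⟩ := exists_dominates_smul hε hD S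
  refine ⟨c, fun t i α β => ?_⟩
  have hpsd := lyapAdjoint_pow_posSemidef (G := G) hp hD' t
  have hdiag (γ : n) : (lyapAdjoint p G ^ t) D i γ γ ≤
      tracePairing 1 ((lyapAdjoint p G ^ t) D) := by
    rw [tracePairing_one]
    exact (le_abs_self _).trans ((abs_apply_le_trace (hpsd i) γ γ).trans <|
      Finset.single_le_sum (f := fun i => ((lyapAdjoint p G ^ t) D i).trace)
        (fun i _ => (hpsd i).trace_nonneg) (Finset.mem_univ i))
  have hentry := hdom.lyapAdjoint_pow (G := G) hp t i (Pi.single α 1) (Pi.single β 1)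
  simp only [mulVec_single_one, single_one_dotProduct, col_apply, map_smul, Pi.smul_apply,
    Matrix.smul_apply, smul_eq_mul] at hentry
  linarith [mul_le_mul_of_nonneg_left (hdiag α) hc, mul_le_mul_of_nonneg_left (hdiag β) hc]

end Domination

section IsStable

variable {ι n : Type*} [Fintype ι] [Fintype n] {p : Matrix ι ι ℝ} {G : ι → Matrix n n ℝ}

variable (p G) in
/-- Stability of the second moment dynamics of a jump linear system: the powers of its moment
operator tend to zero. -/
def IsStable : Prop := ∀ S, Tendsto (fun t => (lyapAdjoint p G ^ t) S) atTop (𝓝 0)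

lemma isStable_of_tendsto_trace [DecidableEq n] (hp : ∀ i j, 0 ≤ p i j) {D : ι → Matrix n n ℝ}
    {ε : ℝ} (hε : 0 < ε) (hD : ∀ i v, ε * (v ⬝ᵥ v) ≤ v ⬝ᵥ D i *ᵥ v)
    (hD' : ∀ i, (D i).PosSemidef)
    (h : Tendsto (fun t => tracePairing 1 ((lyapAdjoint p G ^ t) D)) atTop (𝓝 0)) :
    IsStable p G := by
  intro S
  obtain ⟨c, hc⟩ := exists_abs_lyapAdjoint_pow_le (G := G) hp hε hD hD' S
  refine tendsto_pi_nhds.2 fun i => tendsto_pi_nhds.2 fun α => tendsto_pi_nhds.2 fun β => ?_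
  exact squeeze_zero_norm (fun t => hc t i α β) (by simpa only [mul_zero] using h.const_mul c)

lemma isStable_of_tendsto_vecMulVec [DecidableEq ι] (hp : ∀ i j, 0 ≤ p i j)
    (h : ∀ i x, Tendsto (fun t => ∑ j, (lyapAdjoint p G ^ t) (Pi.single i (vecMulVec x x)) j)
      atTop (𝓝 0)) : IsStable p G := by
  classical
  refine isStable_of_tendsto_trace (D := 1) hp one_pos
    (fun i v => by rw [Pi.one_apply, one_mulVec, one_mul]) (fun _ => .one) ?_
  have hone : (1 : ι → Matrix n n ℝ) =
      ∑ i, ∑ γ, Pi.single i (vecMulVec (Pi.single γ 1) (Pi.single γ 1)) := by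
    ext i α β
    simp only [Finset.sum_apply, Matrix.sum_apply, Pi.one_apply, one_apply]
    rw [Finset.sum_eq_single_of_mem i (Finset.mem_univ i)]
    · simp [vecMulVec_apply, Pi.single_apply]
    · intro j _ hj
      simp [hj.symm]
  have hlim := tendsto_finsetSum Finset.univ fun i _ => tendsto_finsetSum Finset.univ fun γ _ =>
    (continuous_id.matrix_trace.tendsto _).comp (h i (Pi.single γ 1))
  simp only [id, trace_zero, Finset.sum_const_zero] at hlim
  refine hlim.congr fun t => ?_
  rw [tracePairing_one, hone]
  simp only [map_sum, Function.comp_apply, trace_sum, Finset.sum_apply]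
  rw [Finset.sum_congr rfl fun i _ => Finset.sum_comm, Finset.sum_comm]

/-- The pairing with `P` decreases along the moment dynamics, by at least `ε` times the trace in
each step, so the traces are summable. -/
lemma isStable_of_lyapunov (hp : ∀ i j, 0 ≤ p i j) {P : ι → Matrix n n ℝ}
    (hP : ∀ i v, 0 ≤ v ⬝ᵥ P i *ᵥ v) {ε : ℝ} (hε : 0 < ε)
    (h : ∀ i v, ε * (v ⬝ᵥ v) ≤ v ⬝ᵥ (P - lyapOp p G P) i *ᵥ v) : IsStable p G := by
  classical
  have hone (v : n → ℝ) : v ⬝ᵥ (1 : Matrix n n ℝ) *ᵥ v = v ⬝ᵥ v := by rw [one_mulVec]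
  refine isStable_of_tendsto_trace (D := 1) hp one_pos
    (fun _ v => by rw [Pi.one_apply, hone, one_mul]) (fun _ => .one) ?_
  have hpsd (t) := lyapAdjoint_pow_posSemidef (G := G) (S := 1) hp (fun _ => .one) t
  set S : ℕ → ι → Matrix n n ℝ := fun t => (lyapAdjoint p G ^ t) 1
  have hnonneg (t) : 0 ≤ tracePairing 1 (S t) :=
    tracePairing_nonneg (fun _ v => (hone v).ge.trans' (dotProduct_self_nonneg v)) (hpsd t)
  have hdecr (t) : ε * tracePairing 1 (S t) ≤
      tracePairing P (S t) - tracePairing P (S (t + 1)) := by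
    have hsucc : S (t + 1) = lyapAdjoint p G (S t) := by
      simp only [S]
      rw [pow_succ', Module.End.mul_apply]
    rw [hsucc, ← tracePairing_lyapOp, ← LinearMap.sub_apply, ← map_sub]
    exact mul_tracePairing_one_le h (hpsd t)
  refine (summable_of_sum_range_le (c := ε⁻¹ * tracePairing P (S 0)) hnonneg
    fun m => ?_).tendsto_atTop_zero
  rw [← div_eq_inv_mul, le_div_iff₀ hε, mul_comm, Finset.mul_sum]
  refine (Finset.sum_le_sum fun t _ => hdecr t).trans ?_
  rw [Finset.sum_range_sub']
  linarith [tracePairing_nonneg hP (hpsd m)]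

lemma sum_range_lyapAdjoint_pow {X S : ι → Matrix n n ℝ} (hX : X = S + lyapAdjoint p G X)
    (m : ℕ) : ∑ t ∈ Finset.range m, (lyapAdjoint p G ^ t) S = X - (lyapAdjoint p G ^ m) X := by
  induction m with
  | zero => rw [Finset.sum_range_zero, pow_zero, Module.End.one_apply, sub_self]
  | succ m ih =>
    have hstep : (lyapAdjoint p G ^ m) X =
        (lyapAdjoint p G ^ m) S + (lyapAdjoint p G ^ (m + 1)) X := by
      rw [pow_succ, Module.End.mul_apply, ← map_add, ← hX]
    rw [Finset.sum_range_succ, ih, hstep]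
    abel

namespace IsStable

variable (hG : IsStable p G)
include hG

lemma injective_one_sub_lyapAdjoint : Function.Injective ⇑(1 - lyapAdjoint p G) := by
  refine (injective_iff_map_eq_zero _).2 fun S hS => ?_
  rw [LinearMap.sub_apply, Module.End.one_apply, sub_eq_zero] at hS
  have hfix (t : ℕ) : (lyapAdjoint p G ^ t) S = S := by
    rw [Module.End.pow_apply, Function.iterate_fixed hS.symm]
  exact tendsto_nhds_unique tendsto_const_nhds ((hG S).congr hfix)

lemma injective_one_sub_lyapOp : Function.Injective ⇑(1 - lyapOp p G) := by
  refine (injective_iff_map_eq_zero _).2 fun P hP => tracePairing_eq_zero_iff.1 fun S => ?_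
  rw [LinearMap.sub_apply, Module.End.one_apply, sub_eq_zero] at hP
  have hconst (t : ℕ) : tracePairing P ((lyapAdjoint p G ^ t) S) = tracePairing P S := by
    induction t with
    | zero => rw [pow_zero, Module.End.one_apply]
    | succ t ih => rw [pow_succ', Module.End.mul_apply, ← tracePairing_lyapOp, ← hP, ih]
  have hlim := ((continuous_tracePairing P).tendsto 0).comp (hG S)
  rw [map_zero] at hlim
  exact tendsto_nhds_unique tendsto_const_nhds (hlim.congr hconst)

lemma existsUnique_eq_add_lyapAdjoint (S : ι → Matrix n n ℝ) :
    ∃! X, X = S + lyapAdjoint p G X := by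
  have hinj := hG.injective_one_sub_lyapAdjoint
  simpa only [LinearMap.sub_apply, Module.End.one_apply, sub_eq_iff_eq_add] using
    Function.Bijective.existsUnique ⟨hinj, LinearMap.injective_iff_surjective.1 hinj⟩ S

lemma existsUnique_eq_add_lyapOp (H : ι → Matrix n n ℝ) : ∃! P, P = H + lyapOp p G P := by
  have hinj := hG.injective_one_sub_lyapOp
  simpa only [LinearMap.sub_apply, Module.End.one_apply, sub_eq_iff_eq_add] using
    Function.Bijective.existsUnique ⟨hinj, LinearMap.injective_iff_surjective.1 hinj⟩ H

lemma transpose_eq_self {P H : ι → Matrix n n ℝ} (hP : P = H + lyapOp p G P)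
    (hH : ∀ i, (H i)ᵀ = H i) (i : ι) : (P i)ᵀ = P i := by
  refine congrFun ((hG.existsUnique_eq_add_lyapOp H).unique (y₁ := fun i => (P i)ᵀ) ?_ hP) i
  rw [lyapOp_transpose]
  ext1 i
  rw [Pi.add_apply, ← hH i, ← transpose_add, ← Pi.add_apply, ← hP]

lemma tendsto_sum_range_lyapAdjoint_pow {X S : ι → Matrix n n ℝ}
    (hX : X = S + lyapAdjoint p G X) :
    Tendsto (fun m => ∑ t ∈ Finset.range m, (lyapAdjoint p G ^ t) S) atTop (𝓝 X) := by
  simpa only [sum_range_lyapAdjoint_pow hX, sub_zero] using (hG X).const_sub X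

lemma summable_tracePairing_one [DecidableEq n] (hp : ∀ i j, 0 ≤ p i j) :
    Summable fun t => tracePairing (1 : ι → Matrix n n ℝ) ((lyapAdjoint p G ^ t) 1) := by
  obtain ⟨X, hX, -⟩ := hG.existsUnique_eq_add_lyapAdjoint 1
  have hnonneg (t) : 0 ≤ tracePairing (1 : ι → Matrix n n ℝ) ((lyapAdjoint p G ^ t) 1) :=
    tracePairing_nonneg (fun _ => quadForm_nonneg PosSemidef.one)
      (lyapAdjoint_pow_posSemidef hp (fun _ => .one) t)
  have hlim := ((continuous_tracePairing 1).tendsto X).comp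
    (hG.tendsto_sum_range_lyapAdjoint_pow hX)
  simp only [Function.comp_def, map_sum] at hlim
  exact ((hasSum_iff_tendsto_nat_of_nonneg hnonneg _).2 hlim).summable

lemma hasSum_lyapAdjoint_pow (hp : ∀ i j, 0 ≤ p i j) {X S : ι → Matrix n n ℝ}
    (hX : X = S + lyapAdjoint p G X) : HasSum (fun t => (lyapAdjoint p G ^ t) S) X := by
  classical
  obtain ⟨c, hc⟩ := exists_abs_lyapAdjoint_pow_le (G := G) (D := 1) hp one_pos
    (fun i v => by rw [Pi.one_apply, one_mulVec, one_mul]) (fun _ => .one) S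
  have hsum : Summable fun t => (lyapAdjoint p G ^ t) S :=
    Pi.summable.2 fun i => Pi.summable.2 fun α => Pi.summable.2 fun β =>
      .of_norm_bounded ((hG.summable_tracePairing_one hp).mul_left c) fun t => hc t i α β
  rw [tendsto_nhds_unique (hG.tendsto_sum_range_lyapAdjoint_pow hX) hsum.hasSum.tendsto_sum_nat]
  exact hsum.hasSum

lemma hasSum_tracePairing (hp : ∀ i j, 0 ≤ p i j) {X S : ι → Matrix n n ℝ}
    (hX : X = S + lyapAdjoint p G X) (H : ι → Matrix n n ℝ) :
    HasSum (fun t => tracePairing H ((lyapAdjoint p G ^ t) S)) (tracePairing H X) :=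
  (hG.hasSum_lyapAdjoint_pow hp hX).map (tracePairing H) (continuous_tracePairing H)

lemma posSemidef (hp : ∀ i j, 0 ≤ p i j) {X S : ι → Matrix n n ℝ}
    (hX : X = S + lyapAdjoint p G X) (hS : ∀ i, (S i).PosSemidef) (i : ι) :
    (X i).PosSemidef := by
  classical
  have hpsd := lyapAdjoint_pow_posSemidef (G := G) hp hS
  have hsum := Pi.hasSum.1 (hG.hasSum_lyapAdjoint_pow hp hX) i
  refine posSemidef_of_quadForm_nonneg (hsum.unique ?_).symm fun v => ?_
  · simpa only [transpose_eq_of_posSemidef (hpsd _ i)] using hsum.matrix_transpose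
  · rw [← tracePairing_single_vecMulVec, tracePairing_comm]
    refine (hG.hasSum_tracePairing hp hX (Pi.single i (vecMulVec v v))).nonneg fun t => ?_
    rw [tracePairing_comm, tracePairing_single_vecMulVec]
    exact quadForm_nonneg (hpsd t i) v

lemma le_of_eq_add_lyapAdjoint (hp : ∀ i j, 0 ≤ p i j) {X S : ι → Matrix n n ℝ}
    (hX : X = S + lyapAdjoint p G X) (hS : ∀ i, (S i).PosSemidef) (i : ι) (v : n → ℝ) :
    v ⬝ᵥ S i *ᵥ v ≤ v ⬝ᵥ X i *ᵥ v := by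
  have hnext := quadForm_nonneg (lyapAdjoint_posSemidef (G := G) hp (hG.posSemidef hp hX hS) i) v
  rw [congrFun hX i, Pi.add_apply, add_mulVec, dotProduct_add]
  linarith

lemma le_of_eq_add_lyapOp (hp : ∀ i j, 0 ≤ p i j) {P H : ι → Matrix n n ℝ}
    (hP : P = H + lyapOp p G P) (hH : ∀ i v, 0 ≤ v ⬝ᵥ H i *ᵥ v) (i : ι) (v : n → ℝ) :
    v ⬝ᵥ H i *ᵥ v ≤ v ⬝ᵥ P i *ᵥ v := by
  classical
  have hS (j : ι) : ((Pi.single i (vecMulVec v v) : ι → Matrix n n ℝ) j).PosSemidef := by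
    obtain rfl | hj := eq_or_ne j i
    · simpa only [Pi.single_eq_same] using posSemidef_vecMulVec_self v
    · simpa only [Pi.single_eq_of_ne hj] using PosSemidef.zero
  obtain ⟨X, hX, -⟩ := hG.existsUnique_eq_add_lyapAdjoint (Pi.single i (vecMulVec v v))
  rw [← tracePairing_single_vecMulVec, ← tracePairing_single_vecMulVec,
    tracePairing_eq_of_eq_add hP hX]
  conv_rhs => rw [hX, map_add]
  exact le_add_of_nonneg_right <| tracePairing_nonneg hH <|
    lyapAdjoint_posSemidef hp (hG.posSemidef hp hX hS)

end IsStable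

end IsStable

/-! ### Second moments of jump linear systems -/

section MomentMatrix

variable {n Ω : Type*} [MeasurableSpace Ω] {μ : Measure Ω} {X : Ω → n → ℝ}

/-- The second moment matrix `∫ X Xᵀ dμ` of a random vector `X`. -/
def momentMatrix (μ : Measure Ω) (X : Ω → n → ℝ) : Matrix n n ℝ :=
  of fun α β => ∫ a, X a α * X a β ∂μ

lemma momentMatrix_const [IsProbabilityMeasure μ] (x : n → ℝ) :
    momentMatrix μ (fun _ => x) = vecMulVec x x := by
  ext α β
  rw [momentMatrix, of_apply, integral_const, probReal_univ, one_smul, vecMulVec_apply]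

variable [Fintype n]

lemma memLp_mulVec_apply (hX : ∀ α, MemLp (fun a => X a α) 2 μ) {m : Type*} (G : Matrix m n ℝ)
    (α : m) : MemLp (fun a => (G *ᵥ X a) α) 2 μ :=
  memLp_finsetSum _ fun β _ => (hX β).const_mul (G α β)

lemma momentMatrix_mulVec (hX : ∀ α, MemLp (fun a => X a α) 2 μ) {m : Type*} (G : Matrix m n ℝ) :
    momentMatrix μ (fun a => G *ᵥ X a) = G * momentMatrix μ X * Gᵀ := by
  have hInt (γ δ : n) : Integrable (fun a => X a γ * X a δ) μ := (hX γ).integrable_mul (hX δ)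
  ext α β
  have hexpand (a : Ω) : (G *ᵥ X a) α * (G *ᵥ X a) β =
      ∑ δ, ∑ γ, G α γ * G β δ * (X a γ * X a δ) := by
    rw [Finset.sum_comm, mulVec, mulVec, dotProduct, dotProduct, Finset.sum_mul_sum]
    exact Finset.sum_congr rfl fun γ _ => Finset.sum_congr rfl fun δ _ => by ring
  simp only [momentMatrix, of_apply, mul_apply, transpose_apply, Finset.sum_mul, hexpand]
  rw [integral_finsetSum _ fun δ _ => integrable_finsetSum _ fun γ _ => (hInt γ δ).const_mul _]
  refine Finset.sum_congr rfl fun δ _ => ?_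
  rw [integral_finsetSum _ fun γ _ => (hInt γ δ).const_mul _]
  refine Finset.sum_congr rfl fun γ _ => ?_
  rw [integral_const_mul]
  ring

lemma integrable_dotProduct_mulVec (hX : ∀ α, MemLp (fun a => X a α) 2 μ) (H : Matrix n n ℝ) :
    Integrable (fun a => X a ⬝ᵥ H *ᵥ X a) μ :=
  integrable_finsetSum _ fun α _ => (hX α).integrable_mul (memLp_mulVec_apply hX H α)

lemma integral_dotProduct_mulVec (hX : ∀ α, MemLp (fun a => X a α) 2 μ) (H : Matrix n n ℝ) :
    ∫ a, X a ⬝ᵥ H *ᵥ X a ∂μ = (H * momentMatrix μ X).trace := by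
  have hInt (α β : n) : Integrable (fun a => H α β * (X a β * X a α)) μ :=
    ((hX β).integrable_mul (hX α)).const_mul _
  have hexpand (a : Ω) : X a ⬝ᵥ H *ᵥ X a = ∑ α, ∑ β, H α β * (X a β * X a α) := by
    simp only [dotProduct, mulVec, Finset.mul_sum]
    exact Finset.sum_congr rfl fun α _ => Finset.sum_congr rfl fun β _ => by ring
  simp only [trace, diag_apply, mul_apply, momentMatrix, of_apply, hexpand]
  rw [integral_finsetSum _ fun α _ => integrable_finsetSum _ fun β _ => hInt α β]
  refine Finset.sum_congr rfl fun α _ => ?_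
  rw [integral_finsetSum _ fun β _ => hInt α β]
  exact Finset.sum_congr rfl fun β _ => integral_const_mul ..

end MomentMatrix

section MarkovChain

variable {N : ℕ} {Ω E : Type*} [MeasurableSpace Ω] [MeasurableSpace E] {Pr : Measure Ω}
  {ω : ℕ → Ω → Fin N} {π : Fin N → ℝ} {p : Matrix (Fin N) (Fin N) ℝ} {z : Ω → E}

lemma sum_setIntegral_fiber {β : Type*} [Fintype β] [MeasurableSpace β]
    [MeasurableSingletonClass β] {Y : Ω → β} (hY : Measurable Y) {f : Ω → ℝ}
    (hf : Integrable f Pr) : ∑ b, ∫ a in {a | Y a = b}, f a ∂Pr = ∫ a, f a ∂Pr := by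
  have hcover : ⋃ b, {a | Y a = b} = Set.univ := Set.iUnion_eq_univ_iff.2 fun a => ⟨Y a, rfl⟩
  have hdisj : Pairwise (Function.onFun Disjoint fun b => {a | Y a = b}) := fun b c hbc =>
    Set.disjoint_left.2 fun a hb hc => hbc (hb.symm.trans hc)
  rw [← integral_iUnion_fintype (s := fun b => {a | Y a = b})
    (fun b => hY (measurableSet_singleton b)) hdisj fun _ => hf.integrableOn, hcover,
    setIntegral_univ]

lemma sum_momentMatrix_restrict_fiber {β n : Type*} [Fintype β] [MeasurableSpace β]
    [MeasurableSingletonClass β] {Y : Ω → β} (hY : Measurable Y) {X : Ω → n → ℝ}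
    (hX : ∀ α, MemLp (fun a => X a α) 2 Pr) :
    ∑ b, momentMatrix (Pr.restrict {a | Y a = b}) X = momentMatrix Pr X := by
  ext α β
  rw [Matrix.sum_apply]
  exact sum_setIntegral_fiber hY ((hX α).integrable_mul (hX β))

lemma setIntegral_comp_of_indepFun {F : Type*} [MeasurableSpace F] {Y : Ω → F}
    (hzY : IndepFun z Y Pr) (hz : Measurable z) (hY : Measurable Y) {f : E → ℝ}
    (hf : Measurable f) {T : Set F} (hT : MeasurableSet T) :
    ∫ a in {a | Y a ∈ T}, f (z a) ∂Pr = Pr.real {a | Y a ∈ T} * ∫ a, f (z a) ∂Pr :=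
  ((IndepFun_iff_Indep ..).1 hzY.symm).setIntegral_eq_mul hY.comap_le hz.aemeasurable
    ⟨T, hT, rfl⟩ hf.aestronglyMeasurable

lemma setIntegral_eq_sum_path (hω : ∀ t, Measurable (ω t))
    (hzω : IndepFun z (fun a t => ω t a) Pr) (hz : Measurable z) {t : ℕ}
    {F : E → (ℕ → Fin N) → ℝ} (hF : ∀ x, DependsOn (F x) (Set.Iic t))
    (hFm : ∀ w, Measurable fun x => F x w)
    (hInt : Integrable (fun a => F (z a) fun s => ω s a) Pr) {T : Set (ℕ → Fin N)}
    (hT : MeasurableSet T) :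
    ∫ a in {a | (fun s => ω s a) ∈ T}, F (z a) (fun s => ω s a) ∂Pr =
      ∑ v : Fin (t + 1) → Fin N,
        Pr.real ({a | ∀ s ≤ t, ω s a = v (Fin.ofNat _ s)} ∩ {a | (fun s => ω s a) ∈ T}) *
          ∫ a, F (z a) (fun s => v (Fin.ofNat _ s)) ∂Pr := by
  have hpath : Measurable fun a t => ω t a := measurable_pi_lambda _ hω
  have hprefix : Measurable fun a (s : Fin (t + 1)) => ω s a :=
    measurable_pi_lambda _ fun s => hω s
  rw [← sum_setIntegral_fiber hprefix hInt.restrict]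
  refine Finset.sum_congr rfl fun v _ => ?_
  set C : Set (ℕ → Fin N) := {w | ∀ s ≤ t, w s = v (Fin.ofNat _ s)}
  have hC : MeasurableSet C := by
    simp only [C, Set.ofPred_forall]
    exact .iInter fun s => .iInter fun _ => measurable_pi_apply s (measurableSet_singleton _)
  have hfiber : {a | (fun s : Fin (t + 1) => ω s a) = v} = {a | (fun s => ω s a) ∈ C} := by
    ext a
    refine ⟨fun h s hs => ?_, fun h => funext fun s => ?_⟩
    · rw [← show (fun s : Fin (t + 1) => ω s a) = v from h]
      simp [Nat.mod_eq_of_lt (Nat.lt_succ_of_le hs)]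
    · simpa using h s (Nat.le_of_lt_succ s.2)
  have hmeas : MeasurableSet {a | (fun s : Fin (t + 1) => ω s a) = v} :=
    hprefix (measurableSet_singleton v)
  rw [Measure.restrict_restrict hmeas, hfiber]
  exact (setIntegral_congr_fun (hpath (hC.inter hT)) fun a ha => hF (z a) fun s hs =>
    ha.1 s hs).trans (setIntegral_comp_of_indepFun hzω hz hpath (hFm _) (hC.inter hT))

namespace IsMarkovChain

variable (hω : IsMarkovChain Pr ω π p)
include hω

lemma measureReal_inter_next (t : ℕ) (w : ℕ → Fin N) (j : Fin N) :
    Pr.real ({a | ∀ s ≤ t, ω s a = w s} ∩ {a | ω (t + 1) a = j}) =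
      Pr.real {a | ∀ s ≤ t, ω s a = w s} * p (w t) j := by
  have hagree (s) (hs : s ≤ t) : Function.update w (t + 1) j s = w s :=
    Function.update_of_ne (by lia) ..
  have h := hω.step t (Function.update w (t + 1) j)
  have hpast : {a | ∀ s ≤ t, ω s a = Function.update w (t + 1) j s} =
      {a | ∀ s ≤ t, ω s a = w s} := by
    ext a
    exact forall₂_congr fun s hs => by rw [hagree s hs]
  rw [Function.update_self, hagree t le_rfl, hpast] at h
  convert h using 2
  · ext a
    refine ⟨fun ha s hs => ?_, fun ha => ⟨fun s hs => ?_, ?_⟩⟩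
    · obtain hs | rfl := Nat.le_succ_iff.1 hs
      · rw [hagree s hs, ha.1 s hs]
      · rw [Function.update_self, ha.2]
    · rw [ha s (by lia), hagree s hs]
    · exact (ha (t + 1) le_rfl).trans (Function.update_self ..)

lemma setIntegral_succ (hzω : IndepFun z (fun a t => ω t a) Pr) (hz : Measurable z) {t : ℕ}
    {F : E → (ℕ → Fin N) → ℝ} (hF : ∀ x, DependsOn (F x) (Set.Iic t))
    (hFm : ∀ w, Measurable fun x => F x w)
    (hInt : Integrable (fun a => F (z a) fun s => ω s a) Pr) (j : Fin N) :
    ∫ a in {a | ω (t + 1) a = j}, F (z a) (fun s => ω s a) ∂Pr =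
      ∑ i, p i j * ∫ a in {a | ω t a = i}, F (z a) (fun s => ω s a) ∂Pr := by
  have hpath (s : ℕ) (i : Fin N) := setIntegral_eq_sum_path hω.measurable hzω hz hF hFm hInt
    (T := (· s) ⁻¹' {i}) (measurable_pi_apply s (measurableSet_singleton i))
  simp only [Set.mem_preimage, Set.mem_singleton_iff] at hpath
  simp only [hpath, Finset.mul_sum]
  rw [Finset.sum_comm]
  refine Finset.sum_congr rfl fun v _ => ?_
  set w : ℕ → Fin N := fun s => v (Fin.ofNat _ s)
  rw [hω.measureReal_inter_next t w j, Finset.sum_eq_single_of_mem (w t) (Finset.mem_univ _)]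
  · have hinter : {a | ∀ s ≤ t, ω s a = w s} ∩ {a | ω t a = w t} =
        {a | ∀ s ≤ t, ω s a = w s} := Set.inter_eq_left.2 fun a ha => ha t le_rfl
    rw [hinter]
    ring
  · intro i _ hi
    have hinter : {a | ∀ s ≤ t, ω s a = w s} ∩ {a | ω t a = i} = ∅ :=
      Set.eq_empty_of_forall_notMem fun a ha => hi (ha.2.symm.trans (ha.1 t le_rfl))
    rw [hinter, measureReal_empty, zero_mul, mul_zero]

lemma cond_initial (i : Fin N) (hi : Pr {a | ω 0 a = i} ≠ 0) [IsFiniteMeasure Pr] :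
    IsMarkovChain (cond Pr {a | ω 0 a = i}) ω (Pi.single i 1) p where
  measurable := hω.measurable
  initial j := by
    obtain rfl | hj := eq_or_ne j i
    · rw [Pi.single_eq_same, measureReal_def, cond_apply_self hi (measure_ne_top _ _),
        ENNReal.toReal_one]
    · have hm : MeasurableSet {a | ω 0 a = i} := hω.measurable 0 (measurableSet_singleton i)
      have hinter : {a | ω 0 a = i} ∩ {a | ω 0 a = j} = ∅ :=
        Set.eq_empty_of_forall_notMem fun a ha => hj (ha.2.symm.trans ha.1)
      rw [Pi.single_eq_of_ne hj, measureReal_def, cond_apply hm, hinter, measure_empty, mul_zero,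
        ENNReal.toReal_zero]
  step t w := by
    have hm : MeasurableSet {a | ω 0 a = i} := hω.measurable 0 (measurableSet_singleton i)
    simp only [measureReal_def, cond_apply hm, ENNReal.toReal_mul]
    simp only [← measureReal_def]
    by_cases hw : w 0 = i
    · have hinter (m : ℕ) : {a | ω 0 a = i} ∩ {a | ∀ s ≤ m, ω s a = w s} =
          {a | ∀ s ≤ m, ω s a = w s} :=
        Set.inter_eq_right.2 fun a ha => (ha 0 m.zero_le).trans hw
      rw [hinter, hinter, hω.step, mul_assoc]
    · have hinter (m : ℕ) : {a | ω 0 a = i} ∩ {a | ∀ s ≤ m, ω s a = w s} = ∅ :=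
        Set.eq_empty_of_forall_notMem fun a ha => hw ((ha.2 0 m.zero_le).symm.trans ha.1)
      rw [hinter, hinter, measureReal_empty, mul_zero, zero_mul]

end IsMarkovChain

end MarkovChain

section JumpState

variable {n Ω : Type*} [Fintype n] [MeasurableSpace Ω] {N : ℕ} {Pr : Measure Ω}
  {ω : ℕ → Ω → Fin N} {π : Fin N → ℝ} {p : Matrix (Fin N) (Fin N) ℝ} {z : Ω → n → ℝ}
  (G : Fin N → Matrix n n ℝ)

/-- The trajectory `x_{t+1} = G_{w(t)} x_t` of a jump linear system along the path `w` of modes,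
started in `x`. -/
def jumpState (w : ℕ → Fin N) (x : n → ℝ) : ℕ → n → ℝ
  | 0 => x
  | t + 1 => G (w t) *ᵥ jumpState w x t

lemma dependsOn_jumpState (x : n → ℝ) (t : ℕ) :
    DependsOn (fun w => jumpState G w x t) (Set.Iio t) := by
  induction t with
  | zero => exact fun _ _ _ => rfl
  | succ t ih =>
    intro w w' h
    simp only [jumpState, h t (Set.mem_Iio.2 t.lt_succ_self),
      ih fun s hs => h s (Set.mem_Iio.2 (Nat.lt_succ_of_lt hs))]

lemma measurable_jumpState (w : ℕ → Fin N) (t : ℕ) :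
    Measurable fun x => jumpState G w x t := by
  induction t with
  | zero => exact measurable_id
  | succ t ih => exact (G (w t)).mulVecLin.continuous_of_finiteDimensional.measurable.comp ih

lemma memLp_jumpState (hω : ∀ t, Measurable (ω t)) (hz : ∀ α, MemLp (fun a => z a α) 2 Pr)
    (t : ℕ) (α : n) : MemLp (fun a => jumpState G (fun s => ω s a) (z a) t α) 2 Pr := by
  induction t generalizing α with
  | zero => exact hz α
  | succ t ih =>
    have hsplit : (fun a => jumpState G (fun s => ω s a) (z a) (t + 1) α) = fun a => ∑ i,
        {a | ω t a = i}.indicator (fun a => (G i *ᵥ jumpState G (fun s => ω s a) (z a) t) α) a := by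
      ext a
      simp [jumpState, Set.indicator_apply]
    rw [hsplit]
    exact memLp_finsetSum _ fun i _ =>
      (memLp_mulVec_apply ih (G i) α).indicator (hω t (measurableSet_singleton i))

lemma momentMatrix_jumpState_succ (hω : IsMarkovChain Pr ω π p) (hzm : Measurable z)
    (hzω : IndepFun z (fun a t => ω t a) Pr) (hz : ∀ α, MemLp (fun a => z a α) 2 Pr) (t : ℕ) :
    (fun j => momentMatrix (Pr.restrict {a | ω (t + 1) a = j})
        fun a => jumpState G (fun s => ω s a) (z a) (t + 1)) =
      lyapAdjoint p G fun i => momentMatrix (Pr.restrict {a | ω t a = i})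
        fun a => jumpState G (fun s => ω s a) (z a) t := by
  have hmem := memLp_jumpState G hω.measurable hz
  have hstep (i : Fin N) : momentMatrix (Pr.restrict {a | ω t a = i})
      (fun a => jumpState G (fun s => ω s a) (z a) (t + 1)) =
      G i * momentMatrix (Pr.restrict {a | ω t a = i})
        (fun a => jumpState G (fun s => ω s a) (z a) t) * (G i)ᵀ := by
    rw [← momentMatrix_mulVec fun α => (hmem t α).restrict _]
    ext α β
    refine setIntegral_congr_fun (hω.measurable t (measurableSet_singleton i)) fun a ha => ?_
    simp only [jumpState, show ω t a = i from ha]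
  ext j α β
  simp only [lyapAdjoint_apply, ← hstep, Matrix.sum_apply, Matrix.smul_apply, smul_eq_mul]
  refine hω.setIntegral_succ hzω hzm
    (F := fun x w => jumpState G w x (t + 1) α * jumpState G w x (t + 1) β)
    (fun x w w' h => ?_) (fun w => ?_) ((hmem _ α).integrable_mul (hmem _ β)) j
  · have hdep := dependsOn_jumpState G x (t + 1) fun s hs => h s (Nat.le_of_lt_succ hs)
    dsimp only at hdep ⊢
    rw [hdep]
  · have hmeas := measurable_pi_iff.1 (measurable_jumpState G w (t + 1))
    exact (hmeas α).mul (hmeas β)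

lemma momentMatrix_jumpState (hω : IsMarkovChain Pr ω π p) (hzm : Measurable z)
    (hzω : IndepFun z (fun a t => ω t a) Pr) (hz : ∀ α, MemLp (fun a => z a α) 2 Pr) (t : ℕ) :
    (fun j => momentMatrix (Pr.restrict {a | ω t a = j})
        fun a => jumpState G (fun s => ω s a) (z a) t) =
      (lyapAdjoint p G ^ t) fun i => π i • momentMatrix Pr z := by
  induction t with
  | zero =>
    ext j α β
    have hinit := setIntegral_comp_of_indepFun hzω hzm (measurable_pi_lambda _ hω.measurable)
      (f := fun x => x α * x β) ((measurable_pi_apply α).mul (measurable_pi_apply β))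
      (T := (· 0) ⁻¹' {j}) (measurable_pi_apply 0 (measurableSet_singleton j))
    exact hinit.trans (congrArg (· * ∫ a, z a α * z a β ∂Pr) (hω.initial j))
  | succ t ih =>
    rw [momentMatrix_jumpState_succ G hω hzm hzω hz, ih, pow_succ', Module.End.mul_apply]

end JumpState

/-! ### Stability and the cost -/

section StabilityAndCost

variable {N d k : ℕ} {Ω : Type*} [MeasurableSpace Ω] (M : MJLS N d k Ω) (K : Policy N k d)

section Correlation

/-- The initial correlations `X(0) = (π_i E[x_0 x_0ᵀ])_i`. -/
def X0 (i : Fin N) : Matrix (Fin d) (Fin d) ℝ := M.π i • M.cov0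

lemma state_eq_jumpState (x : Fin d → ℝ) (a : Ω) (t : ℕ) :
    M.state K x a t = jumpState (M.Γ K) (fun s => M.ω s a) x t := by
  induction t with
  | zero => rfl
  | succ t ih => rw [state, ih, jumpState]

lemma memLp_state_x0 (t : ℕ) (α : Fin d) :
    MemLp (fun a => M.state K (M.x0 a) a t α) 2 M.Pr := by
  simpa only [state_eq_jumpState] using
    memLp_jumpState (M.Γ K) M.chain.measurable M.x0_memLp t α

lemma corr_eq_momentMatrix (t : ℕ) (i : Fin N) : M.corr K t i =
    momentMatrix (M.Pr.restrict {a | M.ω t a = i}) fun a => M.state K (M.x0 a) a t := by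
  ext α β
  exact integral_indicator (M.chain.measurable t (measurableSet_singleton i))

lemma corr_eq_lyapAdjoint_pow (t : ℕ) :
    M.corr K t = (lyapAdjoint M.p (M.Γ K) ^ t) M.X0 := by
  have h := momentMatrix_jumpState (M.Γ K) M.chain M.x0_measurable M.x0_indep M.x0_memLp t
  simp only [← state_eq_jumpState, ← corr_eq_momentMatrix] at h
  exact h

lemma momentMatrix_cond_state (x : Fin d → ℝ) (i : Fin N) (t : ℕ) :
    momentMatrix (cond M.Pr {a | M.ω 0 a = i}) (fun a => M.state K x a t) =
      ∑ j, (lyapAdjoint M.p (M.Γ K) ^ t) (Pi.single i (vecMulVec x x)) j := by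
  have := M.isProbabilityMeasure
  have hi : M.Pr {a | M.ω 0 a = i} ≠ 0 := fun h =>
    (M.π_pos i).ne (by rw [← M.chain.initial i, measureReal_def, h, ENNReal.toReal_zero])
  have := cond_isProbabilityMeasure hi
  have hchain := M.chain.cond_initial i hi
  have hmem (α : Fin d) : MemLp (fun _ : Ω => x α) 2 (cond M.Pr {a | M.ω 0 a = i}) :=
    memLp_const _
  have hsingle : (fun j => (Pi.single i 1 : Fin N → ℝ) j • vecMulVec x x) =
      Pi.single i (vecMulVec x x) := by
    ext1 j
    obtain rfl | hj := eq_or_ne j i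
    · rw [Pi.single_eq_same, Pi.single_eq_same, one_smul]
    · rw [Pi.single_eq_of_ne hj, Pi.single_eq_of_ne hj, zero_smul]
  simp only [state_eq_jumpState]
  rw [← sum_momentMatrix_restrict_fiber (hchain.measurable t)
    (memLp_jumpState (M.Γ K) hchain.measurable hmem t), ← hsingle, ← momentMatrix_const
    (μ := cond M.Pr {a | M.ω 0 a = i}) x, ← momentMatrix_jumpState (M.Γ K) hchain
    measurable_const (indepFun_const_left x _) hmem t]

lemma isMSS_iff_isStable : M.IsMSS K ↔ IsStable M.p (M.Γ K) := by
  have hmoment (x : Fin d → ℝ) (i : Fin N) (α β : Fin d) (t : ℕ) :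
      ∫ a, M.state K x a t α * M.state K x a t β ∂(cond M.Pr {a | M.ω 0 a = i}) =
        (∑ j, (lyapAdjoint M.p (M.Γ K) ^ t) (Pi.single i (vecMulVec x x)) j) α β := by
    rw [← momentMatrix_cond_state, momentMatrix, of_apply]
  simp only [IsMSS, hmoment]
  refine ⟨fun h => isStable_of_tendsto_vecMulVec M.p_nonneg fun i x =>
    tendsto_pi_nhds.2 fun α => tendsto_pi_nhds.2 fun β => h x i α β, fun h x i α β => ?_⟩
  have hlim := tendsto_finsetSum Finset.univ fun j _ =>
    tendsto_pi_nhds.1 (h (Pi.single i (vecMulVec x x))) j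
  simp only [Pi.zero_apply, Finset.sum_const_zero] at hlim
  exact tendsto_pi_nhds.1 (tendsto_pi_nhds.1 hlim α) β

variable {M K} in
lemma IsMSS.isStable (hK : M.IsMSS K) : IsStable M.p (M.Γ K) := (M.isMSS_iff_isStable K).1 hK

end Correlation

section StageCost

/-- The matrix `Q_i + K_iᵀ R_i K_i` of the stage cost in mode `i`. -/
def stageMat (i : Fin N) : Matrix (Fin d) (Fin d) ℝ := M.Q i + (K.mat i)ᵀ * M.R i * K.mat i

lemma dotProduct_stageMat_mulVec (i : Fin N) (v : Fin d → ℝ) : v ⬝ᵥ M.stageMat K i *ᵥ v =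
    v ⬝ᵥ M.Q i *ᵥ v + (K.mat i *ᵥ v) ⬝ᵥ M.R i *ᵥ (K.mat i *ᵥ v) := by
  rw [stageMat, add_mulVec, dotProduct_add, dotProduct_transpose_mul_mul_mulVec]

lemma stageMat_transpose (i : Fin N) : (M.stageMat K i)ᵀ = M.stageMat K i := by
  simp only [stageMat, transpose_add, transpose_mul, transpose_transpose, Matrix.mul_assoc,
    transpose_eq_of_posSemidef (M.Q_posDef i).posSemidef,
    transpose_eq_of_posSemidef (M.R_posDef i).posSemidef]

lemma Q_le_stageMat (i : Fin N) (v : Fin d → ℝ) :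
    v ⬝ᵥ M.Q i *ᵥ v ≤ v ⬝ᵥ M.stageMat K i *ᵥ v := by
  rw [dotProduct_stageMat_mulVec]
  exact le_add_of_nonneg_right (quadForm_nonneg (M.R_posDef i).posSemidef _)

lemma stageMat_nonneg (i : Fin N) (v : Fin d → ℝ) : 0 ≤ v ⬝ᵥ M.stageMat K i *ᵥ v :=
  (quadForm_nonneg (M.Q_posDef i).posSemidef v).trans (M.Q_le_stageMat K i v)

lemma stageCost_eq (x : Fin d → ℝ) (a : Ω) (t : ℕ) : M.stageCost K x a t =
    M.state K x a t ⬝ᵥ M.stageMat K (M.ω t a) *ᵥ M.state K x a t := by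
  rw [dotProduct_stageMat_mulVec, stageCost, control, mulVec_neg, neg_dotProduct_neg]

lemma stageCost_nonneg (x : Fin d → ℝ) (a : Ω) (t : ℕ) : 0 ≤ M.stageCost K x a t := by
  rw [stageCost_eq]
  exact M.stageMat_nonneg K _ _

lemma integrable_stageCost (t : ℕ) :
    Integrable (fun a => M.stageCost K (M.x0 a) a t) M.Pr := by
  have hsplit : (fun a => M.stageCost K (M.x0 a) a t) = fun a => ∑ i, {a | M.ω t a = i}.indicator
      (fun a => M.state K (M.x0 a) a t ⬝ᵥ M.stageMat K i *ᵥ M.state K (M.x0 a) a t) a := by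
    ext a
    simp [stageCost_eq, Set.indicator_apply]
  rw [hsplit]
  exact integrable_finsetSum _ fun i _ =>
    (integrable_dotProduct_mulVec (M.memLp_state_x0 K t) _).indicator
      (M.chain.measurable t (measurableSet_singleton i))

lemma integral_stageCost (t : ℕ) :
    ∫ a, M.stageCost K (M.x0 a) a t ∂M.Pr = tracePairing (M.stageMat K) (M.corr K t) := by
  rw [← sum_setIntegral_fiber (M.chain.measurable t) (M.integrable_stageCost K t)]
  refine Finset.sum_congr rfl fun i _ => ?_
  rw [corr_eq_momentMatrix, ← integral_dotProduct_mulVec fun α =>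
    (M.memLp_state_x0 K t α).restrict _]
  refine setIntegral_congr_fun (M.chain.measurable t (measurableSet_singleton i)) fun a ha => ?_
  simp only [stageCost_eq, show M.ω t a = i from ha]

lemma extCost_eq_tsum :
    M.extCost K = ∑' t, ENNReal.ofReal (tracePairing (M.stageMat K) (M.corr K t)) := by
  have hmeas (t : ℕ) : AEMeasurable (fun a => M.stageCost K (M.x0 a) a t) M.Pr :=
    (M.integrable_stageCost K t).aestronglyMeasurable.aemeasurable
  rw [extCost, lintegral_tsum fun t => (hmeas t).ennreal_ofReal]
  refine tsum_congr fun t => ?_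
  rw [← integral_stageCost, ofReal_integral_eq_lintegral_ofReal (M.integrable_stageCost K t)
    (.of_forall fun a => M.stageCost_nonneg K _ a t)]

end StageCost

section Positivity

lemma neZero_modes (M : MJLS N d k Ω) : NeZero N :=
  ⟨by rintro rfl; simpa using M.π_sum⟩

lemma lamMin_Q_pos [NeZero d] : 0 < lamMin M.Q :=
  have := M.neZero_modes
  lamMin_pos M.Q_posDef

lemma lamMin_R_pos [NeZero k] : 0 < lamMin M.R :=
  have := M.neZero_modes
  lamMin_pos M.R_posDef

lemma cov0_posDef : M.cov0.PosDef := M.x0_cov_posDef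

lemma mu_pos [NeZero d] : 0 < M.mu := by
  have := M.neZero_modes
  obtain ⟨i, hi⟩ := exists_eq_ciInf_of_finite (f := M.π)
  rw [mu, ← hi]
  exact mul_pos (M.π_pos i) (sigmaMin_pos M.cov0_posDef)

lemma X0_posSemidef (i : Fin N) : (M.X0 i).PosSemidef :=
  M.cov0_posDef.posSemidef.smul (M.π_pos i).le

lemma mu_mul_le_X0 (i : Fin N) (v : Fin d → ℝ) : M.mu * (v ⬝ᵥ v) ≤ v ⬝ᵥ M.X0 i *ᵥ v := by
  have hπ : ⨅ i, M.π i ≤ M.π i := ciInf_le (Set.finite_range _).bddBelow i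
  have hσ := sigmaMin_mul_le_quadForm M.cov0_posDef.posSemidef v
  rw [X0, smul_mulVec, dotProduct_smul, smul_eq_mul, mu, mul_assoc]
  exact mul_le_mul hπ hσ (mul_nonneg (sigmaMin_nonneg _) (dotProduct_self_nonneg v))
    (M.π_pos i).le

lemma corr_posSemidef (t : ℕ) (i : Fin N) : (M.corr K t i).PosSemidef := by
  rw [corr_eq_lyapAdjoint_pow]
  exact lyapAdjoint_pow_posSemidef M.p_nonneg M.X0_posSemidef t i

variable {M} in
lemma opE_posSemidef {P : Fin N → Matrix (Fin d) (Fin d) ℝ} (hP : ∀ i, (P i).PosSemidef)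
    (i : Fin N) : (M.opE P i).PosSemidef :=
  posSemidef_sum _ fun j _ => (hP j).smul (M.p_nonneg i j)

lemma stage_nonneg (t : ℕ) : 0 ≤ tracePairing (M.stageMat K) (M.corr K t) :=
  tracePairing_nonneg (M.stageMat_nonneg K) (M.corr_posSemidef K t)

end Positivity

section Cost

variable {M K}

lemma isLyapunov_iff {P : Fin N → Matrix (Fin d) (Fin d) ℝ} :
    M.IsLyapunov K P ↔ P = M.stageMat K + lyapOp M.p (M.Γ K) P :=
  funext_iff.symm

namespace IsMSS

variable (hK : M.IsMSS K)
include hK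

lemma hasSum_corr_XK : HasSum (M.corr K) (M.XK K) := by
  obtain ⟨X, hX, -⟩ := hK.isStable.existsUnique_eq_add_lyapAdjoint M.X0
  have hsum : HasSum (M.corr K) X := by
    simpa only [← corr_eq_lyapAdjoint_pow] using
      hK.isStable.hasSum_lyapAdjoint_pow M.p_nonneg hX
  have hXK : M.XK K = X := by
    ext i α β
    exact (Pi.hasSum.1 (Pi.hasSum.1 (Pi.hasSum.1 hsum i) α) β).tsum_eq
  rwa [hXK]

lemma summable_corr (i : Fin N) (α β : Fin d) : Summable fun t => M.corr K t i α β :=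
  (Pi.hasSum.1 (Pi.hasSum.1 (Pi.hasSum.1 hK.hasSum_corr_XK i) α) β).summable

lemma XK_eq : M.XK K = M.X0 + lyapAdjoint M.p (M.Γ K) (M.XK K) := by
  obtain ⟨X, hX, -⟩ := hK.isStable.existsUnique_eq_add_lyapAdjoint M.X0
  have hsum := hK.isStable.hasSum_lyapAdjoint_pow M.p_nonneg hX
  simp only [← corr_eq_lyapAdjoint_pow] at hsum
  rwa [hK.hasSum_corr_XK.unique hsum]

lemma XK_posSemidef (i : Fin N) : (M.XK K i).PosSemidef :=
  hK.isStable.posSemidef M.p_nonneg hK.XK_eq M.X0_posSemidef i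

lemma mu_mul_le_XK (i : Fin N) (v : Fin d → ℝ) : M.mu * (v ⬝ᵥ v) ≤ v ⬝ᵥ M.XK K i *ᵥ v :=
  (M.mu_mul_le_X0 i v).trans
    (hK.isStable.le_of_eq_add_lyapAdjoint M.p_nonneg hK.XK_eq M.X0_posSemidef i v)

lemma existsUnique_isLyapunov : ∃! P, M.IsLyapunov K P := by
  simpa only [isLyapunov_iff] using hK.isStable.existsUnique_eq_add_lyapOp (M.stageMat K)

lemma PK_eq : M.PK K = M.stageMat K + lyapOp M.p (M.Γ K) (M.PK K) :=
  isLyapunov_iff.1 (Classical.epsilon_spec hK.existsUnique_isLyapunov.exists)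

lemma PK_posSemidef (i : Fin N) : (M.PK K i).PosSemidef :=
  posSemidef_of_quadForm_nonneg
    (hK.isStable.transpose_eq_self hK.PK_eq (M.stageMat_transpose K) i) fun v =>
      (M.stageMat_nonneg K i v).trans
        (hK.isStable.le_of_eq_add_lyapOp M.p_nonneg hK.PK_eq (M.stageMat_nonneg K) i v)

lemma hasSum_stage : HasSum (fun t => tracePairing (M.stageMat K) (M.corr K t))
    (tracePairing (M.stageMat K) (M.XK K)) :=
  hK.hasSum_corr_XK.map (tracePairing (M.stageMat K)) (continuous_tracePairing _)

lemma extCost_eq_ofReal :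
    M.extCost K = ENNReal.ofReal (tracePairing (M.stageMat K) (M.XK K)) := by
  rw [extCost_eq_tsum, ← hK.hasSum_stage.tsum_eq,
    ENNReal.ofReal_tsum_of_nonneg (M.stage_nonneg K) hK.hasSum_stage.summable]

lemma extCost_ne_top : M.extCost K ≠ ⊤ := by
  rw [hK.extCost_eq_ofReal]
  exact ENNReal.ofReal_ne_top

lemma cost_eq_tracePairing_XK : M.cost K = tracePairing (M.stageMat K) (M.XK K) := by
  rw [cost, hK.extCost_eq_ofReal,
    ENNReal.toReal_ofReal (tracePairing_nonneg (M.stageMat_nonneg K) hK.XK_posSemidef)]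

lemma cost_eq_tracePairing_PK : M.cost K = tracePairing (M.PK K) M.X0 := by
  rw [hK.cost_eq_tracePairing_XK, tracePairing_eq_of_eq_add hK.PK_eq hK.XK_eq]

lemma cost_eq_integral :
    M.cost K = ∫ a, M.x0 a ⬝ᵥ ((∑ i, M.π i • M.PK K i) *ᵥ M.x0 a) ∂M.Pr := by
  rw [integral_dotProduct_mulVec M.x0_memLp, hK.cost_eq_tracePairing_PK, tracePairing_apply,
    Finset.sum_mul, trace_sum]
  refine Finset.sum_congr rfl fun i _ => ?_
  rw [X0, mul_smul_comm, smul_mul_assoc]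
  rfl

end IsMSS

lemma isMSS_of_extCost_ne_top [NeZero d] (h : M.extCost K ≠ ⊤) : M.IsMSS K := by
  have hlim : Tendsto (fun t => tracePairing (M.stageMat K) (M.corr K t)) atTop (𝓝 0) := by
    rw [extCost_eq_tsum] at h
    simpa only [Function.comp_def, ENNReal.toReal_ofReal (M.stage_nonneg K _),
      ENNReal.toReal_zero] using
      (ENNReal.tendsto_toReal ENNReal.zero_ne_top).comp
        (ENNReal.tendsto_atTop_zero_of_tsum_ne_top h)
  refine (M.isMSS_iff_isStable K).2 <|
    isStable_of_tendsto_trace M.p_nonneg M.mu_pos M.mu_mul_le_X0 M.X0_posSemidef ?_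
  simp only [← corr_eq_lyapAdjoint_pow]
  refine squeeze_zero (fun t => ?_) (fun t => ?_)
    (by simpa only [mul_zero] using hlim.const_mul (lamMin M.Q)⁻¹)
  · exact tracePairing_nonneg (fun _ => quadForm_nonneg .one) (M.corr_posSemidef K t)
  · rw [← div_eq_inv_mul, le_div_iff₀ M.lamMin_Q_pos, mul_comm]
    exact mul_tracePairing_one_le (fun i v => (lamMin_mul_le_quadForm
      (fun i => (M.Q_posDef i).posSemidef) i v).trans (M.Q_le_stageMat K i v))
      (M.corr_posSemidef K t)

end Cost

end StabilityAndCost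

/-! ### Coercivity -/

section SublevelSets

section ContinuityInSystem

variable {ι n : Type*} [Fintype ι] [Fintype n] (p : Matrix ι ι ℝ)

lemma continuous_lyapOp (P : ι → Matrix n n ℝ) :
    Continuous fun G : ι → Matrix n n ℝ => lyapOp p G P :=
  continuous_pi fun i => ((continuous_apply i).matrix_transpose.matrix_mul
    continuous_const).matrix_mul (continuous_apply i)

lemma continuous_lyapAdjoint_pow (S : ι → Matrix n n ℝ) (t : ℕ) :
    Continuous fun G : ι → Matrix n n ℝ => (lyapAdjoint p G ^ t) S := by
  induction t with
  | zero => exact continuous_const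
  | succ t ih =>
    simp_rw [pow_succ', Module.End.mul_apply]
    refine continuous_pi fun j => continuous_finsetSum _ fun i _ => Continuous.fun_const_smul ?_ _
    exact ((continuous_apply i).matrix_mul ((continuous_apply i).comp ih)).matrix_mul
      (continuous_apply i).matrix_transpose

variable {p}

/-- The solution `P` of `P = 1 + lyapOp p G P` is a Lyapunov function for all `G'` near `G`. -/
lemma isOpen_isStable (hp : ∀ i j, 0 ≤ p i j) :
    IsOpen {G : ι → Matrix n n ℝ | IsStable p G} := by
  classical
  refine isOpen_iff_mem_nhds.2 fun G (hG : IsStable p G) => ?_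
  obtain ⟨P, hP, -⟩ := hG.existsUnique_eq_add_lyapOp 1
  have hone (i : ι) (v : n → ℝ) : v ⬝ᵥ (1 : ι → Matrix n n ℝ) i *ᵥ v = v ⬝ᵥ v := by
    rw [Pi.one_apply, one_mulVec]
  have hPnonneg (i : ι) (v : n → ℝ) : 0 ≤ v ⬝ᵥ P i *ᵥ v :=
    (dotProduct_self_nonneg v).trans <| (hone i v).ge.trans <| hG.le_of_eq_add_lyapOp hp hP
      (fun i v => (hone i v).ge.trans' (dotProduct_self_nonneg v)) i v
  have hnear (i : ι) : ∀ᶠ G' in 𝓝 G,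
      ∑ α, ∑ β, |(lyapOp p G' P i - lyapOp p G P i) α β| < 1 / 2 := by
    have hcont : Continuous fun G' =>
        ∑ α, ∑ β, |(lyapOp p G' P i - lyapOp p G P i) α β| :=
      continuous_finsetSum _ fun α _ => continuous_finsetSum _ fun β _ =>
        ((((continuous_apply i).comp (continuous_lyapOp p P)).sub
          continuous_const).matrix_elem α β).abs
    refine hcont.continuousAt.eventually_lt continuousAt_const ?_
    simp only [sub_self, Matrix.zero_apply, abs_zero, Finset.sum_const_zero]
    norm_num
  filter_upwards [eventually_all.2 hnear] with G' hG'
  refine isStable_of_lyapunov hp hPnonneg one_half_pos fun i v => ?_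
  have hsplit : (P - lyapOp p G' P) i = 1 - (lyapOp p G' P i - lyapOp p G P i) := by
    rw [Pi.sub_apply, sub_sub_eq_add_sub]
    exact congrArg (· - lyapOp p G' P i) (congrFun hP i)
  have hpert := (le_abs_self _).trans
    (abs_dotProduct_mulVec_le_sum_abs (lyapOp p G' P i - lyapOp p G P i) v v)
  have hsmall := mul_le_mul_of_nonneg_right (hG' i).le (dotProduct_self_nonneg v)
  rw [hsplit, sub_mulVec, one_mulVec, dotProduct_sub]
  linarith

end ContinuityInSystem

variable {N d k : ℕ} {Ω : Type*} [MeasurableSpace Ω] (M : MJLS N d k Ω)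

section Continuity

lemma continuous_mat : Continuous (Policy.mat : Policy N k d → _) :=
  continuous_pi fun i => continuous_matrix fun a b => by
    simp only [Policy.mat, of_apply]
    fun_prop

lemma continuous_Γ : Continuous M.Γ :=
  continuous_pi fun i => continuous_const.sub
    (continuous_const.matrix_mul ((continuous_apply i).comp continuous_mat))

lemma continuous_stageMat : Continuous M.stageMat :=
  continuous_pi fun i =>
    have hmat : Continuous fun K : Policy N k d => K.mat i :=
      (continuous_apply i).comp continuous_mat
    continuous_const.add ((hmat.matrix_transpose.matrix_mul continuous_const).matrix_mul hmat)

lemma continuous_corr (t : ℕ) : Continuous fun K => M.corr K t := by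
  simp only [corr_eq_lyapAdjoint_pow]
  exact (continuous_lyapAdjoint_pow M.p M.X0 t).comp M.continuous_Γ

lemma continuous_stage (t : ℕ) :
    Continuous fun K => tracePairing (M.stageMat K) (M.corr K t) := by
  simp only [tracePairing_apply]
  exact continuous_finsetSum _ fun i _ =>
    (((continuous_apply i).comp M.continuous_stageMat).matrix_mul
      ((continuous_apply i).comp (M.continuous_corr t))).matrix_trace

lemma isOpen_stabSet : IsOpen M.stabSet := by
  have hpre : M.stabSet = M.Γ ⁻¹' {G | IsStable M.p G} := Set.ext M.isMSS_iff_isStable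
  rw [hpre]
  exact (isOpen_isStable M.p_nonneg).preimage M.continuous_Γ

end Continuity

section Coercivity

variable {M}

lemma mem_sublevel_iff [NeZero d] {K : Policy N k d} {α : ℝ} : K ∈ M.sublevel α ↔
    ∀ n, ∑ t ∈ Finset.range n, tracePairing (M.stageMat K) (M.corr K t) ≤ α := by
  refine ⟨fun hK n => ?_, fun h => ?_⟩
  · have hsum := IsMSS.hasSum_stage hK.1
    rw [← IsMSS.cost_eq_tracePairing_XK hK.1] at hsum
    exact (sum_le_hasSum _ (fun t _ => M.stage_nonneg K t) hsum).trans hK.2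
  · have hsummable := summable_of_sum_range_le (M.stage_nonneg K) h
    have hstab : M.IsMSS K := isMSS_of_extCost_ne_top <| by
      rw [extCost_eq_tsum, ← ENNReal.ofReal_tsum_of_nonneg (M.stage_nonneg K) hsummable]
      exact ENNReal.ofReal_ne_top
    refine ⟨hstab, ?_⟩
    rw [hstab.cost_eq_tracePairing_XK, ← hstab.hasSum_stage.tsum_eq]
    exact hsummable.tsum_le_of_sum_range_le h

variable (M)

/-- The partial sums of the cost are continuous on the whole policy space, so the sublevel sets are
closed in it and not only in `𝕂`. -/
lemma isClosed_sublevel [NeZero d] (α : ℝ) : IsClosed (M.sublevel α) := by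
  have hinter : M.sublevel α = ⋂ n, {K | ∑ t ∈ Finset.range n,
      tracePairing (M.stageMat K) (M.corr K t) ≤ α} := by
    ext K
    simp only [mem_sublevel_iff, Set.mem_iInter, Set.mem_ofPred_eq]
  rw [hinter]
  exact isClosed_iInter fun n => isClosed_le
    (continuous_finsetSum _ fun t _ => M.continuous_stage t) continuous_const

lemma inner_eq_tupleInner (K E : Policy N k d) : inner ℝ K E = tupleInner K.mat E.mat := by
  rw [PiLp.inner_apply, Fintype.sum_prod_type]
  refine Finset.sum_congr rfl fun i _ => ?_
  rw [Fintype.sum_prod_type, Finset.sum_comm]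
  simp [trace, mul_apply, Policy.mat, mul_comm]

lemma norm_sq_eq_tupleInner (K : Policy N k d) : ‖K‖ ^ 2 = tupleInner K.mat K.mat := by
  rw [← real_inner_self_eq_norm_sq, inner_eq_tupleInner]

lemma mul_norm_sq_le_tracePairing_one {E : Policy N k d} {H : Fin N → Matrix (Fin d) (Fin d) ℝ}
    {c : ℝ} (h : ∀ i v, c * (E.mat i *ᵥ v ⬝ᵥ E.mat i *ᵥ v) ≤ v ⬝ᵥ H i *ᵥ v) :
    c * ‖E‖ ^ 2 ≤ tracePairing 1 H := by
  have hpairing : tracePairing (fun i => c •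
      ((E.mat i)ᵀ * (1 : Matrix (Fin k) (Fin k) ℝ) * E.mat i)) 1 ≤ tracePairing H 1 := by
    refine tracePairing_le_tracePairing (fun i v => ?_) fun _ => .one
    rw [smul_mulVec, dotProduct_smul, smul_eq_mul, dotProduct_transpose_mul_mul_mulVec, one_mulVec]
    exact h i v
  rw [norm_sq_eq_tupleInner, tracePairing_comm, tupleInner, Finset.mul_sum]
  simpa only [tracePairing_apply, Pi.one_apply, Matrix.mul_one, trace_smul, smul_eq_mul]
    using hpairing

variable {M}

lemma IsMSS.mul_norm_sq_le_tracePairing_XK [NeZero d] {K E : Policy N k d} (hK : M.IsMSS K)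
    {H : Fin N → Matrix (Fin d) (Fin d) ℝ} (hH : ∀ i, (H i).PosSemidef) {c : ℝ}
    (h : ∀ i v, c * (E.mat i *ᵥ v ⬝ᵥ E.mat i *ᵥ v) ≤ v ⬝ᵥ H i *ᵥ v) :
    M.mu * c * ‖E‖ ^ 2 ≤ tracePairing H (M.XK K) := by
  rw [mul_assoc, tracePairing_comm]
  exact (mul_le_mul_of_nonneg_left (mul_norm_sq_le_tracePairing_one h) M.mu_pos.le).trans
    (mul_tracePairing_one_le hK.mu_mul_le_XK hH)

lemma IsMSS.mul_norm_sq_le_cost [NeZero d] {K : Policy N k d} (hK : M.IsMSS K) :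
    M.mu * lamMin M.R * ‖K‖ ^ 2 ≤ M.cost K := by
  rw [hK.cost_eq_tracePairing_XK]
  refine hK.mul_norm_sq_le_tracePairing_XK (fun i => posSemidef_of_quadForm_nonneg
    (M.stageMat_transpose K i) (M.stageMat_nonneg K i)) fun i v => ?_
  rw [dotProduct_stageMat_mulVec]
  exact (lamMin_mul_le_quadForm (fun i => (M.R_posDef i).posSemidef) i _).trans
    (le_add_of_nonneg_left (quadForm_nonneg (M.Q_posDef i).posSemidef v))

variable (M)

lemma isCompact_sublevel [NeZero d] [NeZero k] (α : ℝ) : IsCompact (M.sublevel α) := by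
  refine Metric.isCompact_of_isClosed_isBounded (M.isClosed_sublevel α) ?_
  have hc : 0 < M.mu * lamMin M.R := mul_pos M.mu_pos M.lamMin_R_pos
  refine isBounded_iff_forall_norm_le.2 ⟨√(α / (M.mu * lamMin M.R)), fun K hK => ?_⟩
  refine Real.le_sqrt_of_sq_le ?_
  rw [le_div_iff₀ hc, mul_comm]
  exact (IsMSS.mul_norm_sq_le_cost hK.1).trans hK.2

lemma tendsto_cost_of_tendsto_norm [NeZero d] [NeZero k] {Kseq : ℕ → Policy N k d}
    (hK : ∀ l, Kseq l ∈ M.stabSet) (h : Tendsto (fun l => ‖Kseq l‖) atTop atTop) :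
    Tendsto (fun l => M.cost (Kseq l)) atTop atTop := by
  have hc : 0 < M.mu * lamMin M.R := mul_pos M.mu_pos M.lamMin_R_pos
  refine tendsto_atTop_mono (fun l => IsMSS.mul_norm_sq_le_cost (hK l)) ?_
  exact ((tendsto_pow_atTop two_ne_zero).comp h).const_mul_atTop hc

lemma tendsto_cost_of_tendsto_frontier [NeZero d] {Kseq : ℕ → Policy N k d}
    (hK : ∀ l, Kseq l ∈ M.stabSet) {K : Policy N k d} (hfr : K ∈ frontier M.stabSet)
    (h : Tendsto Kseq atTop (𝓝 K)) : Tendsto (fun l => M.cost (Kseq l)) atTop atTop := by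
  rw [M.isOpen_stabSet.frontier_eq] at hfr
  refine tendsto_atTop.2 fun b => ?_
  by_contra hb
  have hfreq : ∃ᶠ l in atTop, Kseq l ∈ M.sublevel b :=
    (not_eventually.1 hb).mono fun l hl => ⟨hK l, (not_le.1 hl).le⟩
  exact hfr.2 ((M.isClosed_sublevel b).mem_of_frequently_of_tendsto hfreq h).1

end Coercivity

end SublevelSets

/-! ### Cost differences -/

section CostDifferences

section CompletingTheSquare

variable {m n : Type*} [Fintype m] [Fintype n]

lemma dotProduct_transpose_mul_mulVec (E F : Matrix m n ℝ) (v w : n → ℝ) :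
    v ⬝ᵥ (Eᵀ * F) *ᵥ w = (E *ᵥ v) ⬝ᵥ (F *ᵥ w) := by
  rw [← mulVec_mulVec, dotProduct_mulVec, vecMul_transpose]

lemma sq_mul_dotProduct_self_le {S : Matrix n n ℝ} {c : ℝ} (hc : 0 ≤ c) {v : n → ℝ}
    (h : c * (v ⬝ᵥ v) ≤ v ⬝ᵥ S *ᵥ v) : c ^ 2 * (v ⬝ᵥ v) ≤ (S *ᵥ v) ⬝ᵥ (S *ᵥ v) := by
  have hsq := dotProduct_self_nonneg (S *ᵥ v - c • v)
  simp only [sub_dotProduct, dotProduct_sub, smul_dotProduct, dotProduct_smul, smul_eq_mul,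
    dotProduct_comm (S *ᵥ v) v] at hsq
  nlinarith

variable [DecidableEq n] {H : Matrix n n ℝ}

lemma mulVec_inv_mulVec (hH : H.PosDef) (l : n → ℝ) : H *ᵥ (H⁻¹ *ᵥ l) = l := by
  rw [mulVec_mulVec, mul_nonsing_inv _ ((isUnit_iff_isUnit_det H).1 hH.isUnit), one_mulVec]

lemma two_mul_dotProduct_sub_quadForm_le (hH : H.PosDef) (u l : n → ℝ) :
    2 * (u ⬝ᵥ l) - u ⬝ᵥ H *ᵥ u ≤ l ⬝ᵥ H⁻¹ *ᵥ l := by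
  have hsq := quadForm_nonneg hH.posSemidef (u - H⁻¹ *ᵥ l)
  rw [mulVec_sub, dotProduct_sub, sub_dotProduct, sub_dotProduct,
    dotProduct_mulVec_symm (transpose_eq_of_posSemidef hH.posSemidef) u (H⁻¹ *ᵥ l),
    mulVec_inv_mulVec hH, dotProduct_comm (H⁻¹ *ᵥ l) l] at hsq
  linarith

lemma mul_inv_quadForm_le (hH : H.PosDef) {c : ℝ} (hc : 0 ≤ c)
    (h : ∀ w, c * (w ⬝ᵥ w) ≤ w ⬝ᵥ H *ᵥ w) (l : n → ℝ) : c * (l ⬝ᵥ H⁻¹ *ᵥ l) ≤ l ⬝ᵥ l := by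
  have hw := h (H⁻¹ *ᵥ l)
  have hsq := dotProduct_self_nonneg (l - c • H⁻¹ *ᵥ l)
  rw [mulVec_inv_mulVec hH] at hw
  simp only [sub_dotProduct, dotProduct_sub, smul_dotProduct, dotProduct_smul, smul_eq_mul,
    dotProduct_comm (H⁻¹ *ᵥ l) l] at hw hsq
  nlinarith

end CompletingTheSquare

section TupleInner

lemma tracePairing_transpose {ι n : Type*} [Fintype ι] [Fintype n] (P : ι → Matrix n n ℝ)
    {S : ι → Matrix n n ℝ} (hS : ∀ i, (S i)ᵀ = S i) :
    tracePairing (fun i => (P i)ᵀ) S = tracePairing P S :=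
  Finset.sum_congr rfl fun i _ => by
    rw [← trace_transpose, transpose_mul, transpose_transpose, hS, trace_mul_comm]

variable {N m n : ℕ}

lemma tupleInner_eq_tracePairing (H : Fin N → Matrix (Fin n) (Fin n) ℝ)
    {S : Fin N → Matrix (Fin n) (Fin n) ℝ} (hS : ∀ i, (S i)ᵀ = S i) :
    tupleInner H S = tracePairing H S :=
  tracePairing_transpose H hS

lemma tracePairing_le_normMax_mul {H S : Fin N → Matrix (Fin n) (Fin n) ℝ}
    (hH : ∀ i, (H i).PosSemidef) : tracePairing H S ≤ normMax S * tracePairing H 1 := by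
  rw [tracePairing_comm, tracePairing_comm H 1]
  exact tracePairing_le_mul_one (dotProduct_mulVec_le_normMax S) hH

variable (V : Fin N → Matrix (Fin m) (Fin n) ℝ)

lemma tupleInner_self_eq : tupleInner V V = tracePairing 1 fun i => (V i)ᵀ * V i := by
  simp only [tupleInner, tracePairing_apply, Pi.one_apply, Matrix.one_mul]

lemma tupleInner_inv_mul_self {H : Fin N → Matrix (Fin m) (Fin m) ℝ} (hH : ∀ i, (H i)ᵀ = H i) :
    tupleInner (fun i => (H i)⁻¹ * V i) V =
      tracePairing (fun i => (V i)ᵀ * (H i)⁻¹ * V i) 1 := by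
  simp only [tupleInner, tracePairing_apply, Pi.one_apply, Matrix.mul_one, transpose_mul,
    transpose_nonsing_inv, hH]

lemma mul_tupleInner_inv_mul_le {H : Fin N → Matrix (Fin m) (Fin m) ℝ} (hH : ∀ i, (H i).PosDef)
    {c : ℝ} (hc : 0 ≤ c) (h : ∀ i w, c * (w ⬝ᵥ w) ≤ w ⬝ᵥ H i *ᵥ w) :
    c * tupleInner (fun i => (H i)⁻¹ * V i) V ≤ tupleInner V V := by
  rw [tupleInner_inv_mul_self V fun i => transpose_eq_of_posSemidef (hH i).posSemidef,
    tupleInner_self_eq, tracePairing_comm 1, ← smul_eq_mul, ← LinearMap.smul_apply, ← map_smul]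
  refine tracePairing_le_tracePairing (fun i v => ?_) fun _ => .one
  rw [Pi.smul_apply, smul_mulVec, dotProduct_smul, smul_eq_mul,
    dotProduct_transpose_mul_mul_mulVec, dotProduct_transpose_mul_mulVec]
  exact mul_inv_quadForm_le (hH i) hc (h i) _

lemma sq_mul_tupleInner_le {S : Fin N → Matrix (Fin n) (Fin n) ℝ} (hS : ∀ i, (S i)ᵀ = S i)
    {c : ℝ} (hc : 0 ≤ c) (h : ∀ i v, c * (v ⬝ᵥ v) ≤ v ⬝ᵥ S i *ᵥ v) :
    c ^ 2 * tupleInner V V ≤ tupleInner (fun i => V i * S i) fun i => V i * S i := by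
  have hVS : tupleInner (fun i => V i * S i) (fun i => V i * S i) =
      tracePairing (fun i => (S i)ᵀ * S i) fun i => (V i)ᵀ * V i := by
    refine Finset.sum_congr rfl fun i _ => ?_
    rw [transpose_mul, ← Matrix.mul_assoc, trace_mul_comm]
    simp only [hS, Matrix.mul_assoc]
  rw [tupleInner_self_eq, hVS]
  refine mul_tracePairing_one_le (fun i v => ?_) fun i => ?_
  · rw [dotProduct_transpose_mul_mulVec]
    exact sq_mul_dotProduct_self_le hc (h i v)
  · simpa only [conjTranspose_eq_transpose_of_trivial] using posSemidef_conjTranspose_mul_self (V i)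

end TupleInner

variable {N d k : ℕ} {Ω : Type*} [MeasurableSpace Ω] {M : MJLS N d k Ω} {K K' : Policy N k d}

section CostDifference

lemma mat_sub (K K' : Policy N k d) (i : Fin N) : (K - K').mat i = K.mat i - K'.mat i := rfl

lemma riccati_sub {m n : Type*} [Fintype m] [Fintype n] {A E : Matrix n n ℝ} {B : Matrix n m ℝ}
    {R : Matrix m m ℝ} (hE : Eᵀ = E) (hR : Rᵀ = R) (F D : Matrix m n ℝ) :
    (F - D)ᵀ * R * (F - D) + (A - B * (F - D))ᵀ * E * (A - B * (F - D)) =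
      Fᵀ * R * F + (A - B * F)ᵀ * E * (A - B * F) -
        (Dᵀ * ((R + Bᵀ * E * B) * F - Bᵀ * E * A) +
          (Dᵀ * ((R + Bᵀ * E * B) * F - Bᵀ * E * A))ᵀ) + Dᵀ * (R + Bᵀ * E * B) * D := by
  simp only [transpose_sub, transpose_mul, transpose_add, transpose_transpose, Matrix.mul_sub,
    Matrix.sub_mul, Matrix.mul_add, Matrix.add_mul, Matrix.mul_assoc, hE, hR]
  abel

namespace IsMSS

lemma XK_transpose (hK : M.IsMSS K) (i : Fin N) : (M.XK K i)ᵀ = M.XK K i :=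
  transpose_eq_of_posSemidef (hK.XK_posSemidef i)

lemma opE_PK_posSemidef (hK : M.IsMSS K) (i : Fin N) : (M.opE (M.PK K) i).PosSemidef :=
  opE_posSemidef hK.PK_posSemidef i

lemma stageMat_add_lyapOp_sub_PK (hK : M.IsMSS K) (K' : Policy N k d) (i : Fin N) :
    (M.stageMat K' + lyapOp M.p (M.Γ K') (M.PK K) - M.PK K) i =
      ((K - K').mat i)ᵀ * M.Psi K i * (K - K').mat i -
        (((K - K').mat i)ᵀ * M.LK K i + (((K - K').mat i)ᵀ * M.LK K i)ᵀ) := by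
  have hK' : K'.mat i = K.mat i - (K - K').mat i := by rw [mat_sub, sub_sub_cancel]
  have hPK : M.PK K i = M.Q i + (K.mat i)ᵀ * M.R i * K.mat i +
      (M.Γ K i)ᵀ * M.opE (M.PK K) i * M.Γ K i := congrFun hK.PK_eq i
  have hsub := riccati_sub (A := M.A i) (B := M.B i)
    (transpose_eq_of_posSemidef (hK.opE_PK_posSemidef i))
    (transpose_eq_of_posSemidef (M.R_posDef i).posSemidef) (K.mat i) ((K - K').mat i)
  change M.Q i + (K'.mat i)ᵀ * M.R i * K'.mat i + (M.Γ K' i)ᵀ * M.opE (M.PK K) i * M.Γ K' i -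
    M.PK K i = _
  rw [hPK, add_assoc, Γ, hK', hsub, LK, Psi, Γ]
  abel

lemma cost_sub_cost (hK : M.IsMSS K) (hK' : M.IsMSS K') : M.cost K' - M.cost K =
    -2 * tracePairing (fun i => ((K - K').mat i)ᵀ * M.LK K i) (M.XK K') +
      tracePairing (fun i => ((K - K').mat i)ᵀ * M.Psi K i * (K - K').mat i) (M.XK K') := by
  set D : Fin N → Matrix (Fin d) (Fin d) ℝ := fun i => ((K - K').mat i)ᵀ * M.LK K i
  have hresidual : M.stageMat K' + lyapOp M.p (M.Γ K') (M.PK K) - M.PK K =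
      (fun i => ((K - K').mat i)ᵀ * M.Psi K i * (K - K').mat i) - (D + fun i => (D i)ᵀ) :=
    funext (hK.stageMat_add_lyapOp_sub_PK K')
  rw [hK'.cost_eq_tracePairing_XK, hK.cost_eq_tracePairing_PK,
    ← tracePairing_add_lyapOp_sub _ _ hK'.XK_eq, hresidual, map_sub, map_add,
    LinearMap.sub_apply, LinearMap.add_apply, tracePairing_transpose D hK'.XK_transpose]
  ring

lemma cost_sub_cost_tupleInner (hK : M.IsMSS K) (hK' : M.IsMSS K') : M.cost K' - M.cost K =
    -2 * tupleInner (fun i => ((K - K').mat i)ᵀ * M.LK K i) (M.XK K') +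
      tupleInner (fun i => ((K - K').mat i)ᵀ * M.Psi K i * (K - K').mat i) (M.XK K') := by
  rw [tupleInner_eq_tracePairing _ hK'.XK_transpose, tupleInner_eq_tracePairing _ hK'.XK_transpose,
    hK.cost_sub_cost hK']

lemma cost_sub_cost_trace (hK : M.IsMSS K) (hK' : M.IsMSS K') : M.cost K' - M.cost K =
    ∑ i, (-2 * (M.XK K' i * ((K - K').mat i)ᵀ * M.LK K i).trace +
      (M.XK K' i * ((K - K').mat i)ᵀ * M.Psi K i * (K - K').mat i).trace) := by
  rw [hK.cost_sub_cost hK', Finset.sum_add_distrib, ← Finset.mul_sum, tracePairing_comm,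
    tracePairing_comm _ (M.XK K')]
  simp only [tracePairing_apply, Matrix.mul_assoc]

end IsMSS

end CostDifference

section GradientDominance

namespace IsMSS

variable (hK : M.IsMSS K)
include hK

lemma R_le_Psi (i : Fin N) (w : Fin k → ℝ) : w ⬝ᵥ M.R i *ᵥ w ≤ w ⬝ᵥ M.Psi K i *ᵥ w := by
  rw [Psi, add_mulVec, dotProduct_add, dotProduct_transpose_mul_mul_mulVec]
  exact le_add_of_nonneg_right (quadForm_nonneg (hK.opE_PK_posSemidef i) _)

lemma Psi_posDef (i : Fin N) : (M.Psi K i).PosDef :=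
  (M.R_posDef i).add_posSemidef <| by
    simpa only [conjTranspose_eq_transpose_of_trivial] using
      (hK.opE_PK_posSemidef i).conjTranspose_mul_mul_same (M.B i)

lemma Psi_transpose (i : Fin N) : (M.Psi K i)ᵀ = M.Psi K i :=
  transpose_eq_of_posSemidef (hK.Psi_posDef i).posSemidef

lemma lamMin_R_mul_le_Psi (i : Fin N) (w : Fin k → ℝ) :
    lamMin M.R * (w ⬝ᵥ w) ≤ w ⬝ᵥ M.Psi K i *ᵥ w :=
  (lamMin_mul_le_quadForm (fun i => (M.R_posDef i).posSemidef) i w).trans (hK.R_le_Psi i w)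

/-- Minimize the cost difference over `K - K'` in each direction separately. -/
lemma cost_sub_le (hK' : M.IsMSS K') : M.cost K - M.cost K' ≤
    normMax (M.XK K') * tupleInner (fun i => (M.Psi K i)⁻¹ * M.LK K i) (M.LK K) := by
  have hdiff := hK.cost_sub_cost hK'
  set D := K - K'
  have hsquare : tracePairing ((2 : ℝ) • (fun i => (D.mat i)ᵀ * M.LK K i) -
      fun i => (D.mat i)ᵀ * M.Psi K i * D.mat i) (M.XK K') ≤
      tracePairing (fun i => (M.LK K i)ᵀ * (M.Psi K i)⁻¹ * M.LK K i) (M.XK K') := by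
    refine tracePairing_le_tracePairing (fun i v => ?_) hK'.XK_posSemidef
    rw [Pi.sub_apply, Pi.smul_apply, sub_mulVec, dotProduct_sub, smul_mulVec, dotProduct_smul,
      smul_eq_mul, dotProduct_transpose_mul_mul_mulVec, dotProduct_transpose_mul_mul_mulVec,
      dotProduct_transpose_mul_mulVec]
    exact two_mul_dotProduct_sub_quadForm_le (hK.Psi_posDef i) _ _
  have hbound : tracePairing (fun i => (M.LK K i)ᵀ * (M.Psi K i)⁻¹ * M.LK K i) (M.XK K') ≤
      normMax (M.XK K') * tracePairing (fun i => (M.LK K i)ᵀ * (M.Psi K i)⁻¹ * M.LK K i) 1 :=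
    tracePairing_le_normMax_mul fun i => by
      simpa only [conjTranspose_eq_transpose_of_trivial] using
        (hK.Psi_posDef i).inv.posSemidef.conjTranspose_mul_mul_same (M.LK K i)
  rw [map_sub, map_smul, LinearMap.sub_apply, LinearMap.smul_apply, smul_eq_mul] at hsquare
  rw [tupleInner_inv_mul_self _ hK.Psi_transpose]
  linarith

end IsMSS

end GradientDominance

end CostDifferences

/-! ### Second-order expansions along lines -/

section SecondOrder

lemma hasDerivAt_line {F : Type*} [NormedAddCommGroup F] [NormedSpace ℝ F] (x v : F) (s : ℝ) :
    HasDerivAt (fun s : ℝ => x + s • v) v s := by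
  simpa using ((hasDerivAt_id s).smul_const v).const_add x

variable {φ a : ℝ → ℝ} {c : ℝ}

lemma hasDerivAt_of_eventuallyEq_add_mul (hφ : φ =ᶠ[𝓝 0] fun s => c + s * a s)
    (ha : DifferentiableAt ℝ a 0) : HasDerivAt φ (a 0) 0 := by
  have hprod := ((hasDerivAt_id (0 : ℝ)).fun_mul ha.hasDerivAt).const_add c
  simp only [id_eq, one_mul, zero_mul, add_zero] at hprod
  exact hprod.congr_of_eventuallyEq hφ

lemma deriv_deriv_of_eventuallyEq_add_mul (hφ : φ =ᶠ[𝓝 0] fun s => c + s * a s)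
    (ha : ContDiffAt ℝ 2 a 0) : deriv (deriv φ) 0 = 2 * deriv a 0 := by
  have ha' : DifferentiableAt ℝ (deriv a) 0 :=
    (ha.derivWithin (m := 1) (by norm_num)).differentiableAt one_ne_zero
  have hdiff : ∀ᶠ s in 𝓝 (0 : ℝ), DifferentiableAt ℝ a s :=
    (ha.eventually (by simp)).mono fun s hs => hs.differentiableAt two_ne_zero
  have hφ' : deriv φ =ᶠ[𝓝 0] fun s => a s + s * deriv a s := by
    filter_upwards [hφ.deriv, hdiff] with s hs hs'
    rw [hs]
    simpa using (((hasDerivAt_id s).fun_mul hs'.hasDerivAt).const_add c).deriv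
  have hprod := (ha.differentiableAt two_ne_zero).hasDerivAt.fun_add
    ((hasDerivAt_id (0 : ℝ)).fun_mul ha'.hasDerivAt)
  rw [hφ'.deriv_eq, two_mul]
  simpa using hprod.deriv

end SecondOrder

section Gradient

variable {F : Type*} [NormedAddCommGroup F] [InnerProductSpace ℝ F]

lemma norm_le_of_abs_inner_le {T : F →L[ℝ] F} (hT : T.IsSymmetric) {c : ℝ} (hc : 0 ≤ c)
    (h : ∀ x, ‖x‖ = 1 → |inner ℝ (T x) x| ≤ c) : ‖T‖ ≤ c := by
  rw [T.norm_eq_iSup_rayleighQuotient hT]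
  refine ciSup_le fun x => ?_
  rcases eq_or_ne x 0 with rfl | hx
  · simpa using hc
  have hunit : ‖‖x‖⁻¹ • x‖ = 1 := by
    rw [norm_smul, norm_inv, norm_norm, inv_mul_cancel₀ (norm_ne_zero_iff.2 hx)]
  rw [← T.rayleigh_smul x (inv_ne_zero (norm_ne_zero_iff.2 hx)),
    ContinuousLinearMap.rayleighQuotient, hunit]
  simpa [ContinuousLinearMap.reApplyInnerSelf_apply] using h _ hunit

variable [CompleteSpace F] {f : F → ℝ} {x v : F} {s : ℝ}

lemma differentiableAt_gradient (hf : ContDiffAt ℝ 2 f x) : DifferentiableAt ℝ (∇ f) x := by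
  have hDual : IsBoundedLinearMap ℝ fun l : StrongDual ℝ F =>
      (InnerProductSpace.toDual ℝ F).symm l :=
    { map_add := map_add _
      map_smul := fun c l => by simp
      bound := ⟨1, one_pos, fun l => by simp⟩ }
  exact (hDual.differentiableAt (x := fderiv ℝ f x)).comp x
    ((hf.fderiv_right (m := 1) (by norm_num)).differentiableAt one_ne_zero)

lemma inner_fderiv_gradient (hf : ContDiffAt ℝ 2 f x) (u v : F) :
    inner ℝ (fderiv ℝ (∇ f) x u) v = fderiv ℝ (fderiv ℝ f) x u v := by
  have hleft := fderiv_inner_apply ℝ (differentiableAt_gradient hf) (differentiableAt_const v) u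
  have hright := fderiv_clm_apply
    ((hf.fderiv_right (m := 1) (by norm_num)).differentiableAt one_ne_zero)
    (differentiableAt_const v)
  simp only [inner_gradient_left, fderiv_fun_const, Pi.zero_apply, _root_.zero_apply,
    inner_zero_right, zero_add] at hleft
  rw [← hleft, hright]
  simp

lemma isSymmetric_fderiv_gradient (hf : ContDiffAt ℝ 2 f x) :
    (fderiv ℝ (∇ f) x).IsSymmetric := fun u v => calc
  inner ℝ (fderiv ℝ (∇ f) x u) v = fderiv ℝ (fderiv ℝ f) x u v := inner_fderiv_gradient hf u v
  _ = fderiv ℝ (fderiv ℝ f) x v u := hf.isSymmSndFDerivAt (by simp) u v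
  _ = inner ℝ u (fderiv ℝ (∇ f) x v) := by rw [real_inner_comm, inner_fderiv_gradient hf]

lemma hasDerivAt_comp_line (hf : DifferentiableAt ℝ f (x + s • v)) :
    HasDerivAt (fun s : ℝ => f (x + s • v)) (inner ℝ (∇ f (x + s • v)) v) s := by
  rw [inner_gradient_left]
  exact hf.hasFDerivAt.comp_hasDerivAt s (hasDerivAt_line x v s)

lemma hasDerivAt_inner_gradient_line (hf : ContDiffAt ℝ 2 f (x + s • v)) :
    HasDerivAt (fun s : ℝ => inner ℝ (∇ f (x + s • v)) v)
      (inner ℝ (fderiv ℝ (∇ f) (x + s • v) v) v) s := by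
  have hgrad := (differentiableAt_gradient hf).hasFDerivAt.comp_hasDerivAt s (hasDerivAt_line x v s)
  simpa using hgrad.inner ℝ (hasDerivAt_const s v)

lemma deriv_deriv_comp_line (hf : ContDiffAt ℝ 2 f x) (v : F) :
    deriv (deriv fun s : ℝ => f (x + s • v)) 0 = inner ℝ (fderiv ℝ (∇ f) x v) v := by
  have hline : ContinuousAt (fun s : ℝ => x + s • v) 0 := (hasDerivAt_line x v 0).continuousAt
  have hx : x + (0 : ℝ) • v = x := by rw [zero_smul, add_zero]
  rw [← hx] at hf
  have hderiv : (deriv fun s : ℝ => f (x + s • v)) =ᶠ[𝓝 0]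
      fun s => inner ℝ (∇ f (x + s • v)) v := by
    filter_upwards [hline.eventually (hf.eventually (by simp))] with s hs
    exact (hasDerivAt_comp_line (hs.differentiableAt two_ne_zero)).deriv
  rw [hderiv.deriv_eq, (hasDerivAt_inner_gradient_line hf).deriv, hx]

lemma le_add_deriv_add_of_deriv2_le {φ φ' φ'' : ℝ → ℝ} {c : ℝ}
    (hφ : ∀ t ∈ Set.Icc (0 : ℝ) 1, HasDerivAt φ (φ' t) t)
    (hφ' : ∀ t ∈ Set.Icc (0 : ℝ) 1, HasDerivAt φ' (φ'' t) t)
    (hc : ∀ t ∈ Set.Icc (0 : ℝ) 1, φ'' t ≤ c) : φ 1 ≤ φ 0 + φ' 0 + c / 2 := by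
  have hd (t : ℝ) (ht : t ∈ Set.Icc (0 : ℝ) 1) :
      HasDerivAt (fun t => φ t - c / 2 * t ^ 2) (φ' t - c * t) t := by
    refine ((hφ t ht).fun_sub ((hasDerivAt_pow 2 t).const_mul (c / 2))).congr_deriv ?_
    norm_num
    ring
  have hd' (t : ℝ) (ht : t ∈ Set.Icc (0 : ℝ) 1) :
      HasDerivAt (fun t => φ' t - c * t) (φ'' t - c) t := by
    simpa using (hφ' t ht).fun_sub ((hasDerivAt_id t).const_mul c)
  have hconcave : ConcaveOn ℝ (Set.Icc 0 1) fun t => φ t - c / 2 * t ^ 2 :=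
    concaveOn_of_hasDerivWithinAt2_nonpos (convex_Icc 0 1)
      (fun t ht => (hd t ht).continuousAt.continuousWithinAt)
      (fun t ht => (hd t (interior_subset ht)).hasDerivWithinAt)
      (fun t ht => (hd' t (interior_subset ht)).hasDerivWithinAt)
      fun t ht => sub_nonpos.2 (hc t (interior_subset ht))
  have hslope := hconcave.slope_le_of_hasDerivAt (Set.left_mem_Icc.2 zero_le_one)
    (Set.right_mem_Icc.2 zero_le_one) one_pos (hd 0 (Set.left_mem_Icc.2 zero_le_one))
  norm_num [slope_def_field] at hslope
  linarith

lemma le_add_inner_gradient_add_of_norm_hessian_le {y : F} {c : ℝ}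
    (hf : ∀ t ∈ Set.Icc (0 : ℝ) 1, ContDiffAt ℝ 2 f (x + t • (y - x)))
    (hc : ∀ t ∈ Set.Icc (0 : ℝ) 1, ‖fderiv ℝ (∇ f) (x + t • (y - x))‖ ≤ c) :
    f y ≤ f x + inner ℝ (∇ f x) (y - x) + c / 2 * ‖y - x‖ ^ 2 := by
  have hquad (t : ℝ) (ht : t ∈ Set.Icc (0 : ℝ) 1) :
      inner ℝ (fderiv ℝ (∇ f) (x + t • (y - x)) (y - x)) (y - x) ≤ c * ‖y - x‖ ^ 2 := by
    grw [real_inner_le_norm, ContinuousLinearMap.le_opNorm, hc t ht, mul_assoc, ← sq]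
  have htaylor := le_add_deriv_add_of_deriv2_le
    (fun t ht => hasDerivAt_comp_line ((hf t ht).differentiableAt two_ne_zero))
    (fun t ht => hasDerivAt_inner_gradient_line (hf t ht)) hquad
  simp only [one_smul, zero_smul, add_zero, add_sub_cancel] at htaylor
  linarith

end Gradient

/-! ### Smoothness and the gradient of the cost -/

section CostGradient

section SmoothnessInSystem

variable {ι n E : Type*} [Fintype ι] [Fintype n] [NormedAddCommGroup E] [NormedSpace ℝ E]
  {r : WithTop ℕ∞} {p : Matrix ι ι ℝ} {e : E}

lemma contDiffAt_tracePairing {H S : E → ι → Matrix n n ℝ}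
    (hH : ∀ i α β, ContDiffAt ℝ r (fun e => H e i α β) e)
    (hS : ∀ i α β, ContDiffAt ℝ r (fun e => S e i α β) e) :
    ContDiffAt ℝ r (fun e => tracePairing (H e) (S e)) e := by
  simp only [tracePairing_apply, trace, diag_apply, mul_apply]
  exact ContDiffAt.sum fun i _ => ContDiffAt.sum fun α _ => ContDiffAt.sum fun β _ =>
    (hH i α β).mul (hS i β α)

section

attribute [local instance] Matrix.normedAddCommGroup Matrix.normedSpace

lemma contDiff_lyapAdjoint {G : E → ι → Matrix n n ℝ}
    (hG : ∀ i α β, ContDiff ℝ r fun e => G e i α β) :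
    ContDiff ℝ r fun e =>
      Module.End.toContinuousLinearMap (𝕜 := ℝ) (ι → Matrix n n ℝ) (lyapAdjoint p (G e)) := by
  rw [contDiff_clm_apply_iff]
  refine fun S => contDiff_pi.2 fun j => contDiff_pi.2 fun α => contDiff_pi.2 fun β => ?_
  have happly : (fun e => lyapAdjoint p (G e) S j α β) = fun e =>
      ∑ i, p i j * ∑ γ, (∑ δ, G e i α δ * S i δ γ) * G e i β γ := by
    ext e
    simp only [lyapAdjoint_apply, Matrix.sum_apply, Matrix.smul_apply, mul_apply,
      transpose_apply, smul_eq_mul]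
  suffices ContDiff ℝ r fun e => lyapAdjoint p (G e) S j α β from this
  rw [happly]
  exact ContDiff.sum fun i _ => contDiff_const.mul <| ContDiff.sum fun γ _ =>
    (ContDiff.sum fun δ _ => (hG i α δ).mul contDiff_const).mul (hG i β γ)

lemma IsStable.isUnit_one_sub_lyapAdjoint {G : ι → Matrix n n ℝ} (hG : IsStable p G) :
    IsUnit (1 - Module.End.toContinuousLinearMap (𝕜 := ℝ) (ι → Matrix n n ℝ)
      (lyapAdjoint p G)) := by
  have hunit : IsUnit (1 - lyapAdjoint p G) :=
    (LinearMap.isUnit_iff_ker_eq_bot _).2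
      (LinearMap.ker_eq_bot.2 hG.injective_one_sub_lyapAdjoint)
  simpa only [map_sub, map_one] using
    hunit.map (Module.End.toContinuousLinearMap (𝕜 := ℝ) (ι → Matrix n n ℝ))

/-- `X e'` is the image of `S` under the inverse of `1 - lyapAdjoint p (G e')`, and inversion is
smooth in a Banach algebra. -/
lemma IsStable.contDiffAt_of_eq_add_lyapAdjoint {G X : E → ι → Matrix n n ℝ}
    {S : ι → Matrix n n ℝ} (hstab : IsStable p (G e))
    (hG : ∀ i α β, ContDiff ℝ r fun e => G e i α β)
    (hX : ∀ᶠ e' in 𝓝 e, X e' = S + lyapAdjoint p (G e') (X e')) (i : ι) (α β : n) :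
    ContDiffAt ℝ r (fun e => X e i α β) e := by
  let T := fun e =>
    1 - Module.End.toContinuousLinearMap (𝕜 := ℝ) (ι → Matrix n n ℝ) (lyapAdjoint p (G e))
  have hT : ContDiff ℝ r T := contDiff_const.sub (contDiff_lyapAdjoint hG)
  have hTe : IsUnit (T e) := hstab.isUnit_one_sub_lyapAdjoint
  obtain ⟨u, hu⟩ := hTe
  have hinverse : ContDiffAt ℝ r (fun e => Ring.inverse (T e) S) e :=
    ((hu ▸ contDiffAt_ringInverse ℝ u : ContDiffAt ℝ r Ring.inverse (T e)).comp e
      hT.contDiffAt).clm_apply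
      contDiffAt_const
  have hunit : ∀ᶠ e' in 𝓝 e, IsUnit (T e') :=
    hT.continuous.continuousAt.eventually (hu ▸ Units.nhds u)
  have heq : X =ᶠ[𝓝 e] fun e => Ring.inverse (T e) S := by
    filter_upwards [hX, hunit] with e' he' hunit'
    have hTX : T e' (X e') = S := sub_eq_iff_eq_add.2 he'
    rw [← hTX]
    exact (DFunLike.congr_fun (Ring.inverse_mul_cancel _ hunit') (X e')).symm
  exact contDiffAt_pi.1 (contDiffAt_pi.1 (contDiffAt_pi.1
    (hinverse.congr_of_eventuallyEq heq) i) α) β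

end

end SmoothnessInSystem

variable {N d k : ℕ} {Ω : Type*} [MeasurableSpace Ω] (M : MJLS N d k Ω) {K : Policy N k d}

section SmoothnessInPolicy

variable {r : WithTop ℕ∞}

lemma contDiff_mat (i : Fin N) (a : Fin k) (b : Fin d) :
    ContDiff ℝ r fun K : Policy N k d => K.mat i a b := by
  simp only [Policy.mat, of_apply]
  fun_prop

lemma contDiff_Γ (i : Fin N) (α β : Fin d) : ContDiff ℝ r fun K => M.Γ K i α β := by
  simp only [Γ, Matrix.sub_apply, mul_apply]
  exact contDiff_const.sub (ContDiff.sum fun a _ => contDiff_const.mul (contDiff_mat i a β))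

lemma contDiff_stageMat (i : Fin N) (α β : Fin d) :
    ContDiff ℝ r fun K => M.stageMat K i α β := by
  simp only [stageMat, Matrix.add_apply, mul_apply, transpose_apply]
  exact contDiff_const.add (ContDiff.sum fun a _ =>
    (ContDiff.sum fun b _ => (contDiff_mat i b α).mul contDiff_const).mul (contDiff_mat i a β))

variable {M}

lemma IsMSS.eventually (hK : M.IsMSS K) : ∀ᶠ K' in 𝓝 K, M.IsMSS K' :=
  M.isOpen_stabSet.mem_nhds hK

lemma IsMSS.contDiffAt_XK (hK : M.IsMSS K) (i : Fin N) (α β : Fin d) :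
    ContDiffAt ℝ r (fun K => M.XK K i α β) K :=
  hK.isStable.contDiffAt_of_eq_add_lyapAdjoint M.contDiff_Γ
    (hK.eventually.mono fun _ hK' => hK'.XK_eq) i α β

lemma IsMSS.contDiffAt_cost (hK : M.IsMSS K) : ContDiffAt ℝ r M.cost K :=
  (contDiffAt_tracePairing (fun i α β => (M.contDiff_stageMat i α β).contDiffAt)
    hK.contDiffAt_XK).congr_of_eventuallyEq
      (hK.eventually.mono fun _ hK' => hK'.cost_eq_tracePairing_XK)

end SmoothnessInPolicy

variable {M} {E : Policy N k d}

section Gradient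

lemma IsMSS.eventually_line (hK : M.IsMSS K) (E : Policy N k d) :
    ∀ᶠ s in 𝓝 (0 : ℝ), M.IsMSS (K + s • E) := by
  refine (hasDerivAt_line K E 0).continuousAt.eventually ?_
  simpa only [zero_smul, add_zero] using hK.eventually

lemma IsMSS.contDiffAt_tracePairing_XK_line (hK : M.IsMSS K) (E : Policy N k d)
    (H : Fin N → Matrix (Fin d) (Fin d) ℝ) {r : WithTop ℕ∞} :
    ContDiffAt ℝ r (fun s : ℝ => tracePairing H (M.XK (K + s • E))) 0 := by
  have hline : ContDiffAt ℝ r (fun s : ℝ => K + s • E) 0 := by fun_prop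
  refine contDiffAt_tracePairing (fun _ _ _ => contDiffAt_const) fun i α β => ?_
  refine ContDiffAt.comp (g := fun K => M.XK K i α β) 0 ?_ hline
  simpa only [zero_smul, add_zero] using hK.contDiffAt_XK i α β

/-- The symmetrization `Eᵀ L + Lᵀ E` of the linear coefficient `Eᵀ L` of the cost along the
direction `E`. -/
def symDir (M : MJLS N d k Ω) (K E : Policy N k d) (i : Fin N) : Matrix (Fin d) (Fin d) ℝ :=
  (E.mat i)ᵀ * M.LK K i + ((E.mat i)ᵀ * M.LK K i)ᵀ

lemma symDir_transpose (i : Fin N) : (M.symDir K E i)ᵀ = M.symDir K E i := by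
  rw [symDir, transpose_add, transpose_transpose, add_comm]

lemma tracePairing_symDir {S : Fin N → Matrix (Fin d) (Fin d) ℝ} (hS : ∀ i, (S i)ᵀ = S i) :
    tracePairing (M.symDir K E) S = 2 * tracePairing (fun i => (E.mat i)ᵀ * M.LK K i) S := by
  have hsplit : M.symDir K E = (fun i => (E.mat i)ᵀ * M.LK K i) +
      fun i => ((E.mat i)ᵀ * M.LK K i)ᵀ := rfl
  rw [hsplit, map_add, LinearMap.add_apply, tracePairing_transpose _ hS, two_mul]

lemma IsMSS.cost_line (hK : M.IsMSS K) {s : ℝ} (hs : M.IsMSS (K + s • E)) :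
    M.cost (K + s • E) = M.cost K + s * (tracePairing (M.symDir K E) (M.XK (K + s • E)) +
      s * tracePairing (fun i => (E.mat i)ᵀ * M.Psi K i * E.mat i) (M.XK (K + s • E))) := by
  have hmat (i : Fin N) : (K - (K + s • E)).mat i = -s • E.mat i := by
    rw [sub_add_cancel_left, ← neg_smul]
    rfl
  have hlin : (fun i => ((K - (K + s • E)).mat i)ᵀ * M.LK K i) =
      -s • fun i => (E.mat i)ᵀ * M.LK K i := by
    ext1 i
    rw [hmat, transpose_smul, Matrix.smul_mul, Pi.smul_apply]
  have hquad : (fun i => ((K - (K + s • E)).mat i)ᵀ * M.Psi K i * (K - (K + s • E)).mat i) =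
      s ^ 2 • fun i => (E.mat i)ᵀ * M.Psi K i * E.mat i := by
    ext1 i
    rw [hmat, transpose_smul, Matrix.smul_mul, Matrix.smul_mul, Matrix.mul_smul, smul_smul,
      Pi.smul_apply, neg_mul_neg, sq]
  have hdiff := hK.cost_sub_cost hs
  rw [hlin, hquad, map_smul, map_smul, LinearMap.smul_apply, LinearMap.smul_apply, smul_eq_mul,
    smul_eq_mul] at hdiff
  rw [tracePairing_symDir hs.XK_transpose]
  linear_combination hdiff

lemma IsMSS.contDiffAt_cost_line_slope (hK : M.IsMSS K) (E : Policy N k d) {r : WithTop ℕ∞} :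
    ContDiffAt ℝ r (fun s : ℝ => tracePairing (M.symDir K E) (M.XK (K + s • E)) +
      s * tracePairing (fun i => (E.mat i)ᵀ * M.Psi K i * E.mat i) (M.XK (K + s • E))) 0 :=
  (hK.contDiffAt_tracePairing_XK_line E _).add
    (contDiffAt_id.mul (hK.contDiffAt_tracePairing_XK_line E _))

lemma IsMSS.eventuallyEq_cost_line (hK : M.IsMSS K) (E : Policy N k d) :
    (fun s : ℝ => M.cost (K + s • E)) =ᶠ[𝓝 0] fun s =>
      M.cost K + s * (tracePairing (M.symDir K E) (M.XK (K + s • E)) +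
        s * tracePairing (fun i => (E.mat i)ᵀ * M.Psi K i * E.mat i) (M.XK (K + s • E))) :=
  (hK.eventually_line E).mono fun _ hs => hK.cost_line hs

lemma IsMSS.inner_gradient_cost (hK : M.IsMSS K) (E : Policy N k d) :
    inner ℝ (∇ M.cost K) E = tracePairing (M.symDir K E) (M.XK K) := by
  have hcost := hasDerivAt_comp_line (f := M.cost) (x := K) (v := E) (s := 0)
    (by simpa using (hK.contDiffAt_cost (r := 1)).differentiableAt one_ne_zero)
  have hexpand := hasDerivAt_of_eventuallyEq_add_mul (hK.eventuallyEq_cost_line E)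
    ((hK.contDiffAt_cost_line_slope E (r := 1)).differentiableAt one_ne_zero)
  simpa using hcost.unique hexpand

/-- The policy with gain matrices `V i`, inverse to `Policy.mat`. -/
def ofMat (V : Fin N → Matrix (Fin k) (Fin d) ℝ) : Policy N k d :=
  WithLp.toLp 2 fun x => V x.1 x.2.1 x.2.2

lemma IsMSS.gradient_cost (hK : M.IsMSS K) :
    ∇ M.cost K = (2 : ℝ) • ofMat fun i => M.LK K i * M.XK K i := by
  refine ext_inner_right ℝ fun E => ?_
  rw [hK.inner_gradient_cost, tracePairing_symDir hK.XK_transpose, real_inner_smul_left,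
    real_inner_comm, inner_eq_tupleInner, tracePairing_apply]
  simp only [Matrix.mul_assoc]
  rfl

lemma IsMSS.norm_gradient_sq (hK : M.IsMSS K) :
    ‖∇ M.cost K‖ ^ 2 = 4 * tupleInner (fun i => M.LK K i * M.XK K i)
      fun i => M.LK K i * M.XK K i := by
  rw [hK.gradient_cost, norm_smul, mul_pow, ← real_inner_self_eq_norm_sq (ofMat _),
    inner_eq_tupleInner]
  norm_num
  rfl

end Gradient

end CostGradient

/-! ### The Hessian of the cost -/

section CostHessian

section LyapunovPolarization

variable {ι n : Type*} [Fintype ι] [Fintype n] {p : Matrix ι ι ℝ}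

/-- The polarization `Dᵀ E(P) G` of the Lyapunov operator `P ↦ Gᵀ E(P) G`, which expands it along
a line of systems. -/
def lyapCross (p : Matrix ι ι ℝ) (D G P : ι → Matrix n n ℝ) (i : ι) : Matrix n n ℝ :=
  (D i)ᵀ * (∑ j, p i j • P j) * G i

lemma lyapOp_sub_smul_sub (D G P : ι → Matrix n n ℝ) (s : ℝ) :
    lyapOp p (G - s • D) P - lyapOp p G P =
      -s • (lyapCross p D G P + lyapCross p G D P) + s ^ 2 • lyapOp p D P := by
  ext1 i
  simp only [lyapCross, Pi.add_apply, Pi.sub_apply, Pi.smul_apply, Pi.neg_apply, lyapOp_apply,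
    transpose_sub, transpose_smul, Matrix.sub_mul, Matrix.mul_sub, Matrix.smul_mul,
    Matrix.mul_smul, smul_smul, smul_sub, smul_add, neg_smul, pow_two]
  abel

lemma lyapCross_transpose {P : ι → Matrix n n ℝ} (hP : ∀ i, (P i)ᵀ = P i)
    (D G : ι → Matrix n n ℝ) (i : ι) : (lyapCross p D G P i)ᵀ = lyapCross p G D P i := by
  simp only [lyapCross, transpose_mul, transpose_transpose, transpose_sum, transpose_smul, hP,
    Matrix.mul_assoc]

lemma dotProduct_lyapCross_mulVec (D G P : ι → Matrix n n ℝ) (i : ι) (v w : n → ℝ) :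
    v ⬝ᵥ lyapCross p D G P i *ᵥ w = (D i *ᵥ v) ⬝ᵥ (∑ j, p i j • P j) *ᵥ (G i *ᵥ w) := by
  rw [lyapCross, Matrix.mul_assoc, dotProduct_transpose_mul_mulVec, mulVec_mulVec]

lemma tracePairing_lyapCross_add {P S : ι → Matrix n n ℝ} (hP : ∀ i, (P i)ᵀ = P i)
    (hS : ∀ i, (S i)ᵀ = S i) (D G : ι → Matrix n n ℝ) :
    tracePairing (lyapCross p D G P + lyapCross p G D P) S =
      2 * tracePairing (lyapCross p D G P) S := by
  have htranspose : lyapCross p G D P = fun i => (lyapCross p D G P i)ᵀ :=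
    funext fun i => (lyapCross_transpose hP D G i).symm
  rw [map_add, LinearMap.add_apply, htranspose, tracePairing_transpose _ hS, two_mul]

lemma tracePairing_lyapOp_le {P X S : ι → Matrix n n ℝ} {G : ι → Matrix n n ℝ}
    (hX : X = S + lyapAdjoint p G X) (hP : ∀ i v, 0 ≤ v ⬝ᵥ P i *ᵥ v)
    (hS : ∀ i, (S i).PosSemidef) : tracePairing (lyapOp p G P) X ≤ tracePairing P X := by
  have hdiff := tracePairing_add_lyapOp_sub 0 P hX
  rw [zero_add, map_sub, map_zero, LinearMap.sub_apply, LinearMap.zero_apply] at hdiff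
  have hnonneg := tracePairing_nonneg hP hS
  linarith

lemma IsStable.abs_quadForm_le_of_eq_add_lyapOp {G : ι → Matrix n n ℝ} (hG : IsStable p G)
    (hp : ∀ i j, 0 ≤ p i j) {P P' H H' : ι → Matrix n n ℝ} (hP : P = H + lyapOp p G P)
    (hP' : P' = H' + lyapOp p G P') (h : ∀ i v, |v ⬝ᵥ H i *ᵥ v| ≤ v ⬝ᵥ H' i *ᵥ v) (i : ι)
    (v : n → ℝ) : |v ⬝ᵥ P i *ᵥ v| ≤ v ⬝ᵥ P' i *ᵥ v := by
  have hsub : P' - P = (H' - H) + lyapOp p G (P' - P) := by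
    nth_rw 1 [hP, hP', map_sub, add_sub_add_comm]
  have hadd : P' + P = (H' + H) + lyapOp p G (P' + P) := by
    nth_rw 1 [hP, hP', map_add, add_add_add_comm]
  have hsub_nonneg (i : ι) (v : n → ℝ) : 0 ≤ v ⬝ᵥ (H' - H) i *ᵥ v := by
    rw [Pi.sub_apply, sub_mulVec, dotProduct_sub, sub_nonneg]
    exact (abs_le.1 (h i v)).2
  have hadd_nonneg (i : ι) (v : n → ℝ) : 0 ≤ v ⬝ᵥ (H' + H) i *ᵥ v := by
    rw [Pi.add_apply, add_mulVec, dotProduct_add]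
    linarith [(abs_le.1 (h i v)).1]
  have hupper := (hsub_nonneg i v).trans (hG.le_of_eq_add_lyapOp hp hsub hsub_nonneg i v)
  have hlower := (hadd_nonneg i v).trans (hG.le_of_eq_add_lyapOp hp hadd hadd_nonneg i v)
  rw [Pi.sub_apply, sub_mulVec, dotProduct_sub] at hupper
  rw [Pi.add_apply, add_mulVec, dotProduct_add] at hlower
  rw [abs_le]
  constructor <;> linarith

end LyapunovPolarization

variable {N d k : ℕ} {Ω : Type*} [MeasurableSpace Ω] {M : MJLS N d k Ω} {K E : Policy N k d}

section Hessian

variable {P H : Fin N → Matrix (Fin d) (Fin d) ℝ}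

lemma Γ_line (K E : Policy N k d) (s : ℝ) :
    M.Γ (K + s • E) = M.Γ K - s • fun i => M.B i * E.mat i := by
  have hmat (i : Fin N) : (K + s • E).mat i = K.mat i + s • E.mat i := rfl
  ext1 i
  rw [Pi.sub_apply, Pi.smul_apply, Γ, Γ, hmat, Matrix.mul_add, Matrix.mul_smul, sub_sub]

namespace IsMSS

variable (hK : M.IsMSS K)
include hK

lemma tracePairing_XK_line (hP : P = H + lyapOp M.p (M.Γ K) P) {s : ℝ}
    (hs : M.IsMSS (K + s • E)) :
    tracePairing H (M.XK (K + s • E)) = tracePairing H (M.XK K) + s *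
      (-tracePairing (lyapCross M.p (fun i => M.B i * E.mat i) (M.Γ K) P +
          lyapCross M.p (M.Γ K) (fun i => M.B i * E.mat i) P) (M.XK (K + s • E)) +
        s * tracePairing (lyapOp M.p (fun i => M.B i * E.mat i) P) (M.XK (K + s • E))) := by
  have hsource : H + lyapOp M.p (M.Γ (K + s • E)) P - P =
      lyapOp M.p (M.Γ (K + s • E)) P - lyapOp M.p (M.Γ K) P := by
    nth_rw 2 [hP]
    abel
  have hexpand := tracePairing_add_lyapOp_sub H P hs.XK_eq
  rw [hsource, tracePairing_eq_of_eq_add hP hK.XK_eq, Γ_line, lyapOp_sub_smul_sub, map_add,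
    map_smul, map_smul, LinearMap.add_apply, LinearMap.smul_apply, LinearMap.smul_apply,
    smul_eq_mul, smul_eq_mul] at hexpand
  linear_combination -hexpand

lemma hasDerivAt_tracePairing_XK_line (hP : P = H + lyapOp M.p (M.Γ K) P)
    (hPsymm : ∀ i, (P i)ᵀ = P i) (E : Policy N k d) :
    HasDerivAt (fun s : ℝ => tracePairing H (M.XK (K + s • E)))
      (-2 * tracePairing (lyapCross M.p (fun i => M.B i * E.mat i) (M.Γ K) P) (M.XK K)) 0 := by
  have hdiff (G : Fin N → Matrix (Fin d) (Fin d) ℝ) :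
      DifferentiableAt ℝ (fun s : ℝ => tracePairing G (M.XK (K + s • E))) 0 :=
    (hK.contDiffAt_tracePairing_XK_line E G (r := 1)).differentiableAt one_ne_zero
  have h := hasDerivAt_of_eventuallyEq_add_mul
    ((hK.eventually_line E).mono fun _ hs => hK.tracePairing_XK_line hP hs)
    ((hdiff _).neg.add (differentiableAt_id.mul (hdiff _)))
  simpa only [zero_smul, add_zero, zero_mul, tracePairing_lyapCross_add hPsymm hK.XK_transpose,
    ← neg_mul] using h

lemma inner_hessian_cost (hP : P = M.symDir K E + lyapOp M.p (M.Γ K) P) :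
    inner ℝ (fderiv ℝ (∇ M.cost) K E) E =
      2 * tracePairing (fun i => (E.mat i)ᵀ * M.Psi K i * E.mat i) (M.XK K) -
      4 * tracePairing (lyapCross M.p (fun i => M.B i * E.mat i) (M.Γ K) P) (M.XK K) := by
  have hPsymm := hK.isStable.transpose_eq_self hP fun _ => symDir_transpose _
  have hquad := (hK.contDiffAt_tracePairing_XK_line E
    (fun i => (E.mat i)ᵀ * M.Psi K i * E.mat i) (r := 1)).differentiableAt one_ne_zero
  have hslope := (hK.hasDerivAt_tracePairing_XK_line hP hPsymm E).fun_add
    ((hasDerivAt_id (0 : ℝ)).fun_mul hquad.hasDerivAt)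
  simp only [id_eq, one_mul, zero_mul, add_zero, zero_smul] at hslope
  rw [← deriv_deriv_comp_line hK.contDiffAt_cost, deriv_deriv_of_eventuallyEq_add_mul
    (hK.eventuallyEq_cost_line E) (hK.contDiffAt_cost_line_slope E), hslope.deriv]
  ring

end IsMSS

end Hessian

section QuadFormBounds

variable {ι n : Type*} [Fintype ι] [Fintype n] {H : Matrix n n ℝ}

lemma abs_two_mul_dotProduct_mulVec_le (hH : H.PosSemidef) (u w : n → ℝ) :
    |2 * (u ⬝ᵥ H *ᵥ w)| ≤ u ⬝ᵥ H *ᵥ u + w ⬝ᵥ H *ᵥ w := by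
  have hadd := quadForm_nonneg hH (u + w)
  have hsub := quadForm_nonneg hH (u - w)
  simp only [mulVec_add, mulVec_sub, dotProduct_add, dotProduct_sub, add_dotProduct,
    sub_dotProduct, dotProduct_mulVec_symm (transpose_eq_of_posSemidef hH) u w] at hadd hsub
  rw [abs_le]
  constructor <;> linarith

lemma abs_dotProduct_mulVec_le_of_sq_le (hH : Hᵀ = H) {b c t : ℝ}
    (hc : ∀ v, |v ⬝ᵥ H *ᵥ v| ≤ c * (v ⬝ᵥ v)) (hc0 : 0 ≤ c) (hb : 0 ≤ b) {u : n → ℝ}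
    (hu : u ⬝ᵥ u ≤ b ^ 2 * t) (w : n → ℝ) :
    |u ⬝ᵥ H *ᵥ w| ≤ b * c / 2 * (t + w ⬝ᵥ w) := by
  rcases hb.eq_or_lt with rfl | hb
  · have hzero : u = 0 :=
      dotProduct_self_eq_zero.1 (le_antisymm (by simpa using hu) (dotProduct_self_nonneg u))
    simp [hzero]
  have hunscaled : u = b • (b⁻¹ • u) := (smul_inv_smul₀ hb.ne' u).symm
  have hscaled : (b⁻¹ • u) ⬝ᵥ (b⁻¹ • u) ≤ t := by
    rw [smul_dotProduct, dotProduct_smul, smul_eq_mul, smul_eq_mul, ← mul_assoc, ← mul_inv, ← sq,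
      inv_mul_le_iff₀ (by positivity)]
    exact hu
  calc |u ⬝ᵥ H *ᵥ w| = b * |(b⁻¹ • u) ⬝ᵥ H *ᵥ w| := by
        nth_rw 1 [hunscaled]
        rw [smul_dotProduct, smul_eq_mul, abs_mul, abs_of_pos hb]
    _ ≤ b * (c * ((b⁻¹ • u) ⬝ᵥ (b⁻¹ • u) + w ⬝ᵥ w) / 2) := by
        gcongr
        exact abs_dotProduct_mulVec_le_of_symm hH hc _ w
    _ ≤ b * (c * (t + w ⬝ᵥ w) / 2) := by gcongr
    _ = b * c / 2 * (t + w ⬝ᵥ w) := by ring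

lemma abs_tracePairing_le {G D S : ι → Matrix n n ℝ}
    (h : ∀ i v, |v ⬝ᵥ G i *ᵥ v| ≤ v ⬝ᵥ D i *ᵥ v) (hS : ∀ i, (S i).PosSemidef) :
    |tracePairing G S| ≤ tracePairing D S := by
  refine abs_le'.2 ⟨tracePairing_le_tracePairing (fun i v => (le_abs_self _).trans (h i v)) hS, ?_⟩
  rw [← LinearMap.neg_apply, ← map_neg]
  refine tracePairing_le_tracePairing (fun i v => ?_) hS
  rw [Pi.neg_apply, neg_mulVec, dotProduct_neg]
  exact (neg_le_abs _).trans (h i v)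

end QuadFormBounds

section Bounds

lemma abs_opE_quadForm_le {P : Fin N → Matrix (Fin d) (Fin d) ℝ} {c : ℝ}
    (h : ∀ i v, |v ⬝ᵥ P i *ᵥ v| ≤ c * (v ⬝ᵥ v)) (i : Fin N) (v : Fin d → ℝ) :
    |v ⬝ᵥ M.opE P i *ᵥ v| ≤ c * (v ⬝ᵥ v) := by
  simp only [opE, sum_mulVec, dotProduct_sum, smul_mulVec, dotProduct_smul, smul_eq_mul]
  refine (Finset.abs_sum_le_sum_abs _ _).trans ?_
  rw [← one_mul (c * _), ← M.p_sum i, Finset.sum_mul]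
  refine Finset.sum_le_sum fun j _ => ?_
  rw [abs_mul, abs_of_nonneg (M.p_nonneg i j)]
  exact mul_le_mul_of_nonneg_left (h j v) (M.p_nonneg i j)

lemma mat_mulVec_dotProduct_le (hE : ‖E‖ ≤ 1) (i : Fin N) (v : Fin d → ℝ) :
    (E.mat i *ᵥ v) ⬝ᵥ (E.mat i *ᵥ v) ≤ v ⬝ᵥ v := by
  have hpos (i : Fin N) : ((E.mat i)ᵀ * E.mat i).PosSemidef := by
    simpa using posSemidef_conjTranspose_mul_self (E.mat i)
  have htrace : ((E.mat i)ᵀ * E.mat i).trace ≤ 1 := by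
    refine le_trans ?_ (pow_le_one₀ (norm_nonneg E) hE (n := 2))
    rw [norm_sq_eq_tupleInner]
    exact Finset.single_le_sum (f := fun i => ((E.mat i)ᵀ * E.mat i).trace)
      (fun i _ => (hpos i).trace_nonneg) (Finset.mem_univ i)
  rw [← dotProduct_transpose_mul_mulVec]
  exact (dotProduct_mulVec_le_trace_mul (hpos i) v).trans
    (mul_le_of_le_one_left (dotProduct_self_nonneg v) htrace)

lemma LK_eq (K : Policy N k d) (i : Fin N) :
    M.LK K i = M.R i * K.mat i - (M.B i)ᵀ * M.opE (M.PK K) i * M.Γ K i := by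
  simp only [LK, Psi, Γ, Matrix.add_mul, Matrix.mul_sub, Matrix.mul_assoc]
  abel

lemma dotProduct_Psi_mulVec (K : Policy N k d) (i : Fin N) (w : Fin k → ℝ) :
    w ⬝ᵥ M.Psi K i *ᵥ w =
      w ⬝ᵥ M.R i *ᵥ w + (M.B i *ᵥ w) ⬝ᵥ M.opE (M.PK K) i *ᵥ (M.B i *ᵥ w) := by
  rw [Psi, add_mulVec, dotProduct_add, dotProduct_transpose_mul_mul_mulVec]

lemma dotProduct_symDir_mulVec (K E : Policy N k d) (i : Fin N) (v : Fin d → ℝ) :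
    v ⬝ᵥ M.symDir K E i *ᵥ v = 2 * ((E.mat i *ᵥ v) ⬝ᵥ M.R i *ᵥ (K.mat i *ᵥ v)) -
      2 * ((M.B i *ᵥ E.mat i *ᵥ v) ⬝ᵥ M.opE (M.PK K) i *ᵥ (M.Γ K i *ᵥ v)) := by
  have hsymm : v ⬝ᵥ ((E.mat i)ᵀ * M.LK K i)ᵀ *ᵥ v = v ⬝ᵥ ((E.mat i)ᵀ * M.LK K i) *ᵥ v := by
    rw [mulVec_transpose, dotProduct_comm, ← dotProduct_mulVec]
  rw [symDir, add_mulVec, dotProduct_add, hsymm, dotProduct_transpose_mul_mulVec, LK_eq,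
    sub_mulVec, dotProduct_sub, ← mulVec_mulVec, ← mulVec_mulVec, ← mulVec_mulVec,
    dotProduct_mulVec _ (M.B i)ᵀ, vecMul_transpose]
  ring

lemma smoothConst_eq (M : MJLS N d k Ω) (α : ℝ) : M.smoothConst α =
    (2 * (normMax M.R + normMax M.B ^ 2 * (α / M.mu)) +
      4 * (normMax M.B * (M.xi α * (α / M.mu)))) * (α / lamMin M.Q) := by
  have hB : normMax M.B ^ 2 * (1 + 2 * M.xi α / normMax M.B) =
      normMax M.B ^ 2 + 2 * M.xi α * normMax M.B := by
    rcases eq_or_ne (normMax M.B) 0 with h | h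
    · simp [h]
    · field_simp
  rw [smoothConst, hB]
  ring

namespace IsMSS

section

variable (hK : M.IsMSS K)
include hK

lemma dotProduct_PK_mulVec (i : Fin N) (v : Fin d → ℝ) :
    v ⬝ᵥ M.PK K i *ᵥ v = v ⬝ᵥ M.Q i *ᵥ v + (K.mat i *ᵥ v) ⬝ᵥ M.R i *ᵥ (K.mat i *ᵥ v) +
      (M.Γ K i *ᵥ v) ⬝ᵥ M.opE (M.PK K) i *ᵥ (M.Γ K i *ᵥ v) := by
  conv_lhs => rw [hK.PK_eq]
  rw [Pi.add_apply, lyapOp_apply, add_mulVec, dotProduct_add, dotProduct_stageMat_mulVec,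
    dotProduct_transpose_mul_mul_mulVec, opE]

lemma abs_symDir_quadForm_le (E : Policy N k d) (i : Fin N) (v : Fin d → ℝ) :
    |v ⬝ᵥ M.symDir K E i *ᵥ v| ≤ (E.mat i *ᵥ v) ⬝ᵥ M.Psi K i *ᵥ (E.mat i *ᵥ v) +
      v ⬝ᵥ M.PK K i *ᵥ v - v ⬝ᵥ M.Q i *ᵥ v := by
  have hR := abs_two_mul_dotProduct_mulVec_le (M.R_posDef i).posSemidef (E.mat i *ᵥ v)
    (K.mat i *ᵥ v)
  have hP := abs_two_mul_dotProduct_mulVec_le (hK.opE_PK_posSemidef i)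
    (M.B i *ᵥ E.mat i *ᵥ v) (M.Γ K i *ᵥ v)
  rw [dotProduct_symDir_mulVec, dotProduct_Psi_mulVec, hK.dotProduct_PK_mulVec]
  refine (abs_sub _ _).trans ?_
  linarith

end

variable [NeZero d] {α : ℝ} (hK : M.IsMSS K) (hα : M.cost K ≤ α)
include hK hα

lemma tracePairing_one_XK_le : tracePairing 1 (M.XK K) ≤ α / lamMin M.Q := by
  rw [le_div_iff₀ M.lamMin_Q_pos, mul_comm]
  refine le_trans ?_ (hK.cost_eq_tracePairing_XK ▸ hα)
  exact mul_tracePairing_one_le (fun i v => (lamMin_mul_le_quadForm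
    (fun i => (M.Q_posDef i).posSemidef) i v).trans (M.Q_le_stageMat K i v)) hK.XK_posSemidef

lemma PK_quadForm_le (i : Fin N) (v : Fin d → ℝ) :
    v ⬝ᵥ M.PK K i *ᵥ v ≤ α / M.mu * (v ⬝ᵥ v) := by
  have htrace : (M.PK K i).trace ≤ tracePairing 1 (M.PK K) := by
    rw [tracePairing_one]
    exact Finset.single_le_sum (f := fun i => (M.PK K i).trace)
      (fun i _ => (hK.PK_posSemidef i).trace_nonneg) (Finset.mem_univ i)
  have hcost : M.mu * tracePairing 1 (M.PK K) ≤ M.cost K := by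
    rw [hK.cost_eq_tracePairing_PK, tracePairing_comm _ M.X0]
    exact mul_tracePairing_one_le M.mu_mul_le_X0 hK.PK_posSemidef
  refine (dotProduct_mulVec_le_trace_mul (hK.PK_posSemidef i) v).trans
    (mul_le_mul_of_nonneg_right ?_ (dotProduct_self_nonneg v))
  rw [le_div_iff₀ M.mu_pos, mul_comm]
  exact (mul_le_mul_of_nonneg_left htrace M.mu_pos.le).trans (hcost.trans hα)

lemma Psi_quadForm_le (i : Fin N) (w : Fin k → ℝ) :
    w ⬝ᵥ M.Psi K i *ᵥ w ≤ (normMax M.R + normMax M.B ^ 2 * (α / M.mu)) * (w ⬝ᵥ w) := by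
  have hR := dotProduct_mulVec_le_normMax M.R i w
  have hP := (le_abs_self _).trans (abs_opE_quadForm_le (M := M) (fun i v => by
    rw [abs_of_nonneg (quadForm_nonneg (hK.PK_posSemidef i) v)]
    exact hK.PK_quadForm_le hα i v) i (M.B i *ᵥ w))
  have hB := mul_le_mul_of_nonneg_left (mulVec_dotProduct_mulVec_le_normMax M.B i w)
    (div_nonneg (ENNReal.toReal_nonneg.trans hα) M.mu_pos.le)
  rw [dotProduct_Psi_mulVec]
  linarith

lemma Psi_add_PK_quadForm_le (hE : ‖E‖ ≤ 1) (i : Fin N) (v : Fin d → ℝ) :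
    (E.mat i *ᵥ v) ⬝ᵥ M.Psi K i *ᵥ (E.mat i *ᵥ v) + v ⬝ᵥ M.PK K i *ᵥ v ≤
      (M.xi α + 1) * (v ⬝ᵥ M.Q i *ᵥ v) := by
  have hα0 : 0 ≤ α := ENNReal.toReal_nonneg.trans hα
  have hmu := M.mu_pos
  have hR := normMax_nonneg M.R
  have hQ := lamMin_mul_le_quadForm (fun i => (M.Q_posDef i).posSemidef) i v
  have hlam := M.lamMin_Q_pos
  calc (E.mat i *ᵥ v) ⬝ᵥ M.Psi K i *ᵥ (E.mat i *ᵥ v) + v ⬝ᵥ M.PK K i *ᵥ v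
      ≤ (normMax M.R + normMax M.B ^ 2 * (α / M.mu)) * (v ⬝ᵥ v) + α / M.mu * (v ⬝ᵥ v) := by
        refine add_le_add ((hK.Psi_quadForm_le hα i _).trans ?_) (hK.PK_quadForm_le hα i v)
        exact mul_le_mul_of_nonneg_left (mat_mulVec_dotProduct_le hE i v) (by positivity)
    _ = ((1 + normMax M.B ^ 2) / M.mu * α + normMax M.R) / lamMin M.Q *
          (lamMin M.Q * (v ⬝ᵥ v)) := by
        field_simp
        ring
    _ ≤ ((1 + normMax M.B ^ 2) / M.mu * α + normMax M.R) / lamMin M.Q *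
          (v ⬝ᵥ M.Q i *ᵥ v) := mul_le_mul_of_nonneg_left hQ (by positivity)
    _ = (M.xi α + 1) * (v ⬝ᵥ M.Q i *ᵥ v) := by
        rw [xi]
        ring

lemma abs_symDir_quadForm_le_xi (hE : ‖E‖ ≤ 1) (i : Fin N) (v : Fin d → ℝ) :
    |v ⬝ᵥ M.symDir K E i *ᵥ v| ≤ M.xi α * (v ⬝ᵥ M.Q i *ᵥ v) := by
  have habs := hK.abs_symDir_quadForm_le E i v
  have hxi := hK.Psi_add_PK_quadForm_le hα hE i v
  linarith

lemma xi_nonneg : 0 ≤ M.xi α := by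
  have := M.neZero_modes
  have hbound := (abs_nonneg _).trans
    (hK.abs_symDir_quadForm_le_xi hα (E := 0) (by simp) 0 (Pi.single 0 1))
  have hQ := (M.Q_posDef 0).dotProduct_mulVec_pos (x := Pi.single 0 1) (by simp)
  exact nonneg_of_mul_nonneg_left hbound hQ

section

variable (hE : ‖E‖ ≤ 1)
include hE

lemma tracePairing_Psi_le :
    tracePairing (fun i => (E.mat i)ᵀ * M.Psi K i * E.mat i) (M.XK K) ≤
      (normMax M.R + normMax M.B ^ 2 * (α / M.mu)) * tracePairing 1 (M.XK K) := by
  have hα0 : 0 ≤ α := ENNReal.toReal_nonneg.trans hα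
  have hmu := M.mu_pos
  have hR := normMax_nonneg M.R
  refine tracePairing_le_mul_one (fun i v => ?_) hK.XK_posSemidef
  rw [dotProduct_transpose_mul_mul_mulVec]
  exact (hK.Psi_quadForm_le hα i _).trans
    (mul_le_mul_of_nonneg_left (mat_mulVec_dotProduct_le hE i v) (by positivity))

variable {P : Fin N → Matrix (Fin d) (Fin d) ℝ} (hP : P = M.symDir K E + lyapOp M.p (M.Γ K) P)
include hP

lemma abs_sensitivity_quadForm_le (i : Fin N) (v : Fin d → ℝ) :
    |v ⬝ᵥ P i *ᵥ v| ≤ M.xi α * (α / M.mu) * (v ⬝ᵥ v) := by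
  have hxi := hK.xi_nonneg hα
  have hscaled : M.xi α • M.PK K =
      M.xi α • M.stageMat K + lyapOp M.p (M.Γ K) (M.xi α • M.PK K) := by
    rw [map_smul, ← smul_add, ← hK.PK_eq]
  have hsource (i : Fin N) (v : Fin d → ℝ) :
      |v ⬝ᵥ M.symDir K E i *ᵥ v| ≤ v ⬝ᵥ (M.xi α • M.stageMat K) i *ᵥ v := by
    rw [Pi.smul_apply, smul_mulVec, dotProduct_smul, smul_eq_mul]
    exact (hK.abs_symDir_quadForm_le_xi hα hE i v).trans
      (mul_le_mul_of_nonneg_left (M.Q_le_stageMat K i v) hxi)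
  have hcomparison :=
    hK.isStable.abs_quadForm_le_of_eq_add_lyapOp M.p_nonneg hP hscaled hsource i v
  rw [Pi.smul_apply, smul_mulVec, dotProduct_smul, smul_eq_mul] at hcomparison
  rw [mul_assoc]
  exact hcomparison.trans (mul_le_mul_of_nonneg_left (hK.PK_quadForm_le hα i v) hxi)

lemma abs_lyapCross_quadForm_le (i : Fin N) (v : Fin d → ℝ) :
    |v ⬝ᵥ lyapCross M.p (fun i => M.B i * E.mat i) (M.Γ K) P i *ᵥ v| ≤
      normMax M.B * (M.xi α * (α / M.mu)) / 2 *
        (v ⬝ᵥ v + (M.Γ K i *ᵥ v) ⬝ᵥ (M.Γ K i *ᵥ v)) := by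
  have hPsymm := hK.isStable.transpose_eq_self hP fun _ => symDir_transpose _
  have hopE : (M.opE P i)ᵀ = M.opE P i := by
    simp only [opE, transpose_sum, transpose_smul, hPsymm]
  have hBE : ((M.B i * E.mat i) *ᵥ v) ⬝ᵥ ((M.B i * E.mat i) *ᵥ v) ≤ normMax M.B ^ 2 * (v ⬝ᵥ v) := by
    rw [← mulVec_mulVec]
    exact (mulVec_dotProduct_mulVec_le_normMax M.B i _).trans
      (mul_le_mul_of_nonneg_left (mat_mulVec_dotProduct_le hE i v) (sq_nonneg _))
  rw [dotProduct_lyapCross_mulVec]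
  exact abs_dotProduct_mulVec_le_of_sq_le hopE
    (abs_opE_quadForm_le (hK.abs_sensitivity_quadForm_le hα hE hP) i)
    (mul_nonneg (hK.xi_nonneg hα) (div_nonneg (ENNReal.toReal_nonneg.trans hα) M.mu_pos.le))
    (normMax_nonneg _) hBE _

lemma abs_tracePairing_lyapCross_le :
    |tracePairing (lyapCross M.p (fun i => M.B i * E.mat i) (M.Γ K) P) (M.XK K)| ≤
      normMax M.B * (M.xi α * (α / M.mu)) * tracePairing 1 (M.XK K) := by
  set b := normMax M.B * (M.xi α * (α / M.mu)) / 2 with hb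
  have hb0 : 0 ≤ b := by
    have := hK.xi_nonneg hα
    have := normMax_nonneg M.B
    have := M.mu_pos
    have : 0 ≤ α := ENNReal.toReal_nonneg.trans hα
    positivity
  have hΓ : tracePairing (lyapOp M.p (M.Γ K) 1) (M.XK K) ≤ tracePairing 1 (M.XK K) :=
    tracePairing_lyapOp_le hK.XK_eq (fun _ => quadForm_nonneg .one) M.X0_posSemidef
  have hΓ_apply (i : Fin N) : lyapOp M.p (M.Γ K) 1 i = (M.Γ K i)ᵀ * M.Γ K i := by
    simp only [lyapOp_apply, Pi.one_apply, ← Finset.sum_smul, M.p_sum, one_smul, Matrix.mul_one]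
  have hpairing : |tracePairing (lyapCross M.p (fun i => M.B i * E.mat i) (M.Γ K) P) (M.XK K)| ≤
      tracePairing (b • (1 + lyapOp M.p (M.Γ K) 1)) (M.XK K) := by
    refine abs_tracePairing_le (fun i v => ?_) hK.XK_posSemidef
    rw [Pi.smul_apply, Pi.add_apply, hΓ_apply, smul_mulVec, dotProduct_smul, add_mulVec,
      dotProduct_add, dotProduct_transpose_mul_mulVec, Pi.one_apply, one_mulVec, smul_eq_mul]
    exact hK.abs_lyapCross_quadForm_le hα hE hP i v
  rw [map_smul, map_add, LinearMap.smul_apply, LinearMap.add_apply, smul_eq_mul] at hpairing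
  calc _ ≤ b * (tracePairing 1 (M.XK K) + tracePairing (lyapOp M.p (M.Γ K) 1) (M.XK K)) := hpairing
    _ ≤ b * (tracePairing 1 (M.XK K) + tracePairing 1 (M.XK K)) := by gcongr
    _ = normMax M.B * (M.xi α * (α / M.mu)) * tracePairing 1 (M.XK K) := by rw [hb]; ring

end

lemma abs_inner_hessian_cost_le (hE : ‖E‖ ≤ 1) :
    |inner ℝ (fderiv ℝ (∇ M.cost) K E) E| ≤ M.smoothConst α := by
  obtain ⟨P, hP, -⟩ := hK.isStable.existsUnique_eq_add_lyapOp (M.symDir K E)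
  have hα0 : 0 ≤ α := ENNReal.toReal_nonneg.trans hα
  have hmu := M.mu_pos
  have hR := normMax_nonneg M.R
  have hB := normMax_nonneg M.B
  have hxi := hK.xi_nonneg hα
  have hPsi : 0 ≤ tracePairing (fun i => (E.mat i)ᵀ * M.Psi K i * E.mat i) (M.XK K) :=
    tracePairing_nonneg (fun i v => by
      rw [dotProduct_transpose_mul_mul_mulVec]
      exact quadForm_nonneg (hK.Psi_posDef i).posSemidef _) hK.XK_posSemidef
  have hPsi_le := hK.tracePairing_Psi_le hα hE
  rw [hK.inner_hessian_cost hP]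
  calc _ ≤ 2 * tracePairing (fun i => (E.mat i)ᵀ * M.Psi K i * E.mat i) (M.XK K) +
        4 * |tracePairing (lyapCross M.p (fun i => M.B i * E.mat i) (M.Γ K) P) (M.XK K)| := by
        refine (abs_sub _ _).trans_eq ?_
        rw [abs_mul, abs_mul, abs_of_nonneg hPsi, abs_two,
          abs_of_nonneg (by norm_num : (0 : ℝ) ≤ 4)]
    _ ≤ (2 * (normMax M.R + normMax M.B ^ 2 * (α / M.mu)) +
          4 * (normMax M.B * (M.xi α * (α / M.mu)))) * tracePairing 1 (M.XK K) := by
        linarith [hK.abs_tracePairing_lyapCross_le hα hE hP]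
    _ ≤ (2 * (normMax M.R + normMax M.B ^ 2 * (α / M.mu)) +
          4 * (normMax M.B * (M.xi α * (α / M.mu)))) * (α / lamMin M.Q) :=
        mul_le_mul_of_nonneg_left (hK.tracePairing_one_XK_le hα) (by positivity)
    _ = M.smoothConst α := (M.smoothConst_eq α).symm

lemma norm_hessian_cost_le : ‖fderiv ℝ (∇ M.cost) K‖ ≤ M.smoothConst α :=
  norm_le_of_abs_inner_le (isSymmetric_fderiv_gradient hK.contDiffAt_cost)
    ((abs_nonneg _).trans (hK.abs_inner_hessian_cost_le hα (E := 0) (by simp)))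
    fun _ hE => hK.abs_inner_hessian_cost_le hα hE.le

end IsMSS

end Bounds

end CostHessian

/-! ### Optimal policies and gradient dominance -/

section OptimalPolicies

variable {N d k : ℕ} {Ω : Type*} [MeasurableSpace Ω] {M : MJLS N d k Ω} {K K' : Policy N k d}

section Optimal

lemma exists_isOptimal [NeZero d] [NeZero k] (h : M.stabSet.Nonempty) : ∃ K, M.IsOptimal K := by
  obtain ⟨K₀, hK₀⟩ := h
  have hcont : ContinuousOn M.cost (M.sublevel (M.cost K₀)) := fun K hK =>
    (IsMSS.contDiffAt_cost (r := 0) hK.1).continuousAt.continuousWithinAt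
  obtain ⟨K, hK, hmin⟩ := (M.isCompact_sublevel _).exists_isMinOn ⟨K₀, hK₀, le_rfl⟩ hcont
  refine ⟨K, hK.1, fun K' hK' => ?_⟩
  rcases le_total (M.cost K') (M.cost K₀) with h | h
  · exact hmin ⟨hK', h⟩
  · exact hK.2.trans h

namespace IsOptimal

lemma gradient_eq_zero (hK : M.IsOptimal K) : ∇ M.cost K = 0 := by
  have hmin : IsLocalMin M.cost K :=
    (IsMSS.eventually hK.1).mono fun K' hK' => hK.2 K' hK'
  rw [gradient, hmin.fderiv_eq_zero, map_zero]

lemma LK_eq_zero [NeZero d] (hK : M.IsOptimal K) : M.LK K = 0 := by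
  have hs : M.IsMSS K := hK.1
  have hgrad := hs.norm_gradient_sq
  rw [hK.gradient_eq_zero, norm_zero, zero_pow two_ne_zero] at hgrad
  have hbound := sq_mul_tupleInner_le (M.LK K) hs.XK_transpose M.mu_pos.le hs.mu_mul_le_XK
  have hnorm : tupleInner (M.LK K) (M.LK K) = ‖ofMat (M.LK K)‖ ^ 2 :=
    (norm_sq_eq_tupleInner (ofMat (M.LK K))).symm
  rw [hnorm] at hbound
  have hle : M.mu ^ 2 * ‖ofMat (M.LK K)‖ ^ 2 ≤ 0 := by linarith
  have hzero : ofMat (M.LK K) = 0 := by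
    have := M.mu_pos
    rw [← norm_eq_zero, ← sq_nonpos_iff]
    exact nonpos_of_mul_nonpos_right hle (by positivity)
  exact congrArg Policy.mat hzero

lemma mul_norm_sub_sq_le [NeZero d] (hK : M.IsOptimal K) (hK' : M.IsMSS K') :
    M.mu * lamMin M.R * ‖K - K'‖ ^ 2 ≤ M.cost K' - M.cost K := by
  have hs : M.IsMSS K := hK.1
  have hlinear : (fun i => ((K - K').mat i)ᵀ * M.LK K i) = 0 := by
    funext i
    rw [hK.LK_eq_zero, Pi.zero_apply, Matrix.mul_zero, Pi.zero_apply]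
  rw [hs.cost_sub_cost hK', hlinear, map_zero, LinearMap.zero_apply, mul_zero, zero_add]
  refine hK'.mul_norm_sq_le_tracePairing_XK (fun i => ?_) fun i v => ?_
  · simpa only [conjTranspose_eq_transpose_of_trivial] using
      (hs.Psi_posDef i).posSemidef.conjTranspose_mul_mul_same ((K - K').mat i)
  · rw [dotProduct_transpose_mul_mul_mulVec]
    exact hs.lamMin_R_mul_le_Psi i _

lemma eq [NeZero d] [NeZero k] (hK : M.IsOptimal K) (hK' : M.IsOptimal K') : K = K' := by
  have hle := (hK.mul_norm_sub_sq_le hK'.1).trans (sub_nonpos.2 (hK'.2 K hK.1))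
  have hnorm := nonpos_of_mul_nonpos_right hle (mul_pos M.mu_pos M.lamMin_R_pos)
  rwa [sq_nonpos_iff, norm_eq_zero, sub_eq_zero] at hnorm

end IsOptimal

lemma existsUnique_isOptimal [NeZero d] [NeZero k] (h : M.stabSet.Nonempty) :
    ∃! K, M.IsOptimal K := by
  obtain ⟨K, hK⟩ := exists_isOptimal h
  exact ⟨K, hK, fun K' hK' => hK'.eq hK⟩

end Optimal

section Bounds

namespace IsMSS

lemma tupleInner_inv_Psi_mul_LK_le [NeZero k] (hK : M.IsMSS K) :
    tupleInner (fun i => (M.Psi K i)⁻¹ * M.LK K i) (M.LK K) ≤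
      tupleInner (M.LK K) (M.LK K) / lamMin M.R := by
  rw [le_div_iff₀ M.lamMin_R_pos, mul_comm]
  exact mul_tupleInner_inv_mul_le _ hK.Psi_posDef M.lamMin_R_pos.le hK.lamMin_R_mul_le_Psi

lemma tupleInner_LK_le_norm_gradient_sq [NeZero d] (hK : M.IsMSS K) :
    tupleInner (M.LK K) (M.LK K) ≤ ‖∇ M.cost K‖ ^ 2 / (4 * M.mu ^ 2) := by
  have hmu := M.mu_pos
  rw [hK.norm_gradient_sq, le_div_iff₀ (by positivity)]
  linarith [sq_mul_tupleInner_le (M.LK K) hK.XK_transpose hmu.le hK.mu_mul_le_XK]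

lemma gradient_dominance [NeZero d] [NeZero k] (hK : M.IsMSS K) (hK' : M.IsMSS K') :
    M.cost K - M.cost K' ≤ normMax (M.XK K') *
      tupleInner (fun i => (M.Psi K i)⁻¹ * M.LK K i) (M.LK K) ∧
    normMax (M.XK K') * tupleInner (fun i => (M.Psi K i)⁻¹ * M.LK K i) (M.LK K) ≤
      normMax (M.XK K') / lamMin M.R * tupleInner (M.LK K) (M.LK K) ∧
    normMax (M.XK K') / lamMin M.R * tupleInner (M.LK K) (M.LK K) ≤
      normMax (M.XK K') / (4 * M.mu ^ 2 * lamMin M.R) * ‖∇ M.cost K‖ ^ 2 := by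
  have hX := normMax_nonneg (M.XK K')
  have hR := M.lamMin_R_pos
  refine ⟨hK.cost_sub_le hK', ?_, ?_⟩
  · rw [div_mul_eq_mul_div, mul_div_assoc]
    exact mul_le_mul_of_nonneg_left hK.tupleInner_inv_Psi_mul_LK_le hX
  · calc _ ≤ normMax (M.XK K') / lamMin M.R * (‖∇ M.cost K‖ ^ 2 / (4 * M.mu ^ 2)) :=
        mul_le_mul_of_nonneg_left hK.tupleInner_LK_le_norm_gradient_sq (by positivity)
      _ = normMax (M.XK K') / (4 * M.mu ^ 2 * lamMin M.R) * ‖∇ M.cost K‖ ^ 2 := by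
        rw [div_mul_div_comm, mul_comm (lamMin M.R), mul_div_right_comm]

end IsMSS

lemma cost_le_of_segment_subset_sublevel [NeZero d] {α : ℝ}
    (h : ∀ t ∈ Set.Icc (0 : ℝ) 1, t • K + (1 - t) • K' ∈ M.sublevel α) :
    M.cost K' ≤ M.cost K + inner ℝ (∇ M.cost K) (K' - K) +
      M.smoothConst α / 2 * ‖K' - K‖ ^ 2 := by
  have hmem (t : ℝ) (ht : t ∈ Set.Icc (0 : ℝ) 1) : K + t • (K' - K) ∈ M.sublevel α := by
    convert h (1 - t) ⟨sub_nonneg.2 ht.2, sub_le_self 1 ht.1⟩ using 1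
    module
  exact le_add_inner_gradient_add_of_norm_hessian_le
    (fun t ht => IsMSS.contDiffAt_cost (hmem t ht).1)
    fun t ht => IsMSS.norm_hessian_cost_le (hmem t ht).1 (hmem t ht).2

end Bounds

end OptimalPolicies

end MJLS

end

theorem mainTheorem4 {N d k : ℕ} [NeZero d] [NeZero k] {Ω : Type*} [MeasurableSpace Ω]
    (M : MJLS N d k Ω)
    -- the system is mean-square stabilizable
    (hstab : M.stabSet.Nonempty) :
    -- the objects in the statement are well defined on the stabilizing set
    (∀ K ∈ M.stabSet,
      M.extCost K ≠ ⊤ ∧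
      (∃! P, M.IsLyapunov K P) ∧
      M.cost K = ∫ a, M.x0 a ⬝ᵥ ((∑ i, M.π i • M.PK K i) *ᵥ M.x0 a) ∂M.Pr ∧
      (∀ i α β, Summable fun t => M.corr K t i α β) ∧
      ContDiffAt ℝ 2 M.cost K) ∧
    (∃! Ks, M.IsOptimal Ks) ∧
    0 < M.mu ∧
    -- coercivity
    (∀ Kseq : ℕ → MJLS.Policy N k d, (∀ l, Kseq l ∈ M.stabSet) →
      (Tendsto (fun l => ‖Kseq l‖) atTop atTop ∨
        ∃ K ∈ frontier M.stabSet, Tendsto Kseq atTop (𝓝 K)) →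
      Tendsto (fun l => M.cost (Kseq l)) atTop atTop) ∧
    -- almost smoothness
    (∀ K ∈ M.stabSet, ∀ K' ∈ M.stabSet,
      M.cost K' - M.cost K =
        ∑ i, (-2 * (M.XK K' i * ((K - K').mat i)ᵀ * M.LK K i).trace +
          (M.XK K' i * ((K - K').mat i)ᵀ * M.Psi K i * (K - K').mat i).trace) ∧
      M.cost K' - M.cost K =
        -2 * MJLS.tupleInner (fun i => ((K - K').mat i)ᵀ * M.LK K i) (M.XK K') +
          MJLS.tupleInner (fun i => ((K - K').mat i)ᵀ * M.Psi K i * (K - K').mat i) (M.XK K')) ∧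
    -- gradient dominance
    (∀ Ks, M.IsOptimal Ks → ∀ K ∈ M.stabSet,
      M.cost K - M.cost Ks ≤
        MJLS.normMax (M.XK Ks) *
          MJLS.tupleInner (fun i => (M.Psi K i)⁻¹ * M.LK K i) (M.LK K) ∧
      MJLS.normMax (M.XK Ks) * MJLS.tupleInner (fun i => (M.Psi K i)⁻¹ * M.LK K i) (M.LK K) ≤
        MJLS.normMax (M.XK Ks) / MJLS.lamMin M.R * MJLS.tupleInner (M.LK K) (M.LK K) ∧
      MJLS.normMax (M.XK Ks) / MJLS.lamMin M.R * MJLS.tupleInner (M.LK K) (M.LK K) ≤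
        MJLS.normMax (M.XK Ks) / (4 * M.mu ^ 2 * MJLS.lamMin M.R) * ‖∇ M.cost K‖ ^ 2) ∧
    -- compactness of the sublevel sets
    (∀ Ks, M.IsOptimal Ks → ∀ α, M.cost Ks ≤ α → IsCompact (M.sublevel α)) ∧
    -- smoothness on the sublevel sets
    (∀ α : ℝ,
      (∀ K ∈ M.sublevel α, ‖fderiv ℝ (∇ M.cost) K‖ ≤ M.smoothConst α) ∧
      (∀ K K' : MJLS.Policy N k d,
        (∀ t ∈ Set.Icc (0 : ℝ) 1, t • K + (1 - t) • K' ∈ M.sublevel α) →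
        M.cost K' ≤ M.cost K + inner ℝ (∇ M.cost K) (K' - K) +
          M.smoothConst α / 2 * ‖K' - K‖ ^ 2)) := by
  refine ⟨fun K (hK : M.IsMSS K) => ⟨hK.extCost_ne_top, hK.existsUnique_isLyapunov,
    hK.cost_eq_integral, hK.summable_corr, hK.contDiffAt_cost⟩,
    MJLS.existsUnique_isOptimal hstab, M.mu_pos, ?coercivity, ?almostSmoothness,
    fun Ks hKs K hK => MJLS.IsMSS.gradient_dominance hK hKs.1,
    fun _ _ α _ => M.isCompact_sublevel α, fun α => ⟨?hessian, ?segment⟩⟩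
  case coercivity =>
    rintro Kseq hKseq (hnorm | ⟨K, hK, hlim⟩)
    · exact M.tendsto_cost_of_tendsto_norm hKseq hnorm
    · exact M.tendsto_cost_of_tendsto_frontier hKseq hK hlim
  case almostSmoothness =>
    exact fun K (hK : M.IsMSS K) K' hK' =>
      ⟨hK.cost_sub_cost_trace hK', hK.cost_sub_cost_tupleInner hK'⟩
  case hessian => exact fun K hK => MJLS.IsMSS.norm_hessian_cost_le hK.1 hK.2
  case segment => exact fun K K' => MJLS.cost_le_of_segment_subset_sublevel
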